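/- **Setting.** Let $X$ be a finite set with $|X|=t$. For $0\le m\le t$ let $M^{t-m,m}(X)$ be the space of complex functions on the set of $m$-subsets of $X$, with scalar product $\langle f_1,f_2\rangle=\sum_\omega f_1(\omega)\overline{f_2(\omega)}$, and let $\delta_A$ be the Dirac function at $A$. Put $d\delta_A=\sum_{x\in A}\delta_{A\setminus\{x\}}$, $d^*\delta_A=\sum_{x\in X\setminus A}\delta_{A\cup\{x\}}$, $R_q=(d^*)^q/q!$ and $S^{t-k,k}(X)=M^{t-k,k}(X)\cap\ker d$. Write $M^{n-m,m}$ and $S^{n-k,k}$ when $X=\{1,\dots,n\}$. Let $\sigma_m(X)$ be the characteristic function of the set of all $m$-subsets of $X$. For disjoint sets $A,B$, tensor products of functions of subsets of $A$ and of $B$ are regarded as functions of subsets of $A\cup B$ through $\delta_Y\otimes\delta_Z=\delta_{Y\cup Z}$. The Hahn polynomials are $$E_m(a,b,c,x)=\sum_{j=\max\{0,x-c+m\}}^{\min\{m,x\}}(-1)^j\binom mj(b-m+1)_j(-x)_j(a-m+1)_{m-j}(x-c)_{m-j},\qquad (y)_k=y(y+1)\cdots(y+k-1).$$ Let $\mathbf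 a=(a_1,\dots,a_h)$ be a composition of $n$ into positive parts, let $A_1,\dots,A_h$ be the consecutive intervals of lengths $a_1,\dots,a_h$ in $\{1,\dots,n\}$, and let $S_{\mathbf a}=S_{a_1}\times\cdots\times S_{a_h}\le S_n$ be the stabilizer of all of them. Let $\mathcal T$ be a finite planar rooted binary tree (every internal vertex has a left and a right son) with $h$ leaves, the leaves being attached from left to right to $A_1,\dots,A_h$. Attach to each vertex the union of the intervals of the leaves below it; the size of the vertex is the number of elements of this union. Let $L$ be the height of $\mathcal T$, and let $0\le m\le n$. A *representation labeling* $\mathcal T_{\rm r}(\mathbf k)$ assigns a nonnegative integer to each vertex, so that leaves have label $0$, the label $k$ of the root satisfies $k\le\min\{n-m,m\}$, and at each internal vertex with label $k$, whose left and right sons have labels $i,j$ and sizes $a,b$, $$0\le i\le a/2,\quad 0\le j\le b/2,\quad k-a\le j-i\le b-k,\quad i+j\le k .$$ The function $\Phi(\mathcal T(\mathbf a),m,\mathcal T_{\rm r}(\mathbf k))\in M^{n-m,m}$ is defined recursively: for a single leaf with interval $A_r$ it is $\sigma_m(A_r)$; for a tree whose root has label $k$, with left and right subtrees $\mathcal T',\mathcal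 T''$ of sizes $a,b$ and root labels $i,j$, $$\Phi(\mathcal T,m)=\sum_{w=\max\{j,i-a+m\}}^{\min\{b-j,m-i\}}E_{k-i-j}(b-2j,a-2i,m-i-j,w-j)\,\Phi(\mathcal T',m-w)\otimes\Phi(\mathcal T'',w).$$ For $0\le q\le L$ let the level-$q$ frontier consist of the vertices at distance $q$ from the root and the leaves at distance less than $q$, and let $K_q\le S_n$ be the stabilizer of the sets attached to all vertices of the frontier; thus $S_n=K_0\ge K_1\ge\cdots\ge K_L=S_{\mathbf a}$. Let $V_q$ be the representation $\bigotimes_v S^{t_v-k_v,k_v}(X_v)$ of $K_q$, where $v$ runs over the level-$q$ frontier and $X_v,t_v,k_v$ are its attached set, size and label. **Theorem.** 1. For each representation labeling $\mathcal T_{\rm r}(\mathbf k)$ with root label $k$ there is exactly one chain of subspaces $S^{n-k,k}=W_0\supseteq W_1\supseteq\cdots\supseteq W_L$ such that, for $1\le q\le L$, $W_q$ is $K_q$-stable and isomorphic to $V_q$ as a representation of $K_q$. Denote $W_L$ by $[S^{(a_1)}\otimes\cdots\otimes S^{(a_h)}]_{\mathcal T_{\rm r}(\mathbf k)}$. Then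 $$\Phi(\mathcal T(\mathbf a),m,\mathcal T_{\rm r}(\mathbf k))\in R_{m-k}\bigl[S^{(a_1)}\otimes\cdots\otimes S^{(a_h)}\bigr]_{\mathcal T_{\rm r}(\mathbf k)}\subseteq R_{m-k}S^{n-k,k}\subseteq M^{n-m,m}.$$ 2. The functions $\Phi(\mathcal T(\mathbf a),m,\mathcal T_{\rm r}(\mathbf k))$, as $\mathcal T_{\rm r}(\mathbf k)$ varies over all representation labelings, are linearly independent, pairwise orthogonal, and span the space of $S_{\mathbf a}$-invariant functions in $M^{n-m,m}$; that is, they form an orthogonal basis of it. -/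

import Mathlib

namespace HahnTree

open scoped Pointwise

noncomputable section

/-! ### Hahn polynomials -/

/-- The Hahn polynomial (in Dunkl's normalization)
`E_m(a,b,c,x) = ∑_{j = max(0, x-c+m)}^{min(m,x)} (-1)^j C(m,j) (b-m+1)_j (-x)_j (a-m+1)_{m-j} (x-c)_{m-j}`,
where `(y)_k = y (y+1) ⋯ (y+k-1)`. -/
def hahnE (m : ℕ) (a b c x : ℤ) : ℤ :=
  ∑ j ∈ (Finset.range (m + 1)).filter (fun j : ℕ => x - c + m ≤ j ∧ (j : ℤ) ≤ x),
    (-1) ^ j * (m.choose j : ℤ) * (ascPochhammer ℤ j).eval (b - m + 1)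
      * (ascPochhammer ℤ j).eval (-x) * (ascPochhammer ℤ (m - j)).eval (a - m + 1)
      * (ascPochhammer ℤ (m - j)).eval (x - c)

/-! ### Functions on subsets, the modules `M^{t-m,m}(X)` and the Radon transforms

The ground set is `Fin n`. For `X ⊆ Fin n`, a function on the `m`-subsets of `X` is identified with
the function on all finite subsets of `Fin n` that extends it by zero. -/

/-- Complex functions on the collection of all subsets of `Fin n`. -/
abbrev Fun (n : ℕ) : Type := Finset (Fin n) → ℂ

variable {n : ℕ}

/-- `M^{t-m,m}(X)`, `t = |X|`: the functions on the set of `m`-subsets of `X`. -/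
def permModule (X : Finset (Fin n)) (m : ℕ) : Submodule ℂ (Fun n) where
  carrier := {f | ∀ Z, Z ∉ X.powersetCard m → f Z = 0}
  add_mem' hf hg Z hZ := by simp [hf Z hZ, hg Z hZ]
  zero_mem' _ _ := rfl
  smul_mem' c f hf Z hZ := by simp [hf Z hZ]

/-- The natural scalar product of `M^{n-m,m}`. -/
def scalarProd (m : ℕ) (f₁ f₂ : Fun n) : ℂ :=
  ∑ ω ∈ (Finset.univ : Finset (Fin n)).powersetCard m, f₁ ω * (starRingEnd ℂ) (f₂ ω)

/-- The Radon transform `d`, i.e. `d δ_A = ∑_{x ∈ A} δ_{A \ {x}}`. -/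
def radonD (n : ℕ) : Fun n →ₗ[ℂ] Fun n where
  toFun f Y := ∑ x ∈ Yᶜ, f (insert x Y)
  map_add' f g := by ext Y; simp [Finset.sum_add_distrib]
  map_smul' c f := by ext Y; simp [Finset.mul_sum]

/-- The Radon transform `d^*`, i.e. `d^* δ_A = ∑_{x ∉ A} δ_{A ∪ {x}}`. -/
def radonDStar (n : ℕ) : Fun n →ₗ[ℂ] Fun n where
  toFun f Y := ∑ x ∈ Y, f (Y.erase x)
  map_add' f g := by ext Y; simp [Finset.sum_add_distrib]
  map_smul' c f := by ext Y; simp [Finset.mul_sum]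

/-- `R_q = (d^*)^q / q!`. -/
def radonR (n q : ℕ) : Fun n →ₗ[ℂ] Fun n :=
  ((q.factorial : ℂ)⁻¹) • (radonDStar n) ^ q

/-- `S^{t-k,k}(X) = M^{t-k,k}(X) ∩ Ker d`, `t = |X|`. -/
def specht (X : Finset (Fin n)) (k : ℕ) : Submodule ℂ (Fun n) :=
  permModule X k ⊓ LinearMap.ker (radonD n)

/-- `σ_t(X)`: the characteristic function of the set of all `t`-subsets of `X`. -/
def sigma (X : Finset (Fin n)) (t : ℕ) : Fun n :=
  fun Z => if Z ∈ X.powersetCard t then 1 else 0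

/-- For disjoint `A`, `B`: the tensor product `φ ⊗ ψ` of a function `φ` of subsets of `A` and a
function `ψ` of subsets of `B`, as a function of subsets of `A ∪ B`, under the identification
`δ_X ⊗ δ_Y = δ_{X ∪ Y}`. -/
def tensor (A B : Finset (Fin n)) (φ ψ : Fun n) : Fun n :=
  fun Z => if Z ⊆ A ∪ B then φ (Z ∩ A) * ψ (Z ∩ B) else 0

/-- The tensor product `U ⊗ V` of a space `U` of functions of subsets of `A` and a space `V` of
functions of subsets of `B`. -/
def tensorSpace (A B : Finset (Fin n)) (U V : Submodule ℂ (Fun n)) : Submodule ℂ (Fun n) :=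
  Submodule.span ℂ {f | ∃ φ ∈ U, ∃ ψ ∈ V, f = tensor A B φ ψ}

/-! ### Group actions -/

/-- The permutation representation of `S_n`: `(g f)(Z) = f(g⁻¹ Z)`. -/
def permRep (n : ℕ) : Representation ℂ (Equiv.Perm (Fin n)) (Fun n) where
  toFun g :=
    { toFun := fun f Z => f (g⁻¹ • Z)
      map_add' := fun _ _ => rfl
      map_smul' := fun _ _ => rfl }
  map_one' := by ext f Z; simp
  map_mul' g h := by ext f Z; simp [mul_smul]

/-- The group of all permutations that map each of the given subsets onto itself. -/
def setwiseStabilizer (bs : Set (Finset (Fin n))) : Subgroup (Equiv.Perm (Fin n)) :=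
  ⨅ B ∈ bs, MulAction.stabilizer (Equiv.Perm (Fin n)) B

/-- `U` and `V` are stable under the group `K` (acting by the permutation representation) and
isomorphic as representations of `K`. -/
def IsoAsRep (K : Subgroup (Equiv.Perm (Fin n))) (U V : Submodule ℂ (Fun n)) : Prop :=
  ∃ e : U ≃ₗ[ℂ] V, ∀ g ∈ K, ∀ u : U, ∃ hu : permRep n g (u : Fun n) ∈ U,
    (e ⟨permRep n g (u : Fun n), hu⟩ : Fun n) = permRep n g (e u : Fun n)

/-- The interval of length `t` in `Fin n` whose first element is `s`. -/
def seg (n s t : ℕ) : Finset (Fin n) :=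
  Finset.univ.filter (fun x : Fin n => s ≤ (x : ℕ) ∧ (x : ℕ) < s + t)

/-- The Young subgroup `S_a = S_{a_1} × ⋯ × S_{a_h}`: the stabilizer of each of the consecutive
intervals `A_1, …, A_h` of lengths `a_1, …, a_h`. -/
def youngSubgroup (a : Composition n) : Subgroup (Equiv.Perm (Fin n)) :=
  setwiseStabilizer (Set.range fun j : Fin a.length => seg n (a.sizeUpTo j) (a.blocksFun j))

/-- The space of `S_a`-invariant functions in `M^{n-m,m}`. -/
def invariantSpace (a : Composition n) (m : ℕ) : Submodule ℂ (Fun n) where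
  carrier := {f | f ∈ permModule Finset.univ m ∧ ∀ g ∈ youngSubgroup a, permRep n g f = f}
  add_mem' hf hg := ⟨add_mem hf.1 hg.1, fun g hgK => by rw [map_add, hf.2 g hgK, hg.2 g hgK]⟩
  zero_mem' := ⟨zero_mem _, fun g _ => map_zero _⟩
  smul_mem' c _ hf := ⟨Submodule.smul_mem _ c hf.1, fun g hgK => by rw [map_smul, hf.2 g hgK]⟩

/-! ### Labeled trees -/

/-- A finite planar rooted binary tree (each internal vertex has a left son and a right son) whose
leaves are labeled by natural numbers. With leaves labeled `a_1, …, a_h` from left to right this is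
the composition-labeled tree `T(a)`: the composition label of a vertex lists the labels of the
leaves below it. -/
inductive LTree : Type
  | leaf (a : ℕ) : LTree
  | node (l r : LTree) : LTree

/-- The composition label of the root. -/
def LTree.parts : LTree → List ℕ
  | .leaf a => [a]
  | .node l r => l.parts ++ r.parts

/-- The sum of the parts of the composition label of the root. -/
def LTree.size : LTree → ℕ
  | .leaf a => a
  | .node l r => l.size + r.size

/-- The height of the tree. -/
def LTree.height : LTree → ℕ
  | .leaf _ => 0
  | .node l r => max l.height r.height + 1

/-- A labeling of the vertices of a tree by natural numbers in which every leaf has the label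
zero (so only the labels of internal vertices are recorded). -/
inductive Labeling : LTree → Type
  | leaf {a : ℕ} : Labeling (.leaf a)
  | node {l r : LTree} (k : ℕ) (κl : Labeling l) (κr : Labeling r) : Labeling (.node l r)

/-- The label of the root. -/
def Labeling.root : {T : LTree} → Labeling T → ℕ
  | _, .leaf => 0
  | _, .node k _ _ => k

/-- The conditions on the labels `k, i, j` of an internal vertex and of its left and right sons, with
`a`, `b` the sizes of the left and right subtrees: `0 ≤ i ≤ a/2`, `0 ≤ j ≤ b/2`,
`k - a ≤ j - i ≤ b - k` and `i + j ≤ k`, imposed at every internal vertex. -/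
def Labeling.Admissible : {T : LTree} → Labeling T → Prop
  | _, .leaf => True
  | _, .node (l := l) (r := r) k κl κr =>
      2 * κl.root ≤ l.size ∧ 2 * κr.root ≤ r.size ∧
      (k : ℤ) - l.size ≤ (κr.root : ℤ) - κl.root ∧
      (κr.root : ℤ) - κl.root ≤ (r.size : ℤ) - k ∧
      κl.root + κr.root ≤ k ∧ κl.Admissible ∧ κr.Admissible

/-- The representation labelings `T_r(k)` of `T(a)`, for the label `m` of the root in the spaces
labeling: admissible labelings whose root label satisfies `0 ≤ k ≤ min(n - m, m)`. -/
def RepLabeling (T : LTree) (m : ℕ) : Type :=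
  {κ : Labeling T // κ.Admissible ∧ κ.root ≤ m ∧ κ.root + m ≤ T.size}

/-- The function `Φ(T(a), m, T_r(k))`, for a tree placed on the interval of `Fin n` that starts at
`s` and has the size of the tree. For a leaf it is `σ_m`; for an internal vertex with label `k`
whose sons have the labels `i`, `j` and sizes `a`, `b` it is the sum over
`max(j, i-a+m) ≤ w ≤ min(b-j, m-i)` of
`E_{k-i-j}(b-2j, a-2i, m-i-j, w-j) Φ(T', m-w) ⊗ Φ(T'', w)`. -/
def treePhi (n : ℕ) : {T : LTree} → (s m : ℕ) → Labeling T → Fun n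
  | .leaf a, s, m, _ => sigma (seg n s a) m
  | .node l r, s, m, .node k κl κr =>
      ∑ w ∈ (Finset.range (m + 1)).filter (fun w =>
          κr.root ≤ w ∧ κl.root + m ≤ w + l.size ∧ w + κr.root ≤ r.size ∧ w + κl.root ≤ m),
        (hahnE (k - κl.root - κr.root) ((r.size : ℤ) - 2 * κr.root) ((l.size : ℤ) - 2 * κl.root)
            ((m : ℤ) - κl.root - κr.root) ((w : ℤ) - κr.root) : ℂ) •
          tensor (seg n s l.size) (seg n (s + l.size) r.size)
            (treePhi n s (m - w) κl) (treePhi n (s + l.size) w κr)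

/-- The intervals corresponding to the vertices at level `q` and to the leaves at levels below `q`,
for a tree placed on the interval that starts at `s`. -/
def levelBlocks (n : ℕ) : LTree → (s q : ℕ) → Set (Finset (Fin n))
  | .leaf a, s, _ => {seg n s a}
  | .node l r, s, 0 => {seg n s (l.size + r.size)}
  | .node l r, s, q + 1 => levelBlocks n l s q ∪ levelBlocks n r (s + l.size) q

/-- The `q`-th group of the chain `K_0 = S_n ≥ K_1 ≥ ⋯ ≥ K_L = S_a` associated with `T(a)`. -/
def chainGroup (n : ℕ) (T : LTree) (q : ℕ) : Subgroup (Equiv.Perm (Fin n)) :=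
  setwiseStabilizer (levelBlocks n T 0 q)

/-- The irreducible representation of `K_q` attached to a representation labeling: the tensor product
of the representations `S^{t-k,k}(X)`, where `X` runs over the intervals of the vertices at level `q`
and of the leaves at levels below `q`, `t = |X|`, and `k` is the label of the vertex. -/
def chainRep (n : ℕ) : {T : LTree} → (s q : ℕ) → Labeling T → Submodule ℂ (Fun n)
  | .leaf a, s, _, _ => specht (seg n s a) 0
  | .node l r, s, 0, .node k _ _ => specht (seg n s (l.size + r.size)) k
  | .node l r, s, q + 1, .node _ κl κr =>
      tensorSpace (seg n s l.size) (seg n (s + l.size) r.size)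
        (chainRep n s q κl) (chainRep n (s + l.size) q κr)

/-- `W` is the chain `W_0 = S^{n-k,k} ⊇ W_1 ⊇ ⋯ ⊇ W_L` (`L` the height of `T`) attached to the
representation labeling `κ` with root label `k`: `W_{q+1}` is a subspace of `W_q` that is stable
under `K_{q+1}` and isomorphic, as a representation of `K_{q+1}`, to the one determined by the labels. -/
def IsRepChain {T : LTree} (κ : Labeling T) (W : Fin (T.height + 1) → Submodule ℂ (Fun n)) : Prop :=
  W 0 = specht Finset.univ κ.root ∧
    ∀ q : Fin T.height, W q.succ ≤ W q.castSucc ∧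
      IsoAsRep (chainGroup n T (q + 1)) (W q.succ) (chainRep n 0 (q + 1) κ)

end

end HahnTree

open HahnTree

/-!
The functions on the subsets of `{1, …, n}` form the `n`-fold tensor power of a two-dimensional space,
on which `d`, `d^*` and their commutator span a copy of `sl₂`. For each set `X` of sites there are
such operators `lower X` and `raise X` that only act on the sites of `X`; they commute for disjoint
sets, and `lower (A ∪ B) = lower A + lower B`. All constructions are carried out with operators on the
one space `Fun n`, and tensor products only enter where the definitions mention them. Conditions on
a set `X` survive every operator that commutes with the one-site operators of `X` (`commAlg X`).

*Separation of types.* The Casimir operator `casOp X` of this `sl₂` equals the sum of all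
`permRep n (swap x y)` with `x, y ∈ X` (`casOp_eq_sum_swap`). It acts on `S^{t-k,k}(X)` by the scalar
`cas t k`, and different `k ≤ t/2` have different scalars (`cas_injective`). Since `casOp X`
comes from the group algebra, its eigenvalues are the same on isomorphic representations; since it is
self-adjoint, different eigenvalues give orthogonality.

*Clebsch–Gordan operators.* For disjoint `A`, `B` of sizes `a`, `b` and `N = k - i - j`, the operator
`cg A B N (a - 2i) (b - 2j)` is a combination of the `R_{N-x} ⊗ R_x`. The two-term recurrence of its
coefficients (`cgCoef_succ`) says that it maps `S^{a-i,i}(A) ⊗ S^{b-j,j}(B)` into `ker d`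
(`cg_mem_lowest`). It is injective, and its image consists of all lowest weight vectors of weight `k`
on which `casOp A` and `casOp B` have the right eigenvalues (`exists_cg_inverse`): such a vector is
determined by its component of the lowest weight on `B` (`eq_zero_of_proj_lowest`), which the
positivity of `raise * lower` yields. So multiplicity one is obtained without irreducibility or
characters.

*The chain.* Composing the Clebsch–Gordan operators of the vertices at levels less than `q` gives an
equivariant isomorphism (`treeOp`) from the tensor product at the frontier of level `q` onto
`chainSpace n 0 q κ`, the vectors of `S^{n-k,k}` whose Casimir eigenvalues at all vertices of
level at most `q` are the ones given by the labels. A subspace with the property of `W_{q+1}` has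
these eigenvalues and the same dimension, hence equals `chainSpace n 0 (q + 1) κ`
(`eq_chainSpace_of_isoAsRep`).

*The functions `Φ`.* Raising a Clebsch–Gordan vector multiplies its coefficients by binomial
coefficients, and the results are the Hahn polynomials (`hahnE_eq_sum`, `rdiv_mul_cg`). Consequently
`Φ(T, m, κ) = R_{m-k} v` with one vector `v = treeVec n s κ` of the last space of the chain
(`treePhi_eq`). This gives the membership, nonvanishing and, through the Casimir operators,
orthogonality. For the spanning property, an invariant function is by induction on the tree a
combination of tensor products of functions `Φ` of the two subtrees, and for fixed labels `i`, `j` the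
tensor products of weight `m` span the same space as the `Φ` with varying root label: both families
have the same size, and the latter is independent (`rdiv_rdiv_mem_span`).
-/

namespace HahnTree

open scoped Pointwise

variable {n : ℕ}

noncomputable section

/-! ### One-site operators -/

/-- The annihilation operator at the site `x`: `δ_A ↦ δ_{A \ {x}}` if `x ∈ A`, and `0` otherwise. -/
def ann (x : Fin n) : Module.End ℂ (Fun n) where
  toFun f Z := if x ∈ Z then 0 else f (insert x Z)
  map_add' f g := by ext Z; by_cases h : x ∈ Z <;> simp [h]
  map_smul' c f := by ext Z; by_cases h : x ∈ Z <;> simp [h]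

/-- The creation operator at the site `x`: `δ_A ↦ δ_{A ∪ {x}}` if `x ∉ A`, and `0` otherwise. -/
def cre (x : Fin n) : Module.End ℂ (Fun n) where
  toFun f Z := if x ∈ Z then f (Z.erase x) else 0
  map_add' f g := by ext Z; by_cases h : x ∈ Z <;> simp [h]
  map_smul' c f := by ext Z; by_cases h : x ∈ Z <;> simp [h]

theorem ann_apply (x : Fin n) (f : Fun n) (Z : Finset (Fin n)) :
    ann x f Z = if x ∈ Z then 0 else f (insert x Z) := rfl

theorem cre_apply (x : Fin n) (f : Fun n) (Z : Finset (Fin n)) :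
    cre x f Z = if x ∈ Z then f (Z.erase x) else 0 := rfl

theorem ann_mul_cre (x : Fin n) : ann x * cre x = 1 - cre x * ann x := by
  refine LinearMap.ext fun f => funext fun Z => ?_
  by_cases h : x ∈ Z <;> simp [ann_apply, cre_apply, h]

theorem cre_mul_cre (x : Fin n) : cre x * cre x = 0 := by
  refine LinearMap.ext fun f => funext fun Z => ?_
  by_cases h : x ∈ Z <;> simp [cre_apply, h]

theorem ann_mul_ann (x : Fin n) : ann x * ann x = 0 := by
  refine LinearMap.ext fun f => funext fun Z => ?_
  by_cases h : x ∈ Z <;> simp [ann_apply, h]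

theorem commute_ann_ann (x y : Fin n) : Commute (ann x) (ann y) := by
  rcases eq_or_ne x y with rfl | hxy
  · exact Commute.refl _
  refine LinearMap.ext fun f => funext fun Z => ?_
  by_cases h : x ∈ Z <;> by_cases h' : y ∈ Z <;>
    simp [ann_apply, h, h', hxy, hxy.symm, Finset.insert_comm]

theorem commute_cre_cre (x y : Fin n) : Commute (cre x) (cre y) := by
  rcases eq_or_ne x y with rfl | hxy
  · exact Commute.refl _
  refine LinearMap.ext fun f => funext fun Z => ?_
  by_cases h : x ∈ Z <;> by_cases h' : y ∈ Z <;>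
    simp [cre_apply, h, h', hxy, hxy.symm, Finset.erase_right_comm]

theorem commute_ann_cre {x y : Fin n} (hxy : x ≠ y) : Commute (ann x) (cre y) := by
  refine LinearMap.ext fun f => funext fun Z => ?_
  by_cases h : x ∈ Z <;> by_cases h' : y ∈ Z <;>
    simp [ann_apply, cre_apply, h, h', hxy, hxy.symm, Finset.erase_insert_of_ne]

theorem permRep_apply (g : Equiv.Perm (Fin n)) (f : Fun n) (Z : Finset (Fin n)) :
    permRep n g f Z = f (g⁻¹ • Z) := rfl

/-- Together with `permRep_mul_cre`, the source of all equivariance statements below. -/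
theorem permRep_mul_ann (g : Equiv.Perm (Fin n)) (x : Fin n) :
    permRep n g * ann x = ann (g x) * permRep n g := by
  refine LinearMap.ext fun f => funext fun Z => ?_
  have h : x ∈ g⁻¹ • Z ↔ g x ∈ Z := by
    rw [← Finset.smul_mem_smul_finset_iff g, smul_inv_smul, Equiv.Perm.smul_def]
  simp [permRep_apply, ann_apply, h, Finset.smul_finset_insert]

theorem smul_finset_erase (g : Equiv.Perm (Fin n)) (x : Fin n) (Z : Finset (Fin n)) :
    g • Z.erase x = (g • Z).erase (g x) := by
  rw [← Finset.sdiff_singleton_eq_erase, Finset.smul_finset_sdiff,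
    Finset.smul_finset_singleton, Finset.sdiff_singleton_eq_erase, Equiv.Perm.smul_def]

theorem permRep_mul_cre (g : Equiv.Perm (Fin n)) (x : Fin n) :
    permRep n g * cre x = cre (g x) * permRep n g := by
  refine LinearMap.ext fun f => funext fun Z => ?_
  have h : x ∈ g⁻¹ • Z ↔ g x ∈ Z := by
    rw [← Finset.smul_mem_smul_finset_iff g, smul_inv_smul, Equiv.Perm.smul_def]
  simp [permRep_apply, cre_apply, h, smul_finset_erase]

/-! ### Partial Radon transforms -/

/-- The Radon transform `d` in the elements of `A` only. -/
def lower (A : Finset (Fin n)) : Module.End ℂ (Fun n) := ∑ x ∈ A, ann x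

/-- The Radon transform `d^*` in the elements of `A` only. -/
def raise (A : Finset (Fin n)) : Module.End ℂ (Fun n) := ∑ x ∈ A, cre x

/-- Multiplication of `f` by `Z ↦ |Z ∩ A|`. -/
def count (A : Finset (Fin n)) : Module.End ℂ (Fun n) := ∑ x ∈ A, cre x * ann x

/-- The divided power `R_q = (d^*)^q / q!` in the elements of `A` only. -/
def rdiv (A : Finset (Fin n)) (q : ℕ) : Module.End ℂ (Fun n) :=
  ((q.factorial : ℂ)⁻¹) • raise A ^ q

/-- The Casimir operator of the `sl₂`-triple formed by `lower A`, `raise A` and their commutator,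
normalized so that it is the sum of all `permRep n (swap x y)`, `x, y ∈ A`. -/
def casOp (A : Finset (Fin n)) : Module.End ℂ (Fun n) :=
  (2 : ℂ) • (raise A * lower A) + count A ^ 2 + ((A.card : ℂ) • 1 - count A) ^ 2
    - (2 : ℂ) • count A

/-- The eigenvalue of `casOp A`, `|A| = t`, on `S^{t-k,k}(A)`. -/
def cas (t k : ℕ) : ℂ := (k : ℂ) ^ 2 + ((t : ℂ) - k) ^ 2 - 2 * k

/-- The restriction of a function to the sets `Z` with `|Z ∩ A| = w`. -/
def proj (A : Finset (Fin n)) (w : ℕ) : Module.End ℂ (Fun n) where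
  toFun f Z := if (Z ∩ A).card = w then f Z else 0
  map_add' f g := by ext Z; by_cases h : (Z ∩ A).card = w <;> simp [h]
  map_smul' c f := by ext Z; by_cases h : (Z ∩ A).card = w <;> simp [h]

theorem proj_apply (A : Finset (Fin n)) (w : ℕ) (f : Fun n) (Z : Finset (Fin n)) :
    proj A w f Z = if (Z ∩ A).card = w then f Z else 0 := rfl

theorem cre_mul_ann_apply (x : Fin n) (f : Fun n) (Z : Finset (Fin n)) :
    (cre x * ann x) f Z = if x ∈ Z then f Z else 0 := by
  by_cases h : x ∈ Z <;> simp [ann_apply, cre_apply, h]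

theorem count_apply (A : Finset (Fin n)) (f : Fun n) (Z : Finset (Fin n)) :
    count A f Z = ((Z ∩ A).card : ℂ) * f Z := by
  simp only [count, LinearMap.sum_apply, Finset.sum_apply, cre_mul_ann_apply]
  rw [← Finset.sum_filter, Finset.sum_const, nsmul_eq_mul, Finset.filter_mem_eq_inter,
    Finset.inter_comm]

theorem count_eq_smul_iff {A : Finset (Fin n)} {w : ℕ} {f : Fun n} :
    count A f = (w : ℂ) • f ↔ ∀ Z, (Z ∩ A).card ≠ w → f Z = 0 := by
  constructor
  · intro h Z hZ
    have := congrFun h Z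
    rw [count_apply, Pi.smul_apply, smul_eq_mul, ← sub_eq_zero, ← sub_mul] at this
    rcases mul_eq_zero.1 this with h' | h'
    · exact absurd (by exact_mod_cast sub_eq_zero.1 h') hZ
    · exact h'
  · intro h
    ext Z
    rw [count_apply, Pi.smul_apply, smul_eq_mul]
    by_cases hZ : (Z ∩ A).card = w
    · rw [hZ]
    · rw [h Z hZ, mul_zero, mul_zero]

theorem radonD_eq_lower : radonD n = lower Finset.univ := by
  refine LinearMap.ext fun f => funext fun Z => ?_
  simp only [lower, LinearMap.sum_apply, Finset.sum_apply, ann_apply]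
  rw [Finset.sum_ite, Finset.sum_const_zero, zero_add]
  exact Finset.sum_congr (by ext; simp) fun _ _ => rfl

theorem radonDStar_eq_raise : radonDStar n = raise Finset.univ := by
  refine LinearMap.ext fun f => funext fun Z => ?_
  simp only [raise, LinearMap.sum_apply, Finset.sum_apply, cre_apply]
  rw [Finset.sum_ite, Finset.sum_const_zero, add_zero]
  exact Finset.sum_congr (by ext; simp) fun _ _ => rfl

theorem radonR_eq_rdiv (q : ℕ) : radonR n q = rdiv Finset.univ q := by
  rw [radonR, rdiv, radonDStar_eq_raise]

/-! ### Locality -/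

/-- The operators that commute with the creation and annihilation operators at all sites of `C`.
The operators in `commAlg Xᶜ` are the ones that only act on the sites of `X`. -/
def commAlg (C : Finset (Fin n)) : Subalgebra ℂ (Module.End ℂ (Fun n)) :=
  Subalgebra.centralizer ℂ {T | ∃ x ∈ C, T = ann x ∨ T = cre x}

theorem mem_commAlg {C : Finset (Fin n)} {T : Module.End ℂ (Fun n)} :
    T ∈ commAlg C ↔ ∀ x ∈ C, Commute T (ann x) ∧ Commute T (cre x) := by
  rw [commAlg, Subalgebra.mem_centralizer_iff]
  constructor
  · exact fun h x hx => ⟨(h _ ⟨x, hx, .inl rfl⟩).symm, (h _ ⟨x, hx, .inr rfl⟩).symm⟩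
  · rintro h _ ⟨x, hx, rfl | rfl⟩
    exacts [(h x hx).1.symm.eq, (h x hx).2.symm.eq]

theorem commAlg_anti {C D : Finset (Fin n)} (h : C ⊆ D) : commAlg D ≤ commAlg C :=
  fun _ hT => mem_commAlg.2 fun x hx => mem_commAlg.1 hT x (h hx)

theorem ann_mem_commAlg {C : Finset (Fin n)} {x : Fin n} (h : x ∉ C) : ann x ∈ commAlg C :=
  mem_commAlg.2 fun _ hy => ⟨commute_ann_ann _ _, commute_ann_cre (by rintro rfl; exact h hy)⟩

theorem cre_mem_commAlg {C : Finset (Fin n)} {x : Fin n} (h : x ∉ C) : cre x ∈ commAlg C :=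
  mem_commAlg.2 fun _ hy =>
    ⟨(commute_ann_cre (by rintro rfl; exact h hy)).symm, commute_cre_cre _ _⟩

theorem lower_mem_commAlg {A C : Finset (Fin n)} (h : Disjoint A C) : lower A ∈ commAlg C :=
  sum_mem fun _ hx => ann_mem_commAlg (Finset.disjoint_left.1 h hx)

theorem raise_mem_commAlg {A C : Finset (Fin n)} (h : Disjoint A C) : raise A ∈ commAlg C :=
  sum_mem fun _ hx => cre_mem_commAlg (Finset.disjoint_left.1 h hx)

theorem rdiv_mem_commAlg {A C : Finset (Fin n)} (h : Disjoint A C) (q : ℕ) :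
    rdiv A q ∈ commAlg C :=
  Subalgebra.smul_mem _ (pow_mem (raise_mem_commAlg h) q) _

theorem proj_mem_commAlg {A C : Finset (Fin n)} (h : Disjoint A C) (w : ℕ) :
    proj A w ∈ commAlg C := by
  refine mem_commAlg.2 fun x hx => ?_
  have hxA : x ∉ A := Finset.disjoint_right.1 h hx
  constructor <;> refine LinearMap.ext fun f => funext fun Z => ?_ <;> by_cases hZ : x ∈ Z <;>
    simp [proj_apply, ann_apply, cre_apply, hZ, Finset.insert_inter_of_notMem hxA,
      Finset.erase_inter, Finset.erase_eq_of_notMem, hxA]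

theorem commute_lower_of_mem {C : Finset (Fin n)} {T : Module.End ℂ (Fun n)} (hT : T ∈ commAlg C) :
    Commute T (lower C) :=
  Commute.sum_right _ _ _ fun x hx => (mem_commAlg.1 hT x hx).1

theorem commute_raise_of_mem {C : Finset (Fin n)} {T : Module.End ℂ (Fun n)} (hT : T ∈ commAlg C) :
    Commute T (raise C) :=
  Commute.sum_right _ _ _ fun x hx => (mem_commAlg.1 hT x hx).2

theorem commute_count_of_mem {C : Finset (Fin n)} {T : Module.End ℂ (Fun n)} (hT : T ∈ commAlg C) :
    Commute T (count C) :=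
  Commute.sum_right _ _ _ fun x hx => (mem_commAlg.1 hT x hx).2.mul_right (mem_commAlg.1 hT x hx).1

theorem commute_rdiv_of_mem {C : Finset (Fin n)} {T : Module.End ℂ (Fun n)} (hT : T ∈ commAlg C)
    (q : ℕ) : Commute T (rdiv C q) :=
  ((commute_raise_of_mem hT).pow_right q).smul_right _

theorem commute_casOp_of_mem {C : Finset (Fin n)} {T : Module.End ℂ (Fun n)} (hT : T ∈ commAlg C) :
    Commute T (casOp C) := by
  have hN := commute_count_of_mem hT
  refine Commute.sub_right (Commute.add_right (Commute.add_right ?_ (hN.pow_right 2)) ?_)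
    (hN.smul_right _)
  · exact ((commute_raise_of_mem hT).mul_right (commute_lower_of_mem hT)).smul_right _
  · exact (((Commute.one_right T).smul_right _).sub_right hN).pow_right 2

/-! ### The `sl₂`-relations -/

theorem lower_union {A B : Finset (Fin n)} (h : Disjoint A B) :
    lower (A ∪ B) = lower A + lower B := Finset.sum_union h

theorem raise_union {A B : Finset (Fin n)} (h : Disjoint A B) :
    raise (A ∪ B) = raise A + raise B := Finset.sum_union h

theorem count_union {A B : Finset (Fin n)} (h : Disjoint A B) :
    count (A ∪ B) = count A + count B := Finset.sum_union h

theorem lower_mul_raise (A : Finset (Fin n)) :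
    lower A * raise A = raise A * lower A + ((A.card : ℂ) • 1 - (2 : ℂ) • count A) := by
  have key (x y : Fin n) : ann x * cre y = cre y * ann x +
      if x = y then 1 - (2 : ℂ) • (cre x * ann x) else 0 := by
    by_cases h : x = y
    · subst h
      rw [ann_mul_cre, if_pos rfl, two_smul]; abel
    · rw [if_neg h, add_zero, (commute_ann_cre h).eq]
  simp only [lower, raise, Finset.sum_mul_sum, key, Finset.sum_add_distrib, count]
  rw [Finset.sum_comm]
  congr 1
  rw [Finset.sum_congr rfl fun x hx => by rw [Finset.sum_ite_eq, if_pos hx],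
    Finset.sum_sub_distrib, Finset.smul_sum]
  simp [Nat.cast_smul_eq_nsmul]

theorem count_mul_raise (A : Finset (Fin n)) :
    count A * raise A = raise A * count A + raise A := by
  have key (x y : Fin n) : cre x * ann x * cre y = cre y * (cre x * ann x) +
      if x = y then cre y else 0 := by
    by_cases h : x = y
    · subst h
      rw [mul_assoc, ann_mul_cre, if_pos rfl, mul_sub, ← mul_assoc, cre_mul_cre]; simp
    · rw [if_neg h, add_zero, mul_assoc, (commute_ann_cre h).eq, ← mul_assoc, ← mul_assoc,
        (commute_cre_cre x y).eq]
  simp only [raise, Finset.sum_mul_sum, key, Finset.sum_add_distrib, count]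
  rw [Finset.sum_comm]
  congr 1
  exact Finset.sum_congr rfl fun x hx => by rw [Finset.sum_ite_eq, if_pos hx]

theorem count_mul_lower (A : Finset (Fin n)) :
    count A * lower A = lower A * count A - lower A := by
  have key (x y : Fin n) : cre x * ann x * ann y = ann y * (cre x * ann x) -
      if x = y then ann y else 0 := by
    by_cases h : x = y
    · subst h
      rw [mul_assoc, ann_mul_ann, if_pos rfl, ← mul_assoc, ann_mul_cre, sub_mul, mul_assoc,
        ann_mul_ann]; simp
    · rw [if_neg h, sub_zero, mul_assoc, (commute_ann_ann x y).eq, ← mul_assoc, ← mul_assoc,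
        (commute_ann_cre (Ne.symm h)).eq]
  simp only [lower, Finset.sum_mul_sum, key, Finset.sum_sub_distrib, count]
  rw [Finset.sum_comm]
  congr 1
  exact Finset.sum_congr rfl fun x hx => by rw [Finset.sum_ite_eq, if_pos hx]

theorem count_raise {A : Finset (Fin n)} {c : ℂ} {f : Fun n} (h : count A f = c • f) :
    count A (raise A f) = (c + 1) • raise A f := by
  have := congrArg (· f) (count_mul_raise A)
  simpa [Module.End.mul_apply, h, add_smul] using this

theorem count_lower {A : Finset (Fin n)} {c : ℂ} {f : Fun n} (h : count A f = c • f) :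
    count A (lower A f) = (c - 1) • lower A f := by
  have := congrArg (· f) (count_mul_lower A)
  simpa [Module.End.mul_apply, h, sub_smul] using this

theorem count_raise_pow {A : Finset (Fin n)} {c : ℂ} {f : Fun n} (h : count A f = c • f)
    (q : ℕ) : count A ((raise A ^ q) f) = (c + q) • (raise A ^ q) f := by
  induction q with
  | zero => simpa using h
  | succ q ih => rw [pow_succ', Module.End.mul_apply, count_raise ih]; push_cast; rw [add_assoc]

theorem count_lower_pow {A : Finset (Fin n)} {c : ℂ} {f : Fun n} (h : count A f = c • f)
    (q : ℕ) : count A ((lower A ^ q) f) = (c - q) • (lower A ^ q) f := by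
  induction q with
  | zero => simpa using h
  | succ q ih => rw [pow_succ', Module.End.mul_apply, count_lower ih]; push_cast; rw [sub_sub]

theorem count_rdiv {A : Finset (Fin n)} {c : ℂ} {f : Fun n} (h : count A f = c • f)
    (q : ℕ) : count A (rdiv A q f) = (c + q) • rdiv A q f := by
  rw [rdiv, LinearMap.smul_apply, map_smul, count_raise_pow h, smul_comm]

theorem rdiv_zero (A : Finset (Fin n)) : rdiv A 0 = 1 := by simp [rdiv]

theorem lower_raise {A : Finset (Fin n)} {c : ℂ} {f : Fun n} (h : count A f = c • f) :
    lower A (raise A f) = raise A (lower A f) + ((A.card : ℂ) - 2 * c) • f := by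
  have := congrArg (· f) (lower_mul_raise A)
  simpa [Module.End.mul_apply, h, sub_smul, mul_smul] using this

/-- On a lowest weight vector the operators `lower` and `raise` act as in the representation of
`sl₂` of highest weight `|A| - 2c`. -/
theorem lower_raise_pow {A : Finset (Fin n)} {c : ℂ} {f : Fun n} (h : count A f = c • f)
    (h0 : lower A f = 0) (q : ℕ) :
    lower A ((raise A ^ (q + 1)) f) =
      ((q + 1 : ℂ) * ((A.card : ℂ) - 2 * c - q)) • (raise A ^ q) f := by
  induction q with
  | zero => simp [lower_raise h, h0]
  | succ q ih =>
    rw [pow_succ', Module.End.mul_apply, lower_raise (count_raise_pow h (q + 1)), ih, map_smul,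
      ← Module.End.mul_apply, ← pow_succ', ← add_smul]
    congr 1; push_cast; ring

theorem lower_rdiv {A : Finset (Fin n)} {c : ℂ} {f : Fun n} (h : count A f = c • f)
    (h0 : lower A f = 0) (q : ℕ) :
    lower A (rdiv A (q + 1) f) = ((A.card : ℂ) - 2 * c - q) • rdiv A q f := by
  rw [rdiv, rdiv, LinearMap.smul_apply, map_smul, lower_raise_pow h h0, LinearMap.smul_apply,
    smul_smul, smul_smul]
  congr 1
  have h1 : (q.factorial : ℂ) ≠ 0 := by exact_mod_cast q.factorial_ne_zero
  have h2 : (q + 1 : ℂ) ≠ 0 := by exact_mod_cast q.succ_ne_zero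
  rw [Nat.factorial_succ]; push_cast
  field_simp

theorem casOp_apply_of_count {A : Finset (Fin n)} {c : ℂ} {f : Fun n} (h : count A f = c • f) :
    casOp A f = (2 : ℂ) • raise A (lower A f) + (c ^ 2 + (A.card - c) ^ 2 - 2 * c) • f := by
  simp only [casOp, LinearMap.sub_apply, LinearMap.add_apply, LinearMap.smul_apply, pow_two,
    Module.End.mul_apply, h, map_smul, map_sub, Module.End.one_apply]
  module

theorem casOp_apply_of_lower {A : Finset (Fin n)} {k : ℕ} {f : Fun n}
    (h : count A f = (k : ℂ) • f) (h0 : lower A f = 0) : casOp A f = cas A.card k • f := by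
  rw [casOp_apply_of_count h, h0, map_zero, smul_zero, zero_add, cas]

/-- The Casimir eigenvalue determines the label of a vertex. -/
theorem cas_injective {t k l : ℕ} (hk : 2 * k ≤ t) (hl : 2 * l ≤ t) (h : cas t k = cas t l) :
    k = l := by
  have h1 : ((k : ℂ) - l) * ((k : ℂ) + l - t - 1) = 0 := by
    rw [cas, cas] at h; linear_combination h / 2
  rcases mul_eq_zero.1 h1 with h2 | h2
  · exact_mod_cast sub_eq_zero.1 h2
  · have : ((k + l : ℕ) : ℂ) = ((t + 1 : ℕ) : ℂ) := by push_cast; linear_combination h2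
    have := Nat.cast_injective this
    omega

/-! ### Equivariance -/

theorem permRep_one : permRep n 1 = 1 := map_one _

theorem commute_permRep_sum {A : Finset (Fin n)} {g : Equiv.Perm (Fin n)} (hg : g • A = A)
    {T : Fin n → Module.End ℂ (Fun n)} (hT : ∀ x, permRep n g * T x = T (g x) * permRep n g) :
    Commute (permRep n g) (∑ x ∈ A, T x) := by
  rw [commute_iff_eq, Finset.mul_sum, Finset.sum_mul]
  refine Finset.sum_bij (fun x _ => g x) (fun x hx => ?_) (fun _ _ _ _ h => g.injective h)
    (fun y hy => ?_) fun x _ => hT x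
  · rw [← hg]; exact Finset.smul_mem_smul_finset hx
  · rw [← hg] at hy
    obtain ⟨x, hx, rfl⟩ := Finset.mem_smul_finset.1 hy
    exact ⟨x, hx, rfl⟩

theorem commute_permRep_lower {A : Finset (Fin n)} {g : Equiv.Perm (Fin n)} (hg : g • A = A) :
    Commute (permRep n g) (lower A) := commute_permRep_sum hg (permRep_mul_ann g)

theorem commute_permRep_raise {A : Finset (Fin n)} {g : Equiv.Perm (Fin n)} (hg : g • A = A) :
    Commute (permRep n g) (raise A) := commute_permRep_sum hg (permRep_mul_cre g)

theorem commute_permRep_count {A : Finset (Fin n)} {g : Equiv.Perm (Fin n)} (hg : g • A = A) :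
    Commute (permRep n g) (count A) :=
  commute_permRep_sum hg fun x => by
    rw [← mul_assoc, permRep_mul_cre, mul_assoc, permRep_mul_ann, ← mul_assoc]

theorem commute_permRep_rdiv {A : Finset (Fin n)} {g : Equiv.Perm (Fin n)} (hg : g • A = A)
    (q : ℕ) : Commute (permRep n g) (rdiv A q) :=
  ((commute_permRep_raise hg).pow_right q).smul_right _

theorem commute_permRep_proj {A : Finset (Fin n)} {g : Equiv.Perm (Fin n)} (hg : g • A = A)
    (w : ℕ) : Commute (permRep n g) (proj A w) := by
  refine LinearMap.ext fun f => funext fun Z => ?_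
  have h : (g⁻¹ • Z ∩ A).card = (Z ∩ A).card := by
    conv_lhs => rw [← inv_smul_eq_iff.2 hg.symm, ← Finset.smul_finset_inter,
      Finset.card_smul_finset]
  simp [permRep_apply, proj_apply, h]

theorem swap_smul_eq {A : Finset (Fin n)} {x y : Fin n} (h : x ∈ A ↔ y ∈ A) :
    Equiv.swap x y • A = A := by
  ext z
  rw [← Finset.inv_smul_mem_iff, Equiv.swap_inv, Equiv.Perm.smul_def, Equiv.swap_apply_def]
  split_ifs with h1 h2 <;> simp_all

theorem swap_smul_of_mem_of_notMem {Z : Finset (Fin n)} {x y : Fin n} (hx : x ∈ Z) (hy : y ∉ Z) :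
    Equiv.swap x y • Z = insert y (Z.erase x) := by
  have hxy : x ≠ y := by rintro rfl; exact hy hx
  ext z
  rw [← Finset.inv_smul_mem_iff, Equiv.swap_inv, Equiv.Perm.smul_def, Equiv.swap_apply_def]
  split_ifs <;> simp_all

theorem permRep_swap {x y : Fin n} (h : x ≠ y) :
    permRep n (Equiv.swap x y) = (cre x * ann x) * (cre y * ann y)
      + (1 - cre x * ann x) * (1 - cre y * ann y) + cre x * ann y + cre y * ann x := by
  refine LinearMap.ext fun f => funext fun Z => ?_
  have e2 (hx : x ∉ Z) (hy : y ∈ Z) : Equiv.swap x y • Z = insert x (Z.erase y) := by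
    rw [Equiv.swap_comm, swap_smul_of_mem_of_notMem hy hx]
  by_cases hx : x ∈ Z <;> by_cases hy : y ∈ Z
  · simp [permRep_apply, ann_apply, cre_apply, hx, hy, swap_smul_eq, h, h.symm]
  · simp [permRep_apply, ann_apply, cre_apply, hx, hy, swap_smul_of_mem_of_notMem, h.symm]
  · simp [permRep_apply, ann_apply, cre_apply, hx, hy, e2, h]
  · simp [permRep_apply, cre_apply, hx, hy, swap_smul_eq]

/-- The Casimir operator is the action of a central element of the group algebra of the symmetric
group on `A`; this is what makes it usable for arbitrary invariant subspaces. -/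
theorem casOp_eq_sum_swap (A : Finset (Fin n)) :
    casOp A = ∑ x ∈ A, ∑ y ∈ A, permRep n (Equiv.swap x y) := by
  have key (x y : Fin n) : permRep n (Equiv.swap x y) = (cre x * ann x) * (cre y * ann y)
      + (1 - cre x * ann x) * (1 - cre y * ann y) + cre x * ann y + cre y * ann x
      - if x = y then (2 : ℂ) • (cre x * ann x) else 0 := by
    by_cases h : x = y
    · subst h
      have h2 : (cre x * ann x) * (cre x * ann x) = cre x * ann x := by
        rw [mul_assoc, ← mul_assoc (ann x), ann_mul_cre, sub_mul, mul_assoc, ann_mul_ann]; simp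
      rw [if_pos rfl, Equiv.swap_self]
      change permRep n 1 = _
      simp only [permRep_one, mul_sub, sub_mul, h2, one_mul, mul_one]; module
    · rw [if_neg h, sub_zero, permRep_swap h]
  have hc : (A.card : ℂ) • (1 : Module.End ℂ (Fun n)) - count A =
      ∑ x ∈ A, (1 - cre x * ann x) := by
    rw [Finset.sum_sub_distrib, count]; simp [Nat.cast_smul_eq_nsmul]
  simp only [key, Finset.sum_sub_distrib, Finset.sum_add_distrib]
  rw [casOp, hc, pow_two, pow_two, ← Finset.sum_mul_sum, ← Finset.sum_mul_sum, two_smul]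
  have h1 : ∑ x ∈ A, ∑ y ∈ A, cre x * ann y = raise A * lower A := by
    rw [raise, lower, Finset.sum_mul_sum]
  have h2 : ∑ x ∈ A, ∑ y ∈ A, cre y * ann x = raise A * lower A := by
    rw [Finset.sum_comm, h1]
  have h3 : ∑ x ∈ A, ∑ y ∈ A, (if x = y then (2 : ℂ) • (cre x * ann x) else 0) =
      (2 : ℂ) • count A := by
    rw [count, Finset.smul_sum]
    exact Finset.sum_congr rfl fun x hx => by rw [Finset.sum_ite_eq, if_pos hx]
  rw [h1, h2, h3, ← count, Finset.sum_sub_distrib]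
  abel

theorem commute_casOp {A : Finset (Fin n)} {T : Module.End ℂ (Fun n)}
    (h : ∀ x ∈ A, ∀ y ∈ A, Commute (permRep n (Equiv.swap x y)) T) : Commute (casOp A) T := by
  rw [casOp_eq_sum_swap]
  exact Commute.sum_left _ _ _ fun x hx => Commute.sum_left _ _ _ fun y hy => h x hx y hy

/-! ### Positivity -/

section Positivity

open scoped ComplexOrder

theorem ann_dotProduct (x : Fin n) (f g : Fun n) :
    ann x f ⬝ᵥ star g = f ⬝ᵥ star (cre x g) := by
  simp only [dotProduct, ann_apply, cre_apply, Pi.star_apply, ite_mul, zero_mul]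
  rw [Finset.sum_ite, Finset.sum_const_zero, zero_add]
  have : ∀ Z, f Z * star (if x ∈ Z then g (Z.erase x) else 0) =
      if x ∈ Z then f Z * star (g (Z.erase x)) else 0 := by
    intro Z; split_ifs <;> simp
  simp only [this]
  rw [Finset.sum_ite, Finset.sum_const_zero, add_zero]
  refine Finset.sum_bij' (fun Z _ => insert x Z) (fun Z _ => Z.erase x) ?_ ?_ ?_ ?_ ?_
  · simp
  · simp
  · intro Z hZ; exact Finset.erase_insert (by simpa using hZ)
  · intro Z hZ; exact Finset.insert_erase (by simpa using hZ)
  · intro Z hZ; rw [Finset.erase_insert (by simpa using hZ)]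

theorem lower_dotProduct (A : Finset (Fin n)) (f g : Fun n) :
    lower A f ⬝ᵥ star g = f ⬝ᵥ star (raise A g) := by
  simp only [lower, raise, LinearMap.sum_apply, sum_dotProduct, star_sum, dotProduct_sum,
    ann_dotProduct]

theorem raise_dotProduct (A : Finset (Fin n)) (f g : Fun n) :
    raise A f ⬝ᵥ star g = f ⬝ᵥ star (lower A g) := by
  rw [Matrix.dotProduct_star, ← lower_dotProduct, ← Matrix.dotProduct_star]

theorem eq_zero_of_dotProduct {f : Fun n} (h : f ⬝ᵥ star f = 0) : f = 0 :=
  dotProduct_self_star_eq_zero.1 h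

theorem lower_eq_zero_of_raise_lower {A : Finset (Fin n)} {f : Fun n}
    (h : raise A (lower A f) = 0) : lower A f = 0 := by
  refine eq_zero_of_dotProduct ?_
  rw [lower_dotProduct, h]; simp

theorem eq_zero_of_raise_lower {A : Finset (Fin n)} {f : Fun n} {c : ℝ} (hc : c < 0)
    (h : raise A (lower A f) = (c : ℂ) • f) : f = 0 := by
  refine eq_zero_of_dotProduct ?_
  have h1 : lower A f ⬝ᵥ star (lower A f) = (c : ℂ) * (f ⬝ᵥ star f) := by
    rw [← raise_dotProduct, h, smul_dotProduct, smul_eq_mul]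
  have h2 : 0 ≤ lower A f ⬝ᵥ star (lower A f) := dotProduct_self_star_nonneg _
  have h3 : 0 ≤ f ⬝ᵥ star f := dotProduct_self_star_nonneg _
  rw [h1] at h2
  obtain ⟨r, hr⟩ : ∃ r : ℝ, f ⬝ᵥ star f = r := ⟨_, (Complex.eq_re_of_ofReal_le h3)⟩
  rw [hr] at h2 h3 ⊢
  norm_cast at h2 h3 ⊢
  nlinarith

/-- There are no lowest weight vectors of positive weight. -/
theorem eq_zero_of_lower_eq_zero {A : Finset (Fin n)} {w : ℕ} {f : Fun n}
    (h : count A f = (w : ℂ) • f) (h0 : lower A f = 0) (hw : A.card < 2 * w) : f = 0 := by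
  refine eq_zero_of_dotProduct ?_
  have h1 : raise A f ⬝ᵥ star (raise A f) = (A.card - 2 * w : ℂ) * (f ⬝ᵥ star f) := by
    rw [← lower_dotProduct, lower_raise h, h0, map_zero, zero_add, smul_dotProduct, smul_eq_mul]
  have h2 : 0 ≤ raise A f ⬝ᵥ star (raise A f) := dotProduct_self_star_nonneg _
  have h3 : 0 ≤ f ⬝ᵥ star f := dotProduct_self_star_nonneg _
  rw [h1] at h2
  obtain ⟨r, hr⟩ : ∃ r : ℝ, f ⬝ᵥ star f = r := ⟨_, (Complex.eq_re_of_ofReal_le h3)⟩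
  rw [hr] at h2 h3 ⊢
  norm_cast at h2 h3 ⊢
  have hw' : (A.card : ℝ) < 2 * w := by exact_mod_cast hw
  push_cast at h2
  nlinarith

end Positivity

/-! ### Vectors of given weight and Casimir eigenvalue -/

/-- A Casimir eigenvalue determines the eigenvalue of the positive semidefinite operator
`raise A * lower A`, whose sign then decides which weights can occur. -/
theorem raise_lower_of_casOp {A : Finset (Fin n)} {i w : ℕ} {f : Fun n}
    (hw : count A f = (w : ℂ) • f) (hi : casOp A f = cas A.card i • f) :
    raise A (lower A f) = (((w - i) * (A.card + 1 - i - w) : ℝ) : ℂ) • f := by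
  rw [casOp_apply_of_count hw, cas] at hi
  have : (2 : ℂ) • raise A (lower A f) =
      (2 : ℂ) • ((((w - i) * (A.card + 1 - i - w) : ℝ) : ℂ) • f) := by
    rw [← sub_eq_zero] at hi ⊢
    rw [← hi]; push_cast; module
  exact smul_right_injective _ two_ne_zero this

/-- Weights below `i` do not occur in the isotypic component of `S^{t-i,i}(A)`. -/
theorem eq_zero_of_casOp {A : Finset (Fin n)} {i w : ℕ} {f : Fun n}
    (hw : count A f = (w : ℂ) • f) (hi : casOp A f = cas A.card i • f)
    (hiA : 2 * i ≤ A.card) (hwi : w < i) : f = 0 := by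
  refine eq_zero_of_raise_lower ?_ (raise_lower_of_casOp hw hi)
  have h1 : (w : ℝ) < i := by exact_mod_cast hwi
  have h2 : (2 * i : ℝ) ≤ A.card := by exact_mod_cast hiA
  nlinarith

theorem lower_eq_zero_of_casOp {A : Finset (Fin n)} {i : ℕ} {f : Fun n}
    (hw : count A f = (i : ℂ) • f) (hi : casOp A f = cas A.card i • f) : lower A f = 0 := by
  refine lower_eq_zero_of_raise_lower ?_
  rw [raise_lower_of_casOp hw hi]; simp

theorem eq_zero_of_casOp_of_lower {A : Finset (Fin n)} {i w : ℕ} {f : Fun n}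
    (hw : count A f = (w : ℂ) • f) (hi : casOp A f = cas A.card i • f)
    (hiw : i < w) (hwA : i + w ≤ A.card) (h0 : lower A f = 0) : f = 0 := by
  have := raise_lower_of_casOp hw hi
  rw [h0, map_zero] at this
  refine (smul_eq_zero.1 this.symm).resolve_left ?_
  have h1 : (i : ℝ) < w := by exact_mod_cast hiw
  have h2 : (i + w : ℝ) ≤ A.card := by exact_mod_cast hwA
  exact Complex.ofReal_ne_zero.2 (mul_pos (sub_pos.2 h1) (by linarith)).ne'

theorem commute_casOp_lower {A C : Finset (Fin n)} (h : C ⊆ A ∨ Disjoint C A) :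
    Commute (casOp C) (lower A) := by
  refine commute_casOp fun x hx y hy => commute_permRep_lower (swap_smul_eq ?_)
  rcases h with h | h
  · simp [h hx, h hy]
  · simp [Finset.disjoint_left.1 h hx, Finset.disjoint_left.1 h hy]

theorem commute_casOp_raise {A C : Finset (Fin n)} (h : C ⊆ A ∨ Disjoint C A) :
    Commute (casOp C) (raise A) := by
  refine commute_casOp fun x hx y hy => commute_permRep_raise (swap_smul_eq ?_)
  rcases h with h | h
  · simp [h hx, h hy]
  · simp [Finset.disjoint_left.1 h hx, Finset.disjoint_left.1 h hy]

theorem commute_casOp_rdiv {A C : Finset (Fin n)} (h : C ⊆ A ∨ Disjoint C A) (q : ℕ) :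
    Commute (casOp C) (rdiv A q) :=
  ((commute_casOp_raise h).pow_right q).smul_right _

theorem commute_casOp_proj {A C : Finset (Fin n)} (h : C ⊆ A ∨ Disjoint C A) (w : ℕ) :
    Commute (casOp C) (proj A w) := by
  refine commute_casOp fun x hx y hy => commute_permRep_proj (swap_smul_eq ?_) w
  rcases h with h | h
  · simp [h hx, h hy]
  · simp [Finset.disjoint_left.1 h hx, Finset.disjoint_left.1 h hy]

theorem apply_eq_smul_of_commute {S T : Module.End ℂ (Fun n)} (h : Commute S T) {f : Fun n} {c : ℂ}
    (hf : S f = c • f) : S (T f) = c • T f := by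
  rw [← Module.End.mul_apply, h.eq, Module.End.mul_apply, hf, map_smul]

theorem apply_eq_zero_of_commute {S T : Module.End ℂ (Fun n)} (h : Commute S T) {f : Fun n}
    (hf : S f = 0) : S (T f) = 0 := by
  rw [← Module.End.mul_apply, h.eq, Module.End.mul_apply, hf, map_zero]

/-- A vector of weight `i + q` and of the Casimir eigenvalue of `S^{t-i,i}` is recovered from its
`q`-th lowering. -/
theorem exists_smul_raise_lower_pow (A : Finset (Fin n)) (i q : ℕ) (h : 2 * i + q ≤ A.card) :
    ∃ c : ℂ, ∀ f : Fun n, count A f = ((i + q : ℕ) : ℂ) • f → casOp A f = cas A.card i • f →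
      f = c • rdiv A q ((lower A ^ q) f) := by
  induction q with
  | zero => exact ⟨1, fun f _ _ => by simp [rdiv_zero]⟩
  | succ q ih =>
    obtain ⟨c, hc⟩ := ih (by omega)
    set r : ℝ := (((i + (q + 1) : ℕ) : ℝ) - i) * (A.card + 1 - i - (i + (q + 1) : ℕ)) with hr
    have hr0 : (r : ℂ) ≠ 0 := by
      have h2 : (2 * i + (q + 1) : ℝ) ≤ A.card := by exact_mod_cast h
      refine Complex.ofReal_ne_zero.2 (mul_pos ?_ ?_).ne'
      · push_cast; linarith [(Nat.cast_nonneg q : (0 : ℝ) ≤ q)]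
      · push_cast; linarith
    refine ⟨(r : ℂ)⁻¹ * (c * (q + 1)), fun f hf hcas => ?_⟩
    have h1 := raise_lower_of_casOp hf hcas
    have h2 := hc (lower A f) (by rw [count_lower hf]; push_cast; congr 1; ring)
      (apply_eq_smul_of_commute (commute_casOp_lower (.inl subset_rfl)) hcas)
    have h3 : raise A (rdiv A q ((lower A ^ q) (lower A f))) =
        ((q : ℂ) + 1) • rdiv A (q + 1) ((lower A ^ (q + 1)) f) := by
      rw [rdiv, rdiv, LinearMap.smul_apply, map_smul, LinearMap.smul_apply, smul_smul,
        ← Module.End.mul_apply, ← pow_succ', pow_succ (lower A), Module.End.mul_apply]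
      congr 1
      have h1 : (q.factorial : ℂ) ≠ 0 := by exact_mod_cast q.factorial_ne_zero
      have h2 : (q + 1 : ℂ) ≠ 0 := by exact_mod_cast q.succ_ne_zero
      rw [Nat.factorial_succ]; push_cast
      field_simp
    rw [h2, map_smul, h3] at h1
    rw [mul_smul, mul_smul, h1, smul_smul, inv_mul_cancel₀ hr0, one_smul]

/-! ### Lowest weight vectors -/

/-- The functions of weight `k` on `A` that are killed by the Radon transform on `A`; without a
condition on the sites outside `A`. -/
def lowest (A : Finset (Fin n)) (k : ℕ) : Submodule ℂ (Fun n) where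
  carrier := {f | count A f = (k : ℂ) • f ∧ lower A f = 0}
  add_mem' hf hg := ⟨by rw [map_add, hf.1, hg.1, smul_add], by rw [map_add, hf.2, hg.2, add_zero]⟩
  zero_mem' := by simp
  smul_mem' c f hf := ⟨by rw [map_smul, hf.1, smul_comm], by rw [map_smul, hf.2, smul_zero]⟩

theorem mem_lowest {A : Finset (Fin n)} {k : ℕ} {f : Fun n} :
    f ∈ lowest A k ↔ count A f = (k : ℂ) • f ∧ lower A f = 0 := Iff.rfl

theorem apply_mem_lowest {A : Finset (Fin n)} {k : ℕ} {f : Fun n} {T : Module.End ℂ (Fun n)}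
    (hT : T ∈ commAlg A) (hf : f ∈ lowest A k) : T f ∈ lowest A k :=
  ⟨apply_eq_smul_of_commute (commute_count_of_mem hT).symm hf.1,
    apply_eq_zero_of_commute (commute_lower_of_mem hT).symm hf.2⟩

theorem permRep_mem_lowest {A : Finset (Fin n)} {k : ℕ} {f : Fun n} {g : Equiv.Perm (Fin n)}
    (hg : g • A = A) (hf : f ∈ lowest A k) : permRep n g f ∈ lowest A k :=
  ⟨apply_eq_smul_of_commute (commute_permRep_count hg).symm hf.1,
    apply_eq_zero_of_commute (commute_permRep_lower hg).symm hf.2⟩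

theorem casOp_apply_of_mem_lowest {A : Finset (Fin n)} {k : ℕ} {f : Fun n}
    (hf : f ∈ lowest A k) : casOp A f = cas A.card k • f := casOp_apply_of_lower hf.1 hf.2

theorem eq_zero_of_rdiv_eq_zero {A : Finset (Fin n)} {i q : ℕ} {f : Fun n}
    (hf : f ∈ lowest A i) (hq : 2 * i + q ≤ A.card) (h : rdiv A q f = 0) : f = 0 := by
  induction q with
  | zero => simpa [rdiv_zero] using h
  | succ q ih =>
    refine ih (by omega) ?_
    have h1 := lower_rdiv hf.1 hf.2 q
    rw [h, map_zero] at h1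
    refine (smul_eq_zero.1 h1.symm).resolve_left fun h2 => ?_
    have h3 : (A.card : ℂ) = ((2 * i + q : ℕ) : ℂ) := by push_cast; linear_combination h2
    have := Nat.cast_injective h3
    omega

/-- Raising a lowest weight vector of weight `i` more than `|A| - 2i` times gives zero. -/
theorem rdiv_eq_zero_of_lt {A : Finset (Fin n)} {i q : ℕ} {f : Fun n}
    (hf : f ∈ lowest A i) (hi : 2 * i ≤ A.card) (hq : A.card < 2 * i + q) : rdiv A q f = 0 := by
  obtain ⟨r, rfl⟩ : ∃ r, q = A.card - 2 * i + 1 + r := ⟨q - (A.card - 2 * i + 1), by omega⟩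
  clear hq
  have key : rdiv A (A.card - 2 * i + 1) f = 0 := by
    refine eq_zero_of_lower_eq_zero (A := A) (w := i + (A.card - 2 * i + 1)) ?_ ?_ (by omega)
    · rw [count_rdiv hf.1]; push_cast; rfl
    · rw [lower_rdiv hf.1 hf.2, Nat.cast_sub hi]
      push_cast
      rw [sub_self, zero_smul]
  rw [rdiv, LinearMap.smul_apply] at key ⊢
  rw [smul_eq_zero] at key
  have h1 := key.resolve_left (inv_ne_zero (by exact_mod_cast Nat.factorial_ne_zero _))
  rw [add_comm, pow_add, Module.End.mul_apply, h1, map_zero, smul_zero]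

/-! ### Divided powers -/

theorem rdiv_mul_rdiv (A : Finset (Fin n)) (u v : ℕ) :
    rdiv A u * rdiv A v = ((u + v).choose u : ℂ) • rdiv A (u + v) := by
  rw [rdiv, rdiv, rdiv, smul_mul_smul_comm, ← pow_add, smul_smul]
  congr 1
  rw [Nat.choose_symm_add, Nat.add_choose, Nat.cast_div (Nat.factorial_mul_factorial_dvd_factorial_add u v)]
  · have h1 : (u.factorial : ℂ) ≠ 0 := by exact_mod_cast u.factorial_ne_zero
    have h2 : (v.factorial : ℂ) ≠ 0 := by exact_mod_cast v.factorial_ne_zero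
    have h3 : ((u + v).factorial : ℂ) ≠ 0 := by exact_mod_cast (u + v).factorial_ne_zero
    push_cast
    field_simp
  · exact_mod_cast mul_ne_zero u.factorial_ne_zero v.factorial_ne_zero

theorem commute_rdiv {A B : Finset (Fin n)} (h : Disjoint A B) (u v : ℕ) :
    Commute (rdiv A u) (rdiv B v) := commute_rdiv_of_mem (rdiv_mem_commAlg h u) v

/-- The binomial theorem for divided powers. -/
theorem rdiv_union {A B : Finset (Fin n)} (h : Disjoint A B) (q : ℕ) :
    rdiv (A ∪ B) q = ∑ v ∈ Finset.range (q + 1), rdiv A (q - v) * rdiv B v := by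
  have hc : Commute (raise B) (raise A) := commute_raise_of_mem (raise_mem_commAlg h.symm)
  rw [rdiv, raise_union h, add_comm, hc.add_pow, Finset.smul_sum]
  refine Finset.sum_congr rfl fun v hv => ?_
  have hv' : v ≤ q := Nat.lt_succ_iff.1 (Finset.mem_range.1 hv)
  rw [rdiv, rdiv, smul_mul_smul_comm, ((hc.pow_pow v (q - v))).eq, ← nsmul_eq_mul',
    ← Nat.cast_smul_eq_nsmul ℂ, smul_smul]
  congr 1
  rw [Nat.cast_choose ℂ hv']
  have h1 : (q.factorial : ℂ) ≠ 0 := by exact_mod_cast q.factorial_ne_zero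
  have h2 : (v.factorial : ℂ) ≠ 0 := by exact_mod_cast v.factorial_ne_zero
  have h3 : ((q - v).factorial : ℂ) ≠ 0 := by exact_mod_cast (q - v).factorial_ne_zero
  field_simp

/-! ### The Clebsch–Gordan operators and Hahn polynomials -/

/-- The value `E_N(β, α, N, x)`, in closed form. -/
def cgCoef (N : ℕ) (α β : ℤ) (x : ℕ) : ℤ :=
  (-1) ^ (N - x) * N.factorial * (ascPochhammer ℤ x).eval (α - N + 1)
    * (ascPochhammer ℤ (N - x)).eval (β - N + 1)

/-- The recurrence that makes `cg` map into `ker d`. -/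
theorem cgCoef_succ {N x : ℕ} (α β : ℤ) (hx : x < N) :
    cgCoef N α β x * (α - N + x + 1) + cgCoef N α β (x + 1) * (β - x) = 0 := by
  obtain ⟨d, rfl⟩ : ∃ d, N = x + d + 1 := ⟨N - x - 1, by omega⟩
  rw [cgCoef, cgCoef, show x + d + 1 - x = d + 1 by omega,
    show x + d + 1 - (x + 1) = d by omega, ascPochhammer_succ_eval, ascPochhammer_succ_eval,
    pow_succ]
  push_cast
  ring

theorem cgCoef_zero_ne_zero {N : ℕ} {α β : ℤ} (hβ : N ≤ β) : cgCoef N α β 0 ≠ 0 := by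
  rw [cgCoef]
  have h1 : 0 < (ascPochhammer ℤ (N - 0)).eval (β - N + 1) := ascPochhammer_pos _ _ (by linarith)
  simp only [ascPochhammer_zero, Polynomial.eval_one, mul_one]
  have := N.factorial_ne_zero
  positivity

/-- The operator that maps `f ⊗ g`, with `f ∈ S^{a-i,i}(A)` and `g ∈ S^{b-j,j}(B)`, to its
component of the form `S^{n-k,k}(A ∪ B)`, where `N = k - i - j`, `α = a - 2i` and `β = b - 2j`. -/
def cg (A B : Finset (Fin n)) (N : ℕ) (α β : ℤ) : Module.End ℂ (Fun n) :=
  ∑ x ∈ Finset.range (N + 1), (cgCoef N α β x : ℂ) • (rdiv A (N - x) * rdiv B x)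

/-- The Hahn polynomials in terms of their values at the top parameter. -/
theorem hahnE_eq_sum {N M y : ℕ} (α β : ℤ) (hy : y ≤ M) :
    hahnE N β α M y = ∑ x ∈ Finset.range (N + 1),
      ((y.choose x * (M - y).choose (N - x) : ℕ) : ℤ) * cgCoef N α β x := by
  rw [hahnE]
  refine Finset.sum_subset_zero_on_sdiff (Finset.filter_subset _ _) (fun x hx => ?_)
    fun x hx => ?_
  · rw [Finset.mem_sdiff, Finset.mem_filter, Finset.mem_range] at hx
    rcases lt_or_ge y x with h | h
    · rw [Nat.choose_eq_zero_of_lt h]; simp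
    · rw [Nat.choose_eq_zero_of_lt (n := M - y) (k := N - x) (by omega)]; simp
  · have hx' : x ≤ N := by
      have := (Finset.mem_filter.1 hx).1
      rw [Finset.mem_range] at this
      omega
    have e1 : (ascPochhammer ℤ x).eval (-(y : ℤ)) =
        (-1) ^ x * ((x.factorial * y.choose x : ℕ) : ℤ) := by
      rw [ascPochhammer_eval_neg_eq_descPochhammer, descPochhammer_eval_eq_descFactorial,
        Nat.descFactorial_eq_factorial_mul_choose]
    have e2 : (ascPochhammer ℤ (N - x)).eval ((y : ℤ) - M) =
        (-1) ^ (N - x) * (((N - x).factorial * (M - y).choose (N - x) : ℕ) : ℤ) := by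
      rw [show (y : ℤ) - M = -((M - y : ℕ) : ℤ) by push_cast [hy]; ring,
        ascPochhammer_eval_neg_eq_descPochhammer, descPochhammer_eval_eq_descFactorial,
        Nat.descFactorial_eq_factorial_mul_choose]
    have e3 : (-1 : ℤ) ^ x * (-1) ^ x = 1 := by rw [← mul_pow]; simp
    rw [e1, e2, cgCoef, ← Nat.choose_mul_factorial_mul_factorial hx']
    push_cast
    linear_combination ((N.choose x : ℤ) * (ascPochhammer ℤ x).eval (α - N + 1) * (x.factorial)
      * (y.choose x) * (ascPochhammer ℤ (N - x)).eval (β - N + 1) * (-1) ^ (N - x)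
      * ((N - x).factorial * (M - y).choose (N - x))) * e3

/-- Raising a Clebsch–Gordan vector produces the Hahn polynomials as coefficients. -/
theorem rdiv_mul_cg {A B : Finset (Fin n)} (h : Disjoint A B) {N M : ℕ} (hN : N ≤ M) (α β : ℤ) :
    rdiv (A ∪ B) (M - N) * cg A B N α β = ∑ y ∈ Finset.range (M + 1),
      (hahnE N β α M y : ℂ) • (rdiv A (M - y) * rdiv B y) := by
  have hR : ∑ y ∈ Finset.range (M + 1), (hahnE N β α M y : ℂ) • (rdiv A (M - y) * rdiv B y) =
      ∑ x ∈ Finset.range (N + 1), ∑ y ∈ Finset.range (M + 1),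
        ((y.choose x : ℂ) * ((M - y).choose (N - x) : ℂ) * (cgCoef N α β x : ℂ)) •
          (rdiv A (M - y) * rdiv B y) := by
    rw [Finset.sum_comm]
    refine Finset.sum_congr rfl fun y hy => ?_
    rw [hahnE_eq_sum α β (Nat.lt_succ_iff.1 (Finset.mem_range.1 hy)), ← Finset.sum_smul]
    push_cast
    rfl
  rw [hR, cg, Finset.mul_sum]
  refine Finset.sum_congr rfl fun x hx => ?_
  have hx' : x ≤ N := Nat.lt_succ_iff.1 (Finset.mem_range.1 hx)
  rw [← Finset.sum_subset (s₁ := Finset.Ico x (x + (M - N) + 1))]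
  · rw [Finset.sum_Ico_eq_sum_range, rdiv_union h, Finset.sum_mul,
      show x + (M - N) + 1 - x = M - N + 1 by omega]
    refine Finset.sum_congr rfl fun v hv => ?_
    have hv' : v ≤ M - N := Nat.lt_succ_iff.1 (Finset.mem_range.1 hv)
    rw [mul_smul_comm, mul_assoc, ← mul_assoc (rdiv B v), (commute_rdiv h.symm v (N - x)).eq,
      mul_assoc (rdiv A (N - x)), ← mul_assoc (rdiv A (M - N - v)), rdiv_mul_rdiv, rdiv_mul_rdiv,
      smul_mul_smul_comm, smul_smul, show M - N - v + (N - x) = M - (x + v) by omega,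
      add_comm v x]
    congr 1
    rw [Nat.choose_symm_of_eq_add (n := M - (x + v)) (a := M - N - v) (b := N - x) (by omega),
      Nat.choose_symm_of_eq_add (n := x + v) (a := v) (b := x) (by omega)]
    ring
  · intro y hy
    rw [Finset.mem_Ico] at hy
    rw [Finset.mem_range]; omega
  · intro y hy hy'
    rw [Finset.mem_range] at hy
    rw [Finset.mem_Ico] at hy'
    rcases lt_or_ge y x with h1 | h1
    · rw [Nat.choose_eq_zero_of_lt h1]; simp
    · rw [Nat.choose_eq_zero_of_lt (n := M - y) (k := N - x) (by omega)]; simp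

theorem cg_mem_commAlg {A B C : Finset (Fin n)} (hA : Disjoint A C) (hB : Disjoint B C) (N : ℕ)
    (α β : ℤ) : cg A B N α β ∈ commAlg C :=
  sum_mem fun _ _ => Subalgebra.smul_mem _
    (mul_mem (rdiv_mem_commAlg hA _) (rdiv_mem_commAlg hB _)) _

theorem commute_permRep_cg {A B : Finset (Fin n)} {g : Equiv.Perm (Fin n)} (hA : g • A = A)
    (hB : g • B = B) (N : ℕ) (α β : ℤ) : Commute (permRep n g) (cg A B N α β) :=
  Commute.sum_right _ _ _ fun _ _ =>
    ((commute_permRep_rdiv hA _).mul_right (commute_permRep_rdiv hB _)).smul_right _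

theorem commute_casOp_cg {A B C : Finset (Fin n)} (hA : C ⊆ A ∨ Disjoint C A)
    (hB : C ⊆ B ∨ Disjoint C B) (N : ℕ) (α β : ℤ) : Commute (casOp C) (cg A B N α β) :=
  Commute.sum_right _ _ _ fun _ _ =>
    ((commute_casOp_rdiv hA _).mul_right (commute_casOp_rdiv hB _)).smul_right _

section ClebschGordan

variable {A B : Finset (Fin n)} {i j : ℕ} {f : Fun n}

theorem count_left_rdiv_rdiv (h : Disjoint A B) (hA : f ∈ lowest A i) (u v : ℕ) :
    count A (rdiv A u (rdiv B v f)) = ((i + u : ℕ) : ℂ) • rdiv A u (rdiv B v f) := by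
  rw [count_rdiv (apply_mem_lowest (rdiv_mem_commAlg h.symm v) hA).1]; push_cast; rfl

theorem count_right_rdiv_rdiv (h : Disjoint A B) (hB : f ∈ lowest B j) (u v : ℕ) :
    count B (rdiv A u (rdiv B v f)) = ((j + v : ℕ) : ℂ) • rdiv A u (rdiv B v f) := by
  rw [← Module.End.mul_apply (rdiv A u), (commute_rdiv h u v).eq, Module.End.mul_apply]
  exact count_left_rdiv_rdiv h.symm hB v u

theorem cg_apply (N : ℕ) (α β : ℤ) (f : Fun n) : cg A B N α β f =
    ∑ x ∈ Finset.range (N + 1), (cgCoef N α β x : ℂ) • rdiv A (N - x) (rdiv B x f) := by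
  simp [cg, LinearMap.sum_apply]

/-- The recurrence for `cgCoef` says that the Clebsch–Gordan operator produces lowest weight
vectors. -/
theorem cg_mem_lowest (h : Disjoint A B) (hA : f ∈ lowest A i) (hB : f ∈ lowest B j) (N : ℕ) :
    cg A B N (A.card - 2 * i) (B.card - 2 * j) f ∈ lowest (A ∪ B) (i + j + N) := by
  constructor
  · rw [cg_apply, map_sum, Finset.smul_sum]
    refine Finset.sum_congr rfl fun x hx => ?_
    have hx' : x ≤ N := Nat.lt_succ_iff.1 (Finset.mem_range.1 hx)
    rw [map_smul, count_union h, LinearMap.add_apply, count_left_rdiv_rdiv h hA,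
      count_right_rdiv_rdiv h hB, ← add_smul, smul_comm]
    congr 2
    exact_mod_cast (by omega : i + (N - x) + (j + x) = i + j + N)
  · have hA0 (x : ℕ) : lower A (rdiv A 0 (rdiv B x f)) = 0 := by
      rw [rdiv_zero]; exact (apply_mem_lowest (rdiv_mem_commAlg h.symm x) hA).2
    have hB0 (x : ℕ) : lower B (rdiv A x (rdiv B 0 f)) = 0 := by
      rw [rdiv_zero]; exact (apply_mem_lowest (rdiv_mem_commAlg h x) hB).2
    have hA1 (u v : ℕ) : lower A (rdiv A (u + 1) (rdiv B v f)) =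
        ((A.card : ℂ) - 2 * i - u) • rdiv A u (rdiv B v f) := by
      have := apply_mem_lowest (rdiv_mem_commAlg h.symm v) hA
      exact lower_rdiv this.1 this.2 u
    have hB1 (u v : ℕ) : lower B (rdiv A u (rdiv B (v + 1) f)) =
        ((B.card : ℂ) - 2 * j - v) • rdiv A u (rdiv B v f) := by
      have := apply_mem_lowest (rdiv_mem_commAlg h u) hB
      rw [← Module.End.mul_apply (rdiv A u), (commute_rdiv h u _).eq, Module.End.mul_apply,
        lower_rdiv this.1 this.2 v, ← Module.End.mul_apply, ← (commute_rdiv h u _).eq,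
        Module.End.mul_apply]
    rw [cg_apply, map_sum]
    simp only [lower_union h, LinearMap.add_apply, map_smul, smul_add, Finset.sum_add_distrib]
    rw [Finset.sum_range_succ, Nat.sub_self, hA0, smul_zero, add_zero, Finset.sum_range_succ' _ N,
      hB0, smul_zero, add_zero, ← Finset.sum_add_distrib]
    refine Finset.sum_eq_zero fun x hx => ?_
    have hx' : x < N := Finset.mem_range.1 hx
    have key := cgCoef_succ (A.card - 2 * i) (B.card - 2 * j) hx'
    obtain ⟨d, hd⟩ : ∃ d, N = x + d + 1 := ⟨N - x - 1, by omega⟩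
    rw [show N - x = d + 1 by omega, show N - (x + 1) = d by omega, hA1, hB1, smul_smul, smul_smul,
      ← add_smul]
    have key' := congrArg (Int.cast (R := ℂ)) key
    have hN : (N : ℂ) = x + d + 1 := by rw [hd]; push_cast; rfl
    push_cast at key'
    rw [hN] at key'
    convert zero_smul ℂ _ using 2
    linear_combination key'

theorem proj_apply_of_count {C : Finset (Fin n)} {w c : ℕ} {f : Fun n}
    (hf : count C f = (c : ℂ) • f) : proj C w f = if w = c then f else 0 := by
  rw [count_eq_smul_iff] at hf
  ext Z
  rw [proj_apply]
  by_cases h : (Z ∩ C).card = c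
  · rw [h]; by_cases h' : w = c
    · simp [h']
    · simp [h', Ne.symm h']
  · rw [hf Z h]; by_cases h' : w = c <;> simp [h', hf Z h]

/-- The component of lowest weight on `B` only involves the first term of `cg`. -/
theorem proj_cg (h : Disjoint A B) (hB : f ∈ lowest B j) (N : ℕ) (α β : ℤ) :
    proj B j (cg A B N α β f) = (cgCoef N α β 0 : ℂ) • rdiv A N f := by
  rw [cg_apply, map_sum, Finset.sum_eq_single_of_mem 0 (by simp)]
  · rw [map_smul, proj_apply_of_count (count_right_rdiv_rdiv h hB _ _), rdiv_zero]; simp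
  · intro x _ hx
    rw [map_smul, proj_apply_of_count (count_right_rdiv_rdiv h hB _ _), if_neg (by omega),
      smul_zero]

theorem eq_zero_of_cg_eq_zero (h : Disjoint A B) (hA : f ∈ lowest A i) (hB : f ∈ lowest B j)
    {N : ℕ} (hNA : 2 * i + N ≤ A.card) (hNB : 2 * j + N ≤ B.card)
    (h0 : cg A B N (A.card - 2 * i) (B.card - 2 * j) f = 0) : f = 0 := by
  have h1 := proj_cg h hB N (A.card - 2 * i) (B.card - 2 * j)
  rw [h0, map_zero] at h1
  refine eq_zero_of_rdiv_eq_zero hA hNA ((smul_eq_zero.1 h1.symm).resolve_left ?_)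
  exact Int.cast_ne_zero.2 (cgCoef_zero_ne_zero (by omega))

theorem count_proj (C : Finset (Fin n)) (w : ℕ) (f : Fun n) :
    count C (proj C w f) = (w : ℂ) • proj C w f :=
  count_eq_smul_iff.2 fun Z hZ => by rw [proj_apply, if_neg hZ]

theorem lower_mul_proj (C : Finset (Fin n)) (w : ℕ) :
    lower C * proj C (w + 1) = proj C w * lower C := by
  rw [lower, Finset.sum_mul, Finset.mul_sum]
  refine Finset.sum_congr rfl fun x hx => LinearMap.ext fun f => funext fun Z => ?_
  by_cases hZ : x ∈ Z
  · simp [ann_apply, proj_apply, hZ]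
  · have : x ∉ Z ∩ C := fun h => hZ (Finset.mem_inter.1 h).1
    simp [ann_apply, proj_apply, hZ, Finset.insert_inter_of_mem hx,
      Finset.card_insert_of_notMem this]

theorem count_left_proj (h : Disjoint A B) {k w : ℕ} (hk : count (A ∪ B) f = (k : ℂ) • f)
    (hw : w ≤ k) : count A (proj B w f) = ((k - w : ℕ) : ℂ) • proj B w f := by
  rw [count_eq_smul_iff] at hk ⊢
  intro Z hZ
  rw [proj_apply]
  split_ifs with h1
  · refine hk Z fun h2 => hZ ?_
    rw [Finset.inter_union_distrib_left, Finset.card_union_of_disjoint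
      (h.mono Finset.inter_subset_right Finset.inter_subset_right)] at h2
    omega
  · rfl

theorem proj_eq_zero_of_lt {k w : ℕ} (hk : count (A ∪ B) f = (k : ℂ) • f) (hw : k < w) :
    proj B w f = 0 := by
  rw [count_eq_smul_iff] at hk
  ext Z
  rw [proj_apply]
  split_ifs with h1
  · refine hk Z fun h2 => ?_
    have := Finset.card_le_card
      (Finset.inter_subset_inter_left (s := Z) (Finset.subset_union_right (s₁ := A) (s₂ := B)))
    omega
  · rfl

theorem eq_zero_of_proj_eq_zero {C : Finset (Fin n)} (h : ∀ w, proj C w f = 0) : f = 0 := by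
  ext Z
  have := congrFun (h (Z ∩ C).card) Z
  rwa [proj_apply, if_pos rfl] at this

/-- The multiplicity of `S^{a-i,i} ⊗ S^{b-j,j}` in `S^{n-k,k}` is at most one: a lowest weight vector
with the corresponding Casimir eigenvalues is determined by its component of lowest weight on
`B`. -/
theorem eq_zero_of_proj_lowest (h : Disjoint A B) {N : ℕ} (hNA : 2 * i + N ≤ A.card)
    (hNB : 2 * j + N ≤ B.card) (hf : f ∈ lowest (A ∪ B) (i + j + N))
    (hA : casOp A f = cas A.card i • f) (hB : casOp B f = cas B.card j • f)
    (h0 : proj B j f = 0) : f = 0 := by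
  have hA' (w : ℕ) : casOp A (proj B w f) = cas A.card i • proj B w f :=
    apply_eq_smul_of_commute (commute_casOp_proj (.inr h) w) hA
  have hB' (w : ℕ) : casOp B (proj B w f) = cas B.card j • proj B w f :=
    apply_eq_smul_of_commute (commute_casOp_proj (.inl subset_rfl) w) hB
  refine eq_zero_of_proj_eq_zero (C := B) fun w => ?_
  rcases lt_or_ge w j with hw | hw
  · exact eq_zero_of_casOp (count_proj B w f) (hB' w) (by omega) hw
  induction w, hw using Nat.le_induction with
  | base => exact h0
  | succ w hw ih =>
    -- The component of `lower (A ∪ B) f = 0` of weight `w` on `B`.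
    have h1 : lower B (proj B (w + 1) f) = 0 := by
      have h2 : proj B w (lower A f) = 0 := by
        rw [← Module.End.mul_apply, (commute_lower_of_mem (proj_mem_commAlg h.symm w)).eq,
          Module.End.mul_apply, ih, map_zero]
      have h3 := congrArg (proj B w) hf.2
      rw [lower_union h, LinearMap.add_apply, map_add, h2, zero_add, map_zero] at h3
      rw [← Module.End.mul_apply, lower_mul_proj, Module.End.mul_apply, h3]
    rcases le_or_gt (w + 1) (j + N) with h2 | h2
    · exact eq_zero_of_casOp_of_lower (count_proj B _ f) (hB' _) (by omega) (by omega) h1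
    · rcases le_or_gt (w + 1) (i + j + N) with h3 | h3
      · exact eq_zero_of_casOp (count_left_proj h hf.1 h3) (hA' _) (by omega) (by omega)
      · exact proj_eq_zero_of_lt hf.1 h3

/-- The Clebsch–Gordan operator is onto the lowest weight vectors with the right Casimir
eigenvalues. The explicit form of the inverse shows that it only involves the sites of `A ∪ B`, and that
it is equivariant. -/
theorem exists_cg_inverse (h : Disjoint A B) {N : ℕ} (hNA : 2 * i + N ≤ A.card)
    (hNB : 2 * j + N ≤ B.card) :
    ∃ c : ℂ, ∀ f ∈ lowest (A ∪ B) (i + j + N), casOp A f = cas A.card i • f →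
      casOp B f = cas B.card j • f →
      (c • (lower A ^ N * proj B j)) f ∈ lowest A i ∧ (c • (lower A ^ N * proj B j)) f ∈ lowest B j ∧
      cg A B N (A.card - 2 * i) (B.card - 2 * j) ((c • (lower A ^ N * proj B j)) f) = f := by
  obtain ⟨c, hc⟩ := exists_smul_raise_lower_pow A i N hNA
  set e : ℤ := cgCoef N (A.card - 2 * i) (B.card - 2 * j) 0 with he
  have he0 : (e : ℂ) ≠ 0 := by exact Int.cast_ne_zero.2 (cgCoef_zero_ne_zero (by omega))
  -- With this factor the preimage `g` satisfies `proj B j (cg g) = e • R_N g = proj B j f`.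
  refine ⟨(e : ℂ)⁻¹ * c, fun f hf hA hB => ?_⟩
  have hA' : casOp A (proj B j f) = cas A.card i • proj B j f :=
    apply_eq_smul_of_commute (commute_casOp_proj (.inr h) j) hA
  have hB' : casOp B (proj B j f) = cas B.card j • proj B j f :=
    apply_eq_smul_of_commute (commute_casOp_proj (.inl subset_rfl) j) hB
  have hcA : count A (proj B j f) = ((i + N : ℕ) : ℂ) • proj B j f := by
    rw [count_left_proj h hf.1 (by omega), show i + j + N - j = i + N by omega]
  have hcB := count_proj B j f
  have hlB : proj B j f ∈ lowest B j := ⟨hcB, lower_eq_zero_of_casOp hcB hB'⟩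
  set g : Fun n := (((e : ℂ)⁻¹ * c) • (lower A ^ N * proj B j)) f with hg
  have hg' : g = ((e : ℂ)⁻¹ * c) • (lower A ^ N) (proj B j f) := rfl
  have hgA : g ∈ lowest A i := by
    rw [hg']
    refine Submodule.smul_mem _ _ ?_
    have h1 := count_lower_pow hcA N
    rw [show (((i + N : ℕ) : ℂ) - N) = i by push_cast; ring] at h1
    exact ⟨h1, lower_eq_zero_of_casOp h1
      (apply_eq_smul_of_commute ((commute_casOp_lower (.inl subset_rfl)).pow_right N) hA')⟩
  have hgB : g ∈ lowest B j := by
    rw [hg']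
    exact Submodule.smul_mem _ _ (apply_mem_lowest (pow_mem (lower_mem_commAlg h) N) hlB)
  refine ⟨hgA, hgB, ?_⟩
  have hproj : proj B j (cg A B N (A.card - 2 * i) (B.card - 2 * j) g) = proj B j f := by
    rw [proj_cg h hgB, ← he, hg', map_smul, smul_smul, ← mul_assoc, mul_inv_cancel₀ he0, one_mul,
      ← hc _ hcA hA']
  refine sub_eq_zero.1 (eq_zero_of_proj_lowest (i := i) (j := j) (N := N) h hNA hNB ?_ ?_ ?_ ?_)
  · exact sub_mem (cg_mem_lowest h hgA hgB N) hf
  · rw [map_sub, hA, smul_sub, apply_eq_smul_of_commute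
      (commute_casOp_cg (.inl subset_rfl) (.inr h) N _ _) (casOp_apply_of_mem_lowest hgA)]
  · rw [map_sub, hB, smul_sub, apply_eq_smul_of_commute
      (commute_casOp_cg (.inr h.symm) (.inl subset_rfl) N _ _) (casOp_apply_of_mem_lowest hgB)]
  · rw [map_sub, hproj, sub_self]

end ClebschGordan

/-! ### Intervals -/

theorem mem_seg {s t : ℕ} {x : Fin n} : x ∈ seg n s t ↔ s ≤ (x : ℕ) ∧ (x : ℕ) < s + t := by
  simp [seg]

theorem card_seg {s t : ℕ} (h : s + t ≤ n) : (seg n s t).card = t := by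
  have : (seg n s t).map Fin.valEmbedding = Finset.Ico s (s + t) := by
    ext y
    simp only [Finset.mem_map, mem_seg, Fin.valEmbedding_apply, Finset.mem_Ico]
    exact ⟨by rintro ⟨x, hx, rfl⟩; exact hx, fun hy => ⟨⟨y, by omega⟩, hy, rfl⟩⟩
  rw [← Finset.card_map Fin.valEmbedding, this]; simp

theorem seg_add (s t u : ℕ) : seg n s (t + u) = seg n s t ∪ seg n (s + t) u := by
  ext x; simp only [mem_seg, Finset.mem_union]; omega

theorem disjoint_seg (s t u : ℕ) : Disjoint (seg n s t) (seg n (s + t) u) :=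
  Finset.disjoint_left.2 fun x h h' => by rw [mem_seg] at h h'; omega

theorem seg_zero_self : seg n 0 n = Finset.univ := by
  ext x; simp [mem_seg]

theorem seg_left_subset (s t u : ℕ) : seg n s t ⊆ seg n s (t + u) := by
  rw [seg_add]; exact Finset.subset_union_left

theorem seg_right_subset (s t u : ℕ) : seg n (s + t) u ⊆ seg n s (t + u) := by
  rw [seg_add]; exact Finset.subset_union_right

/-! ### Frontiers and the spaces attached to them -/

/-- The vertices at level `q` and the leaves at lower levels, each given by the attached set and the
label. -/
def frontier (n : ℕ) : {T : LTree} → (s q : ℕ) → Labeling T → Set (Finset (Fin n) × ℕ)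
  | .leaf a, s, _, _ => {(seg n s a, 0)}
  | .node l r, s, 0, .node k _ _ => {(seg n s (l.size + r.size), k)}
  | .node l _, s, q + 1, .node _ κl κr => frontier n s q κl ∪ frontier n (s + l.size) q κr

/-- The vertices at levels at most `q`, each given by the attached set and the label. -/
def verts (n : ℕ) : {T : LTree} → (s q : ℕ) → Labeling T → Set (Finset (Fin n) × ℕ)
  | .leaf a, s, _, _ => {(seg n s a, 0)}
  | .node l r, s, 0, .node k _ _ => {(seg n s (l.size + r.size), k)}
  | .node l r, s, q + 1, .node k κl κr =>
      {(seg n s (l.size + r.size), k)} ∪ (verts n s q κl ∪ verts n (s + l.size) q κr)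

/-- The functions that are lowest weight vectors of weight `k` on `X`, for each `(X, k) ∈ P`. -/
def lowestSpace (P : Set (Finset (Fin n) × ℕ)) : Submodule ℂ (Fun n) :=
  ⨅ p ∈ P, lowest p.1 p.2

/-- The functions on which, for each `(X, k) ∈ P`, the Casimir operator of `X` acts as it does on
`S^{t-k,k}(X)`. -/
def casSpace (P : Set (Finset (Fin n) × ℕ)) : Submodule ℂ (Fun n) :=
  ⨅ p ∈ P, Module.End.eigenspace (casOp p.1) (cas p.1.card p.2)

theorem mem_lowestSpace {P : Set (Finset (Fin n) × ℕ)} {f : Fun n} :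
    f ∈ lowestSpace P ↔ ∀ p ∈ P, f ∈ lowest p.1 p.2 := by
  simp [lowestSpace, Submodule.mem_iInf]

theorem mem_casSpace {P : Set (Finset (Fin n) × ℕ)} {f : Fun n} :
    f ∈ casSpace P ↔ ∀ p ∈ P, casOp p.1 f = cas p.1.card p.2 • f := by
  simp [casSpace, Submodule.mem_iInf]

theorem mem_lowestSpace_union {P Q : Set (Finset (Fin n) × ℕ)} {f : Fun n} :
    f ∈ lowestSpace (P ∪ Q) ↔ f ∈ lowestSpace P ∧ f ∈ lowestSpace Q := by
  simp only [mem_lowestSpace, Set.mem_union, or_imp, forall_and]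

theorem mem_casSpace_union {P Q : Set (Finset (Fin n) × ℕ)} {f : Fun n} :
    f ∈ casSpace (P ∪ Q) ↔ f ∈ casSpace P ∧ f ∈ casSpace Q := by
  simp only [mem_casSpace, Set.mem_union, or_imp, forall_and]

theorem apply_mem_lowestSpace {P : Set (Finset (Fin n) × ℕ)} {X : Finset (Fin n)}
    (hP : ∀ p ∈ P, p.1 ⊆ X) {T : Module.End ℂ (Fun n)} (hT : T ∈ commAlg X) {f : Fun n}
    (hf : f ∈ lowestSpace P) : T f ∈ lowestSpace P :=
  mem_lowestSpace.2 fun p hp =>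
    apply_mem_lowest (commAlg_anti (hP p hp) hT) (mem_lowestSpace.1 hf p hp)

theorem apply_mem_casSpace {P : Set (Finset (Fin n) × ℕ)} {X : Finset (Fin n)}
    (hP : ∀ p ∈ P, p.1 ⊆ X) {T : Module.End ℂ (Fun n)} (hT : T ∈ commAlg X) {f : Fun n}
    (hf : f ∈ casSpace P) : T f ∈ casSpace P :=
  mem_casSpace.2 fun p hp => apply_eq_smul_of_commute
    (commute_casOp_of_mem (commAlg_anti (hP p hp) hT)).symm (mem_casSpace.1 hf p hp)

theorem subset_of_mem_verts {T : LTree} (κ : Labeling T) {s q : ℕ} {p : Finset (Fin n) × ℕ}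
    (hp : p ∈ verts n s q κ) : p.1 ⊆ seg n s T.size := by
  induction κ generalizing s q with
  | leaf =>
    rw [verts, Set.mem_singleton_iff] at hp
    subst hp; exact subset_rfl
  | @node l r k κl κr ihl ihr =>
    cases q with
    | zero =>
      rw [verts, Set.mem_singleton_iff] at hp
      subst hp; exact subset_rfl
    | succ q =>
      rw [verts] at hp
      rcases hp with hp | hp | hp
      · rw [Set.mem_singleton_iff] at hp
        subst hp; exact subset_rfl
      · exact (ihl hp).trans (seg_left_subset _ _ _)
      · exact (ihr hp).trans (seg_right_subset _ _ _)

theorem frontier_subset_verts {T : LTree} (κ : Labeling T) (s q : ℕ) :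
    frontier n s q κ ⊆ verts n s q κ := by
  induction κ generalizing s q with
  | leaf => rw [frontier, verts]
  | node k κl κr ihl ihr =>
    cases q with
    | zero => rw [frontier, verts]
    | succ q =>
      rw [frontier, verts]
      exact Set.subset_union_of_subset_right (Set.union_subset_union (ihl _ _) (ihr _ _)) _

theorem verts_succ {T : LTree} (κ : Labeling T) (s q : ℕ) :
    verts n s (q + 1) κ = verts n s q κ ∪ frontier n s (q + 1) κ := by
  induction κ generalizing s q with
  | leaf => rw [frontier, verts, verts, Set.union_self]
  | node k κl κr ihl ihr =>
    cases q with
    | zero =>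
      have h0 (T : LTree) (κ : Labeling T) (s : ℕ) : verts n s 0 κ = frontier n s 0 κ := by
        cases κ <;> rw [verts, frontier]
      rw [frontier, verts, verts, h0, h0]
    | succ q =>
      rw [frontier, verts, ihl, ihr, verts]
      ext p; simp only [Set.mem_union]; tauto

theorem root_mem_verts {T : LTree} (κ : Labeling T) (s q : ℕ) :
    (seg n s T.size, κ.root) ∈ verts n s q κ := by
  cases κ with
  | leaf => rw [verts]; rfl
  | node k κl κr =>
    cases q with
    | zero => rw [verts]; rfl
    | succ q => rw [verts]; exact Or.inl rfl

theorem levelBlocks_eq_image {T : LTree} (κ : Labeling T) (s q : ℕ) :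
    levelBlocks n T s q = Prod.fst '' frontier n s q κ := by
  induction κ generalizing s q with
  | leaf => rw [levelBlocks, frontier, Set.image_singleton]
  | node k κl κr ihl ihr =>
    cases q with
    | zero => rw [levelBlocks, frontier, Set.image_singleton]
    | succ q => rw [levelBlocks, frontier, Set.image_union, ihl, ihr]

theorem subset_of_mem_levelBlocks {T : LTree} {s q : ℕ} {B : Finset (Fin n)}
    (h : B ∈ levelBlocks n T s q) : B ⊆ seg n s T.size := by
  induction T generalizing s q with
  | leaf a =>
    rw [levelBlocks, Set.mem_singleton_iff] at h
    subst h; exact subset_rfl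
  | node l r ihl ihr =>
    cases q with
    | zero =>
      rw [levelBlocks, Set.mem_singleton_iff] at h
      subst h; exact subset_rfl
    | succ q =>
      rw [levelBlocks] at h
      rcases h with h | h
      · exact (ihl h).trans (seg_left_subset _ _ _)
      · exact (ihr h).trans (seg_right_subset _ _ _)

/-- The blocks of a level are pairwise disjoint, hence two points of one block are not separated by
any other. -/
theorem mem_iff_of_mem_levelBlocks {T : LTree} {s q : ℕ} {B C : Finset (Fin n)}
    (hB : B ∈ levelBlocks n T s q) (hC : C ∈ levelBlocks n T s q) {x y : Fin n} (hx : x ∈ C)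
    (hy : y ∈ C) : x ∈ B ↔ y ∈ B := by
  induction T generalizing s q with
  | leaf a =>
    rw [levelBlocks, Set.mem_singleton_iff] at hB hC
    subst hB; subst hC; simp [hx, hy]
  | node l r ihl ihr =>
    cases q with
    | zero =>
      rw [levelBlocks, Set.mem_singleton_iff] at hB hC
      subst hB; subst hC; simp [hx, hy]
    | succ q =>
      rw [levelBlocks] at hB hC
      have hd := Finset.disjoint_left.1 (disjoint_seg (n := n) s l.size r.size)
      rcases hB with hB | hB <;> rcases hC with hC | hC
      · exact ihl hB hC
      · have hB' := subset_of_mem_levelBlocks hB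
        have hC' := subset_of_mem_levelBlocks hC
        exact iff_of_false (fun h => hd (hB' h) (hC' hx)) (fun h => hd (hB' h) (hC' hy))
      · have hB' := subset_of_mem_levelBlocks hB
        have hC' := subset_of_mem_levelBlocks hC
        exact iff_of_false (fun h => hd (hC' hx) (hB' h)) (fun h => hd (hC' hy) (hB' h))
      · exact ihr hB hC

theorem mem_setwiseStabilizer {bs : Set (Finset (Fin n))} {g : Equiv.Perm (Fin n)} :
    g ∈ setwiseStabilizer bs ↔ ∀ B ∈ bs, g • B = B := by
  simp [setwiseStabilizer, Subgroup.mem_iInf, MulAction.mem_stabilizer_iff]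

theorem swap_mem_setwiseStabilizer {T : LTree} {s q : ℕ} {C : Finset (Fin n)}
    (hC : C ∈ levelBlocks n T s q) {x y : Fin n} (hx : x ∈ C) (hy : y ∈ C) :
    Equiv.swap x y ∈ setwiseStabilizer (levelBlocks n T s q) :=
  mem_setwiseStabilizer.2 fun _ hB => swap_smul_eq (mem_iff_of_mem_levelBlocks hB hC hx hy)

theorem smul_seg_of_mem_setwiseStabilizer {T : LTree} {s q : ℕ} {g : Equiv.Perm (Fin n)}
    (hg : g ∈ setwiseStabilizer (levelBlocks n T s q)) : g • seg n s T.size = seg n s T.size := by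
  rw [mem_setwiseStabilizer] at hg
  induction T generalizing s q with
  | leaf a => exact hg _ (by rw [levelBlocks]; rfl)
  | node l r ihl ihr =>
    cases q with
    | zero => exact hg _ (by rw [levelBlocks]; rfl)
    | succ q =>
      rw [LTree.size, seg_add, Finset.smul_finset_union]
      rw [levelBlocks] at hg
      rw [ihl fun B hB => hg B (.inl hB), ihr fun B hB => hg B (.inr hB)]

/-- The space `W_q` of the chain attached to a labeling, for a tree placed on the interval that
starts at `s`. -/
def chainSpace (n : ℕ) {T : LTree} (s q : ℕ) (κ : Labeling T) : Submodule ℂ (Fun n) :=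
  lowest (seg n s T.size) κ.root ⊓ casSpace (verts n s q κ)

theorem mem_chainSpace {T : LTree} {κ : Labeling T} {s q : ℕ} {f : Fun n} :
    f ∈ chainSpace n s q κ ↔
      f ∈ lowest (seg n s T.size) κ.root ∧ f ∈ casSpace (verts n s q κ) := Iff.rfl

theorem apply_mem_chainSpace {T : LTree} {κ : Labeling T} {s q : ℕ} {S : Module.End ℂ (Fun n)}
    (hS : S ∈ commAlg (seg n s T.size)) {f : Fun n} (hf : f ∈ chainSpace n s q κ) :
    S f ∈ chainSpace n s q κ :=
  ⟨apply_mem_lowest hS hf.1, apply_mem_casSpace (fun _ hp => subset_of_mem_verts κ hp) hS hf.2⟩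

theorem apply_mem_frontier {T : LTree} {κ : Labeling T} {s q : ℕ} {S : Module.End ℂ (Fun n)}
    (hS : S ∈ commAlg (seg n s T.size)) {f : Fun n} (hf : f ∈ lowestSpace (frontier n s q κ)) :
    S f ∈ lowestSpace (frontier n s q κ) :=
  apply_mem_lowestSpace (fun _ hp => subset_of_mem_verts κ (frontier_subset_verts κ s q hp)) hS hf

theorem permRep_mem_frontier {T : LTree} {κ : Labeling T} {s q : ℕ} {g : Equiv.Perm (Fin n)}
    (hg : g ∈ setwiseStabilizer (levelBlocks n T s q)) {f : Fun n}
    (hf : f ∈ lowestSpace (frontier n s q κ)) : permRep n g f ∈ lowestSpace (frontier n s q κ) := by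
  rw [levelBlocks_eq_image κ, mem_setwiseStabilizer] at hg
  exact mem_lowestSpace.2 fun p hp =>
    permRep_mem_lowest (hg _ ⟨p, hp, rfl⟩) (mem_lowestSpace.1 hf p hp)

/-! ### The intertwining operators of a tree -/

/-- The Clebsch–Gordan operator of the root of a tree with subtrees of sizes `a` and `b`, placed on
the interval that starts at `s`, where `k`, `i` and `j` are the labels of the root and its sons. -/
def nodeOp (n s a b k i j : ℕ) : Module.End ℂ (Fun n) :=
  cg (seg n s a) (seg n (s + a) b) (k - i - j) ((a : ℤ) - 2 * i) ((b : ℤ) - 2 * j)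

/-- The product of the Clebsch–Gordan operators of the internal vertices at levels less than `q`. It
maps the tensor product attached to the frontier at level `q` into the space attached to the root. -/
def treeOp (n : ℕ) : {T : LTree} → (s q : ℕ) → Labeling T → Module.End ℂ (Fun n)
  | .leaf _, _, _, _ => 1
  | .node _ _, _, 0, .node _ _ _ => 1
  | .node l r, s, q + 1, .node k κl κr =>
      nodeOp n s l.size r.size k κl.root κr.root *
        (treeOp n s q κl * treeOp n (s + l.size) q κr)

theorem disjoint_of_disjoint_seg {s a b : ℕ} {C : Finset (Fin n)}
    (h : Disjoint (seg n s (a + b)) C) : Disjoint (seg n s a) C ∧ Disjoint (seg n (s + a) b) C := by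
  rwa [seg_add, Finset.disjoint_union_left] at h

theorem nodeOp_mem_commAlg {s a b : ℕ} {C : Finset (Fin n)} (h : Disjoint (seg n s (a + b)) C)
    (k i j : ℕ) : nodeOp n s a b k i j ∈ commAlg C :=
  cg_mem_commAlg (disjoint_of_disjoint_seg h).1 (disjoint_of_disjoint_seg h).2 _ _ _

theorem treeOp_mem_commAlg {T : LTree} (κ : Labeling T) {s q : ℕ} {C : Finset (Fin n)}
    (h : Disjoint (seg n s T.size) C) : treeOp n s q κ ∈ commAlg C := by
  induction κ generalizing s q with
  | leaf => rw [treeOp]; exact one_mem _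
  | node k κl κr ihl ihr =>
    cases q with
    | zero => rw [treeOp]; exact one_mem _
    | succ q =>
      rw [treeOp]
      exact mul_mem (nodeOp_mem_commAlg h _ _ _) (mul_mem (ihl (disjoint_of_disjoint_seg h).1)
        (ihr (disjoint_of_disjoint_seg h).2))

theorem commute_permRep_treeOp {T : LTree} (κ : Labeling T) {s q : ℕ} {g : Equiv.Perm (Fin n)}
    (hg : g ∈ setwiseStabilizer (levelBlocks n T s q)) :
    Commute (permRep n g) (treeOp n s q κ) := by
  induction κ generalizing s q with
  | leaf => rw [treeOp]; exact Commute.one_right _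
  | @node l r k κl κr ihl ihr =>
    cases q with
    | zero => rw [treeOp]; exact Commute.one_right _
    | succ q =>
      rw [levelBlocks] at hg
      have hl : g ∈ setwiseStabilizer (levelBlocks n l s q) :=
        mem_setwiseStabilizer.2 fun B hB => mem_setwiseStabilizer.1 hg B (.inl hB)
      have hr : g ∈ setwiseStabilizer (levelBlocks n r (s + l.size) q) :=
        mem_setwiseStabilizer.2 fun B hB => mem_setwiseStabilizer.1 hg B (.inr hB)
      rw [treeOp]
      exact (commute_permRep_cg (smul_seg_of_mem_setwiseStabilizer hl)
        (smul_seg_of_mem_setwiseStabilizer hr) _ _ _).mul_right ((ihl hl).mul_right (ihr hr))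

theorem nodeOp_mem_lowest {s a b k i j : ℕ} (hs : s + (a + b) ≤ n) (hk : i + j ≤ k) {f : Fun n}
    (hA : f ∈ lowest (seg n s a) i) (hB : f ∈ lowest (seg n (s + a) b) j) :
    nodeOp n s a b k i j f ∈ lowest (seg n s (a + b)) k := by
  have := cg_mem_lowest (disjoint_seg s a b) hA hB (k - i - j)
  rw [card_seg (by omega), card_seg (by omega), show i + j + (k - i - j) = k by omega,
    ← seg_add] at this
  exact this

theorem commute_casOp_nodeOp {s a b : ℕ} {C : Finset (Fin n)}
    (hC : C ⊆ seg n s a ∨ C ⊆ seg n (s + a) b) (k i j : ℕ) :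
    Commute (casOp C) (nodeOp n s a b k i j) := by
  rcases hC with h | h
  · exact commute_casOp_cg (.inl h) (.inr (Finset.disjoint_of_subset_left h (disjoint_seg _ _ _)))
      _ _ _
  · exact commute_casOp_cg
      (.inr (Finset.disjoint_of_subset_left h (disjoint_seg _ _ _).symm)) (.inl h) _ _ _

theorem nodeOp_mem_chainSpace {l r : LTree} {k s q : ℕ} {κl : Labeling l} {κr : Labeling r}
    (hs : s + (l.size + r.size) ≤ n) (hk : κl.root + κr.root ≤ k) {f : Fun n}
    (hl : f ∈ chainSpace n s q κl) (hr : f ∈ chainSpace n (s + l.size) q κr) :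
    nodeOp n s l.size r.size k κl.root κr.root f ∈ chainSpace n s (q + 1) (.node k κl κr) := by
  have h1 := nodeOp_mem_lowest hs hk hl.1 hr.1
  refine ⟨h1, ?_⟩
  rw [verts, SetLike.mem_coe, mem_casSpace_union, mem_casSpace_union]
  refine ⟨mem_casSpace.2 ?_, mem_casSpace.2 fun p hp => ?_, mem_casSpace.2 fun p hp => ?_⟩
  · rintro p rfl
    exact casOp_apply_of_mem_lowest h1
  · exact apply_eq_smul_of_commute (commute_casOp_nodeOp (.inl (subset_of_mem_verts κl hp)) _ _ _)
      (mem_casSpace.1 hl.2 p hp)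
  · exact apply_eq_smul_of_commute (commute_casOp_nodeOp (.inr (subset_of_mem_verts κr hp)) _ _ _)
      (mem_casSpace.1 hr.2 p hp)

theorem chainSpace_zero {T : LTree} (κ : Labeling T) (s : ℕ) :
    chainSpace n s 0 κ = lowest (seg n s T.size) κ.root := by
  refine le_antisymm inf_le_left fun f hf => ⟨hf, mem_casSpace.2 fun p hp => ?_⟩
  have : p = (seg n s T.size, κ.root) := by
    cases κ <;> rw [verts] at hp <;> exact hp
  rw [this]; exact casOp_apply_of_mem_lowest hf

theorem frontier_zero_eq {T : LTree} (κ : Labeling T) (s : ℕ) :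
    lowestSpace (frontier n s 0 κ) = lowest (seg n s T.size) κ.root := by
  cases κ <;> simp [frontier, lowestSpace, LTree.size, Labeling.root]

theorem chainSpace_leaf {a : ℕ} (s q : ℕ) : chainSpace n s q (.leaf (a := a)) =
    lowestSpace (frontier n s q (.leaf (a := a))) := by
  have h := chainSpace_zero (n := n) (.leaf (a := a)) s
  have h' := frontier_zero_eq (n := n) (.leaf (a := a)) s
  rw [chainSpace, verts] at h ⊢
  rw [frontier] at h' ⊢
  rw [h, h']

/-- The consequences of the conditions at an internal vertex that are used for the Clebsch–Gordan
operators. -/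
theorem Labeling.Admissible.bounds {l r : LTree} {k : ℕ} {κl : Labeling l} {κr : Labeling r}
    (h : (Labeling.node k κl κr).Admissible) :
    κl.root + κr.root ≤ k ∧ 2 * κl.root + (k - κl.root - κr.root) ≤ l.size ∧
      2 * κr.root + (k - κl.root - κr.root) ≤ r.size := by
  rw [Labeling.Admissible] at h
  omega

/-- The intertwining operator maps the tensor product at the frontier into the space of the chain. -/
theorem treeOp_mem_chainSpace {T : LTree} {κ : Labeling T} (hκ : κ.Admissible) {s q : ℕ}
    (hs : s + T.size ≤ n) {f : Fun n} (hf : f ∈ lowestSpace (frontier n s q κ)) :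
    treeOp n s q κ f ∈ chainSpace n s q κ := by
  induction κ generalizing s q f with
  | leaf => rw [treeOp, chainSpace_leaf]; exact hf
  | @node l r k κl κr ihl ihr =>
    cases q with
    | zero => rw [treeOp, chainSpace_zero, ← frontier_zero_eq]; exact hf
    | succ q =>
      rw [LTree.size] at hs
      rw [frontier, mem_lowestSpace_union] at hf
      have hb := hκ.bounds
      rw [Labeling.Admissible] at hκ
      rw [treeOp]
      have hd := disjoint_seg (n := n) s l.size r.size
      refine nodeOp_mem_chainSpace hs hb.1 ?_ ?_
      · exact ihl hκ.2.2.2.2.2.1 (by omega)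
          (apply_mem_frontier (treeOp_mem_commAlg κr hd.symm) hf.1)
      · exact apply_mem_chainSpace (treeOp_mem_commAlg κl hd)
          (ihr hκ.2.2.2.2.2.2 (by omega) hf.2)

theorem eq_zero_of_nodeOp_eq_zero {s a b k i j : ℕ} (hs : s + (a + b) ≤ n)
    (ha : 2 * i + (k - i - j) ≤ a) (hb : 2 * j + (k - i - j) ≤ b) {f : Fun n}
    (hA : f ∈ lowest (seg n s a) i) (hB : f ∈ lowest (seg n (s + a) b) j)
    (h0 : nodeOp n s a b k i j f = 0) : f = 0 := by
  have hca : (seg n s a).card = a := card_seg (by omega)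
  have hcb : (seg n (s + a) b).card = b := card_seg (by omega)
  refine eq_zero_of_cg_eq_zero (disjoint_seg s a b) hA hB (N := k - i - j) (by omega) (by omega) ?_
  rw [hca, hcb]; exact h0

/-- The intertwining operator is injective on the tensor product at the frontier. -/
theorem eq_zero_of_treeOp_eq_zero {T : LTree} {κ : Labeling T} (hκ : κ.Admissible) {s q : ℕ}
    (hs : s + T.size ≤ n) {f : Fun n} (hf : f ∈ lowestSpace (frontier n s q κ))
    (h0 : treeOp n s q κ f = 0) : f = 0 := by
  induction κ generalizing s q f with
  | leaf => rw [treeOp] at h0; exact h0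
  | @node l r k κl κr ihl ihr =>
    cases q with
    | zero => rw [treeOp] at h0; exact h0
    | succ q =>
      rw [LTree.size] at hs
      rw [frontier, mem_lowestSpace_union] at hf
      have hb := hκ.bounds
      rw [Labeling.Admissible] at hκ
      rw [treeOp] at h0
      have hd := disjoint_seg (n := n) s l.size r.size
      have h1 := apply_mem_frontier (treeOp_mem_commAlg κr hd.symm (q := q)) hf.1
      have h2 := treeOp_mem_chainSpace hκ.2.2.2.2.2.1 (by omega) h1
      have h3 := treeOp_mem_chainSpace hκ.2.2.2.2.2.2 (by omega) hf.2
      have h4 := apply_mem_chainSpace (treeOp_mem_commAlg κl hd (q := q)) h3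
      refine ihr hκ.2.2.2.2.2.2 (by omega) hf.2 (ihl hκ.2.2.2.2.2.1 (by omega) h1 ?_)
      exact eq_zero_of_nodeOp_eq_zero hs hb.2.1 hb.2.2 h2.1 h4.1 h0

/-- `exists_cg_inverse` at an internal vertex, retaining of the inverse only that it acts on the sites
of the vertex and commutes with the Casimir operators of the vertices below. -/
theorem exists_nodeOp_inverse {s a b k i j : ℕ} (hs : s + (a + b) ≤ n) (hk : i + j ≤ k)
    (ha : 2 * i + (k - i - j) ≤ a) (hb : 2 * j + (k - i - j) ≤ b) :
    ∃ S : Module.End ℂ (Fun n), (∀ C, Disjoint (seg n s (a + b)) C → S ∈ commAlg C) ∧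
      (∀ C, C ⊆ seg n s a ∨ C ⊆ seg n (s + a) b → Commute (casOp C) S) ∧
      ∀ f ∈ lowest (seg n s (a + b)) k, casOp (seg n s a) f = cas (seg n s a).card i • f →
        casOp (seg n (s + a) b) f = cas (seg n (s + a) b).card j • f →
        S f ∈ lowest (seg n s a) i ∧ S f ∈ lowest (seg n (s + a) b) j ∧
          nodeOp n s a b k i j (S f) = f := by
  have hca : (seg n s a).card = a := card_seg (by omega)
  have hcb : (seg n (s + a) b).card = b := card_seg (by omega)
  have hd := disjoint_seg (n := n) s a b
  obtain ⟨c, hc⟩ := exists_cg_inverse hd (i := i) (j := j) (N := k - i - j) (by omega) (by omega)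
  rw [← seg_add, show i + j + (k - i - j) = k by omega, hca, hcb] at hc
  refine ⟨c • (lower (seg n s a) ^ (k - i - j) * proj (seg n (s + a) b) j), fun C hC => ?_,
    fun C hC => ?_, fun f hf hA hB => hc f hf (by rw [hca] at hA; exact hA)
      (by rw [hcb] at hB; exact hB)⟩
  · exact Subalgebra.smul_mem _ (mul_mem (pow_mem (lower_mem_commAlg (disjoint_of_disjoint_seg hC).1)
      _) (proj_mem_commAlg (disjoint_of_disjoint_seg hC).2 _)) _
  · have h1 : C ⊆ seg n s a ∨ Disjoint C (seg n s a) :=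
      hC.imp id fun h => Finset.disjoint_of_subset_left h hd.symm
    have h2 : C ⊆ seg n (s + a) b ∨ Disjoint C (seg n (s + a) b) :=
      hC.symm.imp id fun h => Finset.disjoint_of_subset_left h hd
    exact ((((commute_casOp_lower h1).pow_right _).mul_right (commute_casOp_proj h2 _)).smul_right _)

/-- The tensor product attached to the frontier at level `q` maps onto the space of the chain. That the
inverse acts on the sites of the tree only is what lets the two subtrees be treated separately. -/
theorem exists_treeOp_inverse {T : LTree} {κ : Labeling T} (hκ : κ.Admissible) {s : ℕ} (q : ℕ)
    (hs : s + T.size ≤ n) :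
    ∃ S : Module.End ℂ (Fun n), (∀ C, Disjoint (seg n s T.size) C → S ∈ commAlg C) ∧
      ∀ f ∈ chainSpace n s q κ, S f ∈ lowestSpace (frontier n s q κ) ∧
        treeOp n s q κ (S f) = f := by
  induction κ generalizing s q with
  | leaf =>
    refine ⟨1, fun _ _ => one_mem _, fun f hf => ?_⟩
    rw [chainSpace_leaf] at hf
    rw [treeOp]
    exact ⟨hf, rfl⟩
  | @node l r k κl κr ihl ihr =>
    cases q with
    | zero =>
      refine ⟨1, fun _ _ => one_mem _, fun f hf => ?_⟩
      rw [chainSpace_zero, ← frontier_zero_eq] at hf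
      rw [treeOp]
      exact ⟨hf, rfl⟩
    | succ q =>
      rw [LTree.size] at hs ⊢
      have hb := hκ.bounds
      rw [Labeling.Admissible] at hκ
      have hd := disjoint_seg (n := n) s l.size r.size
      obtain ⟨S, hS1, hS2, hS3⟩ := exists_nodeOp_inverse hs hb.1 hb.2.1 hb.2.2
      obtain ⟨Sl, hl1, hl2⟩ := ihl hκ.2.2.2.2.2.1 (s := s) q (by omega)
      obtain ⟨Sr, hr1, hr2⟩ := ihr hκ.2.2.2.2.2.2 (s := s + l.size) q (by omega)
      refine ⟨Sr * Sl * S, fun C hC => mul_mem (mul_mem (hr1 C (disjoint_of_disjoint_seg hC).2)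
        (hl1 C (disjoint_of_disjoint_seg hC).1)) (hS1 C hC), fun f hf => ?_⟩
      obtain ⟨hf1, hf2⟩ := mem_chainSpace.1 hf
      rw [LTree.size, Labeling.root] at hf1
      rw [verts, mem_casSpace_union, mem_casSpace_union] at hf2
      obtain ⟨-, hfl, hfr⟩ := hf2
      have hel := mem_casSpace.1 hfl _ (root_mem_verts κl s q)
      have her := mem_casSpace.1 hfr _ (root_mem_verts κr _ q)
      obtain ⟨h1, h2, h3⟩ := hS3 f hf1 hel her
      have h4 : S f ∈ chainSpace n s q κl := ⟨h1, mem_casSpace.2 fun p hp =>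
        apply_eq_smul_of_commute (hS2 _ (.inl (subset_of_mem_verts κl hp)))
          (mem_casSpace.1 hfl p hp)⟩
      have h5 : S f ∈ chainSpace n (s + l.size) q κr := ⟨h2, mem_casSpace.2 fun p hp =>
        apply_eq_smul_of_commute (hS2 _ (.inr (subset_of_mem_verts κr hp)))
          (mem_casSpace.1 hfr p hp)⟩
      obtain ⟨h6, h7⟩ := hl2 _ h4
      obtain ⟨h8, h9⟩ := hr2 _ (apply_mem_chainSpace (hl1 _ hd) h5)
      rw [frontier, mem_lowestSpace_union, treeOp]
      refine ⟨⟨apply_mem_frontier (hr1 _ hd.symm) h6, h8⟩, ?_⟩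
      simp only [Module.End.mul_apply]
      rw [h9, h7, h3]

/-! ### Tensor products and slices -/

/-- The functions that vanish outside the set of subsets of `X`. -/
def suppSpace (X : Finset (Fin n)) : Submodule ℂ (Fun n) where
  carrier := {f | ∀ Z, ¬ Z ⊆ X → f Z = 0}
  add_mem' hf hg Z hZ := by simp [hf Z hZ, hg Z hZ]
  zero_mem' _ _ := rfl
  smul_mem' c f hf Z hZ := by simp [hf Z hZ]

theorem mem_suppSpace {X : Finset (Fin n)} {f : Fun n} :
    f ∈ suppSpace X ↔ ∀ Z, ¬ Z ⊆ X → f Z = 0 := Iff.rfl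

theorem suppSpace_univ : suppSpace (Finset.univ : Finset (Fin n)) = ⊤ :=
  eq_top_iff.2 fun _ _ Z hZ => absurd (Finset.subset_univ Z) hZ

theorem mem_permModule_iff {X : Finset (Fin n)} {k : ℕ} {f : Fun n} :
    f ∈ permModule X k ↔ count X f = (k : ℂ) • f ∧ f ∈ suppSpace X := by
  rw [count_eq_smul_iff, mem_suppSpace]
  constructor
  · intro h
    refine ⟨fun Z hZ => h Z fun h' => hZ ?_, fun Z hZ => h Z fun h' => hZ ?_⟩
    · rw [Finset.mem_powersetCard] at h'
      rw [Finset.inter_eq_left.2 h'.1, h'.2]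
    · exact (Finset.mem_powersetCard.1 h').1
  · rintro ⟨h1, h2⟩ Z hZ
    by_cases hX : Z ⊆ X
    · refine h1 Z fun h => hZ ?_
      rw [Finset.inter_eq_left.2 hX] at h
      exact Finset.mem_powersetCard.2 ⟨hX, h⟩
    · exact h2 Z hX

theorem specht_eq (X : Finset (Fin n)) (k : ℕ) : specht X k = lowest X k ⊓ suppSpace X := by
  ext f
  have h (hf : f ∈ suppSpace X) : lower Finset.univ f = lower X f := by
    rw [← Finset.union_compl X, lower_union disjoint_compl_right, LinearMap.add_apply,
      add_eq_left, lower, LinearMap.sum_apply]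
    refine Finset.sum_eq_zero fun y hy => funext fun Z => ?_
    rw [ann_apply]
    split_ifs
    · rfl
    · exact hf _ fun h' => Finset.mem_compl.1 hy (h' (Finset.mem_insert_self y Z))
  rw [specht, Submodule.mem_inf, Submodule.mem_inf, mem_permModule_iff, LinearMap.mem_ker,
    radonD_eq_lower, mem_lowest]
  constructor
  · rintro ⟨⟨h1, h2⟩, h3⟩; exact ⟨⟨h1, by rw [← h h2, h3]⟩, h2⟩
  · rintro ⟨⟨h1, h3⟩, h2⟩; exact ⟨⟨h1, h2⟩, by rw [h h2, h3]⟩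

theorem tensor_apply (A B : Finset (Fin n)) (φ ψ : Fun n) (Z : Finset (Fin n)) :
    tensor A B φ ψ Z = if Z ⊆ A ∪ B then φ (Z ∩ A) * ψ (Z ∩ B) else 0 := rfl

/-- The operator `φ ↦ φ ⊗ ψ`. -/
def tensorLeft (A B : Finset (Fin n)) (ψ : Fun n) : Module.End ℂ (Fun n) where
  toFun φ := tensor A B φ ψ
  map_add' φ φ' := by ext Z; by_cases h : Z ⊆ A ∪ B <;> simp [tensor_apply, h, add_mul]
  map_smul' c φ := by ext Z; by_cases h : Z ⊆ A ∪ B <;> simp [tensor_apply, h, mul_assoc]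

/-- The operator `ψ ↦ φ ⊗ ψ`. -/
def tensorRight (A B : Finset (Fin n)) (φ : Fun n) : Module.End ℂ (Fun n) where
  toFun ψ := tensor A B φ ψ
  map_add' φ φ' := by ext Z; by_cases h : Z ⊆ A ∪ B <;> simp [tensor_apply, h, mul_add]
  map_smul' c φ := by ext Z; by_cases h : Z ⊆ A ∪ B <;> simp [tensor_apply, h, mul_left_comm]

theorem tensorLeft_apply (A B : Finset (Fin n)) (φ ψ : Fun n) :
    tensorLeft A B ψ φ = tensor A B φ ψ := rfl

theorem tensorRight_apply (A B : Finset (Fin n)) (φ ψ : Fun n) :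
    tensorRight A B φ ψ = tensor A B φ ψ := rfl

theorem tensorLeft_mem_commAlg {A B : Finset (Fin n)} (h : Disjoint A B) (ψ : Fun n) :
    tensorLeft A B ψ ∈ commAlg A := by
  refine mem_commAlg.2 fun x hx => ?_
  have hxB : x ∉ B := Finset.disjoint_left.1 h hx
  constructor <;> refine LinearMap.ext fun f => funext fun Z => ?_ <;> by_cases hZ : x ∈ Z
  · simp [tensorLeft_apply, tensor_apply, ann_apply, hZ, hx]
  · simp [tensorLeft_apply, tensor_apply, ann_apply, hZ, hx, Finset.insert_inter_of_mem,
      Finset.insert_inter_of_notMem hxB, Finset.insert_subset_iff]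
  · have h1 : Z.erase x ⊆ A ∪ B ↔ Z ⊆ A ∪ B := by
      rw [← Finset.subset_insert_iff, Finset.insert_eq_of_mem (Finset.mem_union_left _ hx)]
    simp [tensorLeft_apply, tensor_apply, cre_apply, hZ, hx, h1, Finset.erase_inter,
      Finset.erase_eq_of_notMem, hxB]
  · simp [tensorLeft_apply, tensor_apply, cre_apply, hZ]

theorem tensor_comm (A B : Finset (Fin n)) (φ ψ : Fun n) :
    tensor A B φ ψ = tensor B A ψ φ := by
  ext Z; rw [tensor_apply, tensor_apply, Finset.union_comm, mul_comm]

theorem tensorRight_mem_commAlg {A B : Finset (Fin n)} (h : Disjoint A B) (φ : Fun n) :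
    tensorRight A B φ ∈ commAlg B := by
  have : tensorRight A B φ = tensorLeft B A φ := LinearMap.ext fun ψ => tensor_comm A B φ ψ
  rw [this]
  exact tensorLeft_mem_commAlg h.symm φ

theorem tensor_mem_suppSpace (A B : Finset (Fin n)) (φ ψ : Fun n) :
    tensor A B φ ψ ∈ suppSpace (A ∪ B) := fun Z hZ => by rw [tensor_apply, if_neg hZ]

/-- The slice `Y ↦ f (Y ∪ Z)` of a function of subsets, as a function of the subsets of `A`. -/
def slice (A Z : Finset (Fin n)) : Module.End ℂ (Fun n) where
  toFun f Y := if Y ⊆ A then f (Y ∪ Z) else 0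
  map_add' f g := by ext Y; by_cases h : Y ⊆ A <;> simp [h]
  map_smul' c f := by ext Y; by_cases h : Y ⊆ A <;> simp [h]

theorem slice_apply (A Z : Finset (Fin n)) (f : Fun n) (Y : Finset (Fin n)) :
    slice A Z f Y = if Y ⊆ A then f (Y ∪ Z) else 0 := rfl

theorem slice_mem_suppSpace (A Z : Finset (Fin n)) (f : Fun n) : slice A Z f ∈ suppSpace A :=
  fun Y hY => by rw [slice_apply, if_neg hY]

theorem slice_mem_commAlg {A Z : Finset (Fin n)} (h : Disjoint A Z) : slice A Z ∈ commAlg A := by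
  refine mem_commAlg.2 fun x hx => ?_
  have hxZ : x ∉ Z := Finset.disjoint_left.1 h hx
  constructor <;> refine LinearMap.ext fun f => funext fun Y => ?_ <;> by_cases hY : x ∈ Y
  · simp [slice_apply, ann_apply, hY]
  · simp [slice_apply, ann_apply, hY, hxZ, hx, Finset.insert_subset_iff]
  · have h1 : Y.erase x ⊆ A ↔ Y ⊆ A := by
      rw [← Finset.subset_insert_iff, Finset.insert_eq_of_mem hx]
    have h2 : (Y ∪ Z).erase x = Y.erase x ∪ Z := by
      rw [Finset.erase_union_distrib, Finset.erase_eq_of_notMem hxZ]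
    simp [slice_apply, cre_apply, hY, h1, h2]
  · simp [slice_apply, cre_apply, hY, hxZ]

/-- A function of subsets of `A ∪ B` all of whose slices lie in `U` and in `V` lies in `U ⊗ V`. -/
theorem mem_tensorSpace_of_slice {A B : Finset (Fin n)} {U V : Submodule ℂ (Fun n)} {f : Fun n}
    (hf : f ∈ suppSpace (A ∪ B)) (hU : ∀ Z ⊆ B, slice A Z f ∈ U) (hV : ∀ Y ⊆ A, slice B Y f ∈ V) :
    f ∈ tensorSpace A B U V := by
  obtain ⟨p, hp⟩ := LinearMap.exists_leftInverse_of_injective U.subtype U.ker_subtype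
  have hp' (u : U) : p u = u := LinearMap.congr_fun hp u
  let b := Module.finBasis ℂ U
  -- The coordinates of the slices `slice A Z f ∈ U` in the basis `b`, as functions of `Z`.
  let g (i : Fin (Module.finrank ℂ U)) : Fun n := fun Z =>
    if Z ⊆ B then b.repr (p (slice A Z f)) i else 0
  have hg (i) : g i ∈ V := by
    have : g i = ∑ Y ∈ A.powerset, b.repr (p (Pi.single Y 1)) i • slice B Y f := by
      ext Z
      by_cases hZ : Z ⊆ B
      · have h1 : slice A Z f = ∑ Y ∈ A.powerset, f (Y ∪ Z) • (Pi.single Y 1 : Fun n) := by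
          ext Y
          simp [slice_apply, Finset.sum_apply, Pi.single_apply]
        simp only [g, if_pos hZ, h1, map_sum, map_smul, Finset.sum_apply, Pi.smul_apply,
          Finsupp.coe_finsetSum, Finsupp.smul_apply, slice_apply, smul_eq_mul]
        exact Finset.sum_congr rfl fun Y _ => by rw [mul_comm, Finset.union_comm]
      · simp [g, hZ, slice_apply]
    rw [this]
    exact sum_mem fun Y hY => Submodule.smul_mem _ _ (hV Y (Finset.mem_powerset.1 hY))
  have hsum : f = ∑ i, tensor A B (b i) (g i) := by
    ext W
    rw [Finset.sum_apply]
    by_cases hW : W ⊆ A ∪ B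
    · have h1 : f W = slice A (W ∩ B) f (W ∩ A) := by
        rw [slice_apply, if_pos Finset.inter_subset_right, ← Finset.inter_union_distrib_left,
          Finset.inter_eq_left.2 hW]
      have h2 := b.sum_repr (p (slice A (W ∩ B) f))
      have h3 := congrArg (fun u : U => (u : Fun n) (W ∩ A)) h2
      simp only [hp' ⟨_, hU (W ∩ B) Finset.inter_subset_right⟩, Submodule.coe_sum,
        Finset.sum_apply, Submodule.coe_smul, Pi.smul_apply, smul_eq_mul] at h3
      rw [h1]
      have h4 : p (slice A (W ∩ B) f) = ⟨_, hU (W ∩ B) Finset.inter_subset_right⟩ :=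
        hp' ⟨_, hU (W ∩ B) Finset.inter_subset_right⟩
      rw [← h3]
      refine Finset.sum_congr rfl fun i _ => ?_
      rw [tensor_apply, if_pos hW]
      simp only [g, if_pos Finset.inter_subset_right, h4]
      rw [mul_comm]
    · rw [hf W hW]
      exact (Finset.sum_eq_zero fun i _ => by rw [tensor_apply, if_neg hW]).symm
  rw [hsum]
  exact sum_mem fun i _ => Submodule.subset_span ⟨b i, (b i).2, g i, hg i, rfl⟩

/-- The iterated tensor product `chainRep` is cut out by conditions at the individual vertices of the
frontier. -/
theorem chainRep_eq {T : LTree} (κ : Labeling T) (s q : ℕ) :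
    chainRep n s q κ = lowestSpace (frontier n s q κ) ⊓ suppSpace (seg n s T.size) := by
  induction κ generalizing s q with
  | leaf => rw [chainRep, specht_eq, frontier]; simp [lowestSpace, LTree.size]
  | @node l r k κl κr ihl ihr =>
    cases q with
    | zero => rw [chainRep, specht_eq, frontier]; simp [lowestSpace, LTree.size]
    | succ q =>
      have hd := disjoint_seg (n := n) s l.size r.size
      rw [chainRep, ihl, ihr, frontier, LTree.size, seg_add]
      refine le_antisymm (Submodule.span_le.2 ?_) ?_
      · rintro _ ⟨φ, hφ, ψ, hψ, rfl⟩
        refine ⟨mem_lowestSpace_union.2 ⟨?_, ?_⟩, tensor_mem_suppSpace _ _ _ _⟩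
        · exact apply_mem_frontier (tensorLeft_mem_commAlg hd ψ) hφ.1
        · exact apply_mem_frontier (tensorRight_mem_commAlg hd φ) hψ.1
      · rintro f ⟨hf, hs⟩
        obtain ⟨hl, hr⟩ := mem_lowestSpace_union.1 hf
        refine mem_tensorSpace_of_slice hs (fun Z hZ => ⟨?_, slice_mem_suppSpace _ _ _⟩)
          fun Y hY => ⟨?_, slice_mem_suppSpace _ _ _⟩
        · exact apply_mem_frontier
            (slice_mem_commAlg (Finset.disjoint_of_subset_right hZ hd)) hl
        · exact apply_mem_frontier
            (slice_mem_commAlg (Finset.disjoint_of_subset_right hY hd.symm)) hr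

/-! ### Existence and uniqueness of the chain -/

theorem isoAsRep_of_operator {K : Subgroup (Equiv.Perm (Fin n))} {U V : Submodule ℂ (Fun n)}
    (P : Module.End ℂ (Fun n)) (hP : ∀ g ∈ K, Commute (permRep n g) P)
    (hV : ∀ g ∈ K, ∀ v ∈ V, permRep n g v ∈ V) (hmaps : ∀ v ∈ V, P v ∈ U)
    (hinj : ∀ v ∈ V, P v = 0 → v = 0) (hsurj : ∀ u ∈ U, ∃ v ∈ V, P v = u) : IsoAsRep K U V := by
  have hb : Function.Bijective (P.restrict hmaps) := by
    constructor
    · rw [injective_iff_map_eq_zero]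
      intro v hv
      exact Subtype.ext (hinj v v.2 (congrArg Subtype.val hv))
    · rintro ⟨u, hu⟩
      obtain ⟨v, hv, rfl⟩ := hsurj u hu
      exact ⟨⟨v, hv⟩, rfl⟩
  let e := LinearEquiv.ofBijective (P.restrict hmaps) hb
  have he (v : V) : (e v : Fun n) = P v := rfl
  refine ⟨e.symm, fun g hg u => ?_⟩
  obtain ⟨v, rfl⟩ := e.surjective u
  have h1 : permRep n g (e v : Fun n) = P (permRep n g v) := by
    rw [he, ← Module.End.mul_apply, (hP g hg).eq, Module.End.mul_apply]
  have h2 : permRep n g (e v : Fun n) ∈ U := by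
    rw [h1]; exact hmaps _ (hV g hg v v.2)
  refine ⟨h2, ?_⟩
  have h3 : (⟨_, h2⟩ : U) = e ⟨permRep n g v, hV g hg v v.2⟩ := Subtype.ext h1
  rw [h3, e.symm_apply_apply, e.symm_apply_apply]

/-- Isomorphic representations have the same Casimir eigenvalues. -/
theorem casOp_apply_of_isoAsRep {K : Subgroup (Equiv.Perm (Fin n))} {U V : Submodule ℂ (Fun n)}
    (h : IsoAsRep K U V) {A : Finset (Fin n)} (hA : ∀ x ∈ A, ∀ y ∈ A, Equiv.swap x y ∈ K) {c : ℂ}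
    (hV : ∀ v ∈ V, casOp A v = c • v) {u : Fun n} (hu : u ∈ U) : casOp A u = c • u := by
  obtain ⟨e, he⟩ := h
  have hmem (x y : Fin n) (hx : x ∈ A) (hy : y ∈ A) : permRep n (Equiv.swap x y) u ∈ U :=
    (he _ (hA x hx y hy) ⟨u, hu⟩).1
  let w : U := ∑ x : A, ∑ y : A, ⟨permRep n (Equiv.swap (x : Fin n) y) u, hmem x y x.2 y.2⟩
  have hw : (w : Fun n) = casOp A u := by
    simp only [w, Submodule.coe_sum, casOp_eq_sum_swap, LinearMap.sum_apply]
    rw [← Finset.sum_coe_sort A]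
    exact Finset.sum_congr rfl fun x _ => Finset.sum_coe_sort A fun y =>
      permRep n (Equiv.swap (x : Fin n) y) u
  have hew : (e w : Fun n) = casOp A (e ⟨u, hu⟩) := by
    simp only [w, map_sum, Submodule.coe_sum, casOp_eq_sum_swap, LinearMap.sum_apply]
    rw [← Finset.sum_coe_sort A]
    refine Finset.sum_congr rfl fun x _ => ?_
    rw [← Finset.sum_coe_sort A]
    refine Finset.sum_congr rfl fun y _ => ?_
    exact (he _ (hA x x.2 y y.2) ⟨u, hu⟩).2
  rw [hV _ (e ⟨u, hu⟩).2] at hew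
  have : w = c • ⟨u, hu⟩ := e.injective (Subtype.ext (by rw [hew, map_smul]; rfl))
  rw [← hw, this]; rfl

theorem chainRep_zero_eq {T : LTree} (hT : T.size = n) (κ : Labeling T) (q : ℕ) :
    chainRep n 0 q κ = lowestSpace (frontier n 0 q κ) := by
  rw [chainRep_eq, hT, seg_zero_self, suppSpace_univ, inf_top_eq]

/-- Existence: the space of the chain carries the prescribed representation. -/
theorem isoAsRep_chainSpace {T : LTree} (hT : T.size = n) {κ : Labeling T} (hκ : κ.Admissible)
    (q : ℕ) : IsoAsRep (chainGroup n T q) (chainSpace n 0 q κ) (chainRep n 0 q κ) := by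
  have hs : 0 + T.size ≤ n := by omega
  rw [chainRep_zero_eq hT]
  obtain ⟨S, -, hS⟩ := exists_treeOp_inverse hκ q hs
  exact isoAsRep_of_operator (treeOp n 0 q κ) (fun g hg => commute_permRep_treeOp κ hg)
    (fun g hg v hv => permRep_mem_frontier hg hv) (fun v hv => treeOp_mem_chainSpace hκ hs hv)
    (fun v hv h0 => eq_zero_of_treeOp_eq_zero hκ hs hv h0) (fun u hu => ⟨S u, hS u hu⟩)

theorem finrank_eq_of_isoAsRep {K : Subgroup (Equiv.Perm (Fin n))} {U V : Submodule ℂ (Fun n)}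
    (h : IsoAsRep K U V) : Module.finrank ℂ U = Module.finrank ℂ V := by
  obtain ⟨e, -⟩ := h
  exact e.finrank_eq

/-- Uniqueness: a subspace that carries the prescribed representation has the Casimir eigenvalues and
the dimension of the space of the chain. -/
theorem eq_chainSpace_of_isoAsRep {T : LTree} (hT : T.size = n) {κ : Labeling T}
    (hκ : κ.Admissible) {q : ℕ} {U : Submodule ℂ (Fun n)} (hU : U ≤ chainSpace n 0 q κ)
    (h : IsoAsRep (chainGroup n T (q + 1)) U (chainRep n 0 (q + 1) κ)) :
    U = chainSpace n 0 (q + 1) κ := by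
  refine Submodule.eq_of_le_of_finrank_eq (fun u hu => ?_) ?_
  · obtain ⟨h1, h2⟩ := mem_chainSpace.1 (hU hu)
    refine mem_chainSpace.2 ⟨h1, ?_⟩
    rw [verts_succ, mem_casSpace_union]
    refine ⟨h2, mem_casSpace.2 fun p hp => casOp_apply_of_isoAsRep h ?_ ?_ hu⟩
    · have hp' : p.1 ∈ levelBlocks n T 0 (q + 1) := by
        rw [levelBlocks_eq_image κ]; exact ⟨p, hp, rfl⟩
      exact fun x hx y hy => swap_mem_setwiseStabilizer hp' hx hy
    · intro v hv
      rw [chainRep_zero_eq hT] at hv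
      exact casOp_apply_of_mem_lowest (mem_lowestSpace.1 hv p hp)
  · rw [finrank_eq_of_isoAsRep h, finrank_eq_of_isoAsRep (isoAsRep_chainSpace hT hκ (q + 1))]

theorem isRepChain_iff {T : LTree} (hT : T.size = n) {κ : Labeling T} (hκ : κ.Admissible)
    (W : Fin (T.height + 1) → Submodule ℂ (Fun n)) :
    IsRepChain κ W ↔ W = fun q : Fin (T.height + 1) => chainSpace n 0 (q : ℕ) κ := by
  have h0 : specht Finset.univ κ.root = chainSpace n 0 0 κ := by
    rw [specht_eq, suppSpace_univ, inf_top_eq, chainSpace_zero, hT, seg_zero_self]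
  constructor
  · rintro ⟨hW0, hW⟩
    funext q
    induction q using Fin.induction with
    | zero => rw [hW0, h0]; rfl
    | succ q ih =>
      obtain ⟨h1, h2⟩ := hW q
      rw [ih] at h1
      exact eq_chainSpace_of_isoAsRep hT hκ h1 h2
  · rintro rfl
    refine ⟨h0.symm, fun q => ⟨fun f hf => ?_, isoAsRep_chainSpace hT hκ _⟩⟩
    obtain ⟨h1, h2⟩ := mem_chainSpace.1 hf
    refine mem_chainSpace.2 ⟨h1, ?_⟩
    rw [Fin.val_succ, verts_succ, mem_casSpace_union] at h2
    exact h2.1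

/-! ### The invariant vector of a labeled tree -/

theorem mem_suppSpace_iff_ann {X : Finset (Fin n)} {f : Fun n} :
    f ∈ suppSpace X ↔ ∀ y ∉ X, ann y f = 0 := by
  constructor
  · refine fun h y hy => funext fun Z => ?_
    rw [ann_apply]
    split_ifs
    · rfl
    · exact h _ fun h' => hy (h' (Finset.mem_insert_self y Z))
  · intro h Z hZ
    obtain ⟨y, hy, hyX⟩ := Finset.not_subset.1 hZ
    have := congrFun (h y hyX) (Z.erase y)
    rwa [ann_apply, if_neg (Finset.notMem_erase y Z), Finset.insert_erase hy] at this

theorem apply_mem_suppSpace {X : Finset (Fin n)} {S : Module.End ℂ (Fun n)}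
    (hS : S ∈ commAlg Xᶜ) {f : Fun n} (hf : f ∈ suppSpace X) : S f ∈ suppSpace X := by
  rw [mem_suppSpace_iff_ann] at hf ⊢
  intro y hy
  exact apply_eq_zero_of_commute (mem_commAlg.1 hS y (Finset.mem_compl.2 hy)).1.symm (hf y hy)

/-- The vector of the smallest weight among the `treePhi n s m κ`; the others are obtained from it by
raising. -/
def treeVec (n : ℕ) : {T : LTree} → (s : ℕ) → Labeling T → Fun n
  | .leaf _, _, _ => Pi.single ∅ 1
  | .node l r, s, .node k κl κr =>
      nodeOp n s l.size r.size k κl.root κr.root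
        (tensor (seg n s l.size) (seg n (s + l.size) r.size)
          (treeVec n s κl) (treeVec n (s + l.size) κr))

theorem single_empty_mem_lowest (X : Finset (Fin n)) :
    (Pi.single ∅ 1 : Fun n) ∈ lowest X 0 := by
  refine ⟨count_eq_smul_iff.2 fun Z hZ => ?_, ?_⟩
  · rw [Pi.single_apply, if_neg]
    rintro rfl; simp at hZ
  · rw [lower, LinearMap.sum_apply]
    refine Finset.sum_eq_zero fun x _ => funext fun Z => ?_
    simp [ann_apply]

theorem treeVec_mem_chainSpace {T : LTree} {κ : Labeling T} (hκ : κ.Admissible) {s : ℕ} (q : ℕ)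
    (hs : s + T.size ≤ n) : treeVec n s κ ∈ chainSpace n s q κ := by
  induction κ generalizing s q with
  | leaf =>
    rw [treeVec, chainSpace_leaf, frontier]
    simpa [lowestSpace] using single_empty_mem_lowest _
  | @node l r k κl κr ihl ihr =>
    rw [LTree.size] at hs
    have hb := hκ.bounds
    rw [Labeling.Admissible] at hκ
    have hd := disjoint_seg (n := n) s l.size r.size
    have key (q : ℕ) : treeVec n s (.node k κl κr) ∈ chainSpace n s (q + 1) (.node k κl κr) := by
      rw [treeVec]
      refine nodeOp_mem_chainSpace hs hb.1 ?_ ?_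
      · exact apply_mem_chainSpace (tensorLeft_mem_commAlg hd _)
          (ihl hκ.2.2.2.2.2.1 q (by omega))
      · exact apply_mem_chainSpace (tensorRight_mem_commAlg hd _)
          (ihr hκ.2.2.2.2.2.2 q (by omega))
    cases q with
    | zero =>
      rw [chainSpace_zero]
      exact (mem_chainSpace.1 (key 0)).1
    | succ q => exact key q

theorem treeVec_mem_suppSpace {T : LTree} (κ : Labeling T) (s : ℕ) :
    treeVec n s κ ∈ suppSpace (seg n s T.size) := by
  cases κ with
  | leaf =>
    intro Z hZ
    rw [treeVec, Pi.single_apply, if_neg]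
    rintro rfl; exact hZ (Finset.empty_subset _)
  | @node l r k κl κr =>
    rw [treeVec, LTree.size]
    refine apply_mem_suppSpace (nodeOp_mem_commAlg disjoint_compl_right _ _ _) ?_
    rw [seg_add]
    exact tensor_mem_suppSpace _ _ _ _

theorem tensor_ne_zero {A B : Finset (Fin n)} (h : Disjoint A B) {φ ψ : Fun n}
    (hφ : φ ∈ suppSpace A) (hψ : ψ ∈ suppSpace B) (hφ0 : φ ≠ 0) (hψ0 : ψ ≠ 0) :
    tensor A B φ ψ ≠ 0 := by
  obtain ⟨Y, hY⟩ := Function.ne_iff.1 hφ0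
  obtain ⟨Z, hZ⟩ := Function.ne_iff.1 hψ0
  have hYA : Y ⊆ A := by by_contra h'; exact hY (hφ Y h')
  have hZB : Z ⊆ B := by by_contra h'; exact hZ (hψ Z h')
  intro h0
  have h1 := congrFun h0 (Y ∪ Z)
  have e1 : (Y ∪ Z) ∩ A = Y := by
    rw [Finset.union_inter_distrib_right, Finset.inter_eq_left.2 hYA,
      Finset.disjoint_iff_inter_eq_empty.1 (Finset.disjoint_of_subset_left hZB h.symm),
      Finset.union_empty]
  have e2 : (Y ∪ Z) ∩ B = Z := by
    rw [Finset.union_inter_distrib_right, Finset.inter_eq_left.2 hZB,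
      Finset.disjoint_iff_inter_eq_empty.1 (Finset.disjoint_of_subset_left hYA h),
      Finset.empty_union]
  rw [tensor_apply, if_pos (Finset.union_subset_union hYA hZB), e1, e2] at h1
  exact mul_ne_zero hY hZ h1

theorem treeVec_ne_zero {T : LTree} {κ : Labeling T} (hκ : κ.Admissible) {s : ℕ}
    (hs : s + T.size ≤ n) : treeVec n s κ ≠ 0 := by
  induction κ generalizing s with
  | leaf =>
    intro h
    have := congrFun h ∅
    rw [treeVec] at this
    simp at this
  | @node l r k κl κr ihl ihr =>
    rw [LTree.size] at hs
    have hb := hκ.bounds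
    rw [Labeling.Admissible] at hκ
    have hd := disjoint_seg (n := n) s l.size r.size
    have hl := ihl hκ.2.2.2.2.2.1 (s := s) (by omega)
    have hr := ihr hκ.2.2.2.2.2.2 (s := s + l.size) (by omega)
    have hl' := treeVec_mem_chainSpace (n := n) hκ.2.2.2.2.2.1 (s := s) 0 (by omega)
    have hr' := treeVec_mem_chainSpace (n := n) hκ.2.2.2.2.2.2 (s := s + l.size) 0 (by omega)
    rw [chainSpace_zero] at hl' hr'
    intro h0
    rw [treeVec] at h0
    refine tensor_ne_zero hd (treeVec_mem_suppSpace κl s) (treeVec_mem_suppSpace κr _) hl hr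
      (eq_zero_of_nodeOp_eq_zero hs hb.2.1 hb.2.2 ?_ ?_ h0)
    · exact apply_mem_lowest (tensorLeft_mem_commAlg hd _) hl'
    · exact apply_mem_lowest (tensorRight_mem_commAlg hd _) hr'

theorem tensor_rdiv_rdiv {A B : Finset (Fin n)} (h : Disjoint A B) (φ ψ : Fun n) (u v : ℕ) :
    tensor A B (rdiv A u φ) (rdiv B v ψ) = rdiv A u (rdiv B v (tensor A B φ ψ)) := by
  rw [← tensorLeft_apply, ← Module.End.mul_apply,
    (commute_rdiv_of_mem (tensorLeft_mem_commAlg h _) u).eq, Module.End.mul_apply,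
    tensorLeft_apply, ← tensorRight_apply, ← Module.End.mul_apply (tensorRight A B φ),
    (commute_rdiv_of_mem (tensorRight_mem_commAlg h _) v).eq, Module.End.mul_apply,
    tensorRight_apply]

theorem raise_sigma (X : Finset (Fin n)) (m : ℕ) :
    raise X (sigma X m) = ((m : ℂ) + 1) • sigma X (m + 1) := by
  ext Z
  simp only [raise, LinearMap.sum_apply, Finset.sum_apply, cre_apply, sigma, Pi.smul_apply,
    smul_eq_mul, Finset.mem_powersetCard]
  rw [← Finset.sum_filter, Finset.filter_mem_eq_inter]
  by_cases hZ : Z ⊆ X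
  · have h1 (x) (hx : x ∈ X ∩ Z) : (if Z.erase x ⊆ X ∧ (Z.erase x).card = m then (1 : ℂ) else 0) =
        if Z.card = m + 1 then 1 else 0 := by
      have hxZ := (Finset.mem_inter.1 hx).2
      have := Finset.card_erase_add_one hxZ
      have h2 : Z.erase x ⊆ X := (Finset.erase_subset _ _).trans hZ
      simp only [h2, true_and]
      congr 1
      rw [eq_iff_iff]; omega
    rw [Finset.sum_congr rfl h1, Finset.sum_const, Finset.inter_eq_right.2 hZ]
    simp only [hZ, true_and]
    split_ifs with h3
    · rw [h3]; simp
    · simp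
  · have h1 (x) (hx : x ∈ X ∩ Z) : ¬ Z.erase x ⊆ X := fun h => hZ fun y hy => by
      by_cases hyx : y = x
      · subst hyx; exact (Finset.mem_inter.1 hx).1
      · exact h (Finset.mem_erase.2 ⟨hyx, hy⟩)
    rw [Finset.sum_eq_zero fun x hx => by rw [if_neg fun h => h1 x hx h.1]]
    simp [hZ]

theorem rdiv_single_empty (X : Finset (Fin n)) (m : ℕ) :
    rdiv X m (Pi.single ∅ 1) = sigma X m := by
  induction m with
  | zero =>
    rw [rdiv_zero]
    ext Z
    by_cases h : Z = ∅ <;> simp [sigma, h]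
  | succ m ih =>
    have h1 : (m : ℂ) + 1 ≠ 0 := by exact_mod_cast m.succ_ne_zero
    have h2 : ((m : ℂ) + 1) • rdiv X (m + 1) (Pi.single ∅ 1) = ((m : ℂ) + 1) • sigma X (m + 1) := by
      rw [← raise_sigma, ← ih, rdiv, rdiv, LinearMap.smul_apply, LinearMap.smul_apply, map_smul,
        pow_succ', Module.End.mul_apply, smul_smul]
      congr 1
      have h3 : (m.factorial : ℂ) ≠ 0 := by exact_mod_cast m.factorial_ne_zero
      rw [Nat.factorial_succ]; push_cast
      field_simp
    exact smul_right_injective _ h1 h2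

/-- The recursive definition of the functions `treePhi` amounts to raising one and the same vector:
the Hahn polynomials are exactly the coefficients that appear in `rdiv_mul_cg`. -/
theorem treePhi_eq {T : LTree} {κ : Labeling T} (hκ : κ.Admissible) {s m : ℕ}
    (hs : s + T.size ≤ n) (hm : κ.root ≤ m) :
    treePhi n s m κ = rdiv (seg n s T.size) (m - κ.root) (treeVec n s κ) := by
  induction κ generalizing s m with
  | leaf => rw [treePhi, treeVec, Labeling.root, LTree.size, Nat.sub_zero, rdiv_single_empty]
  | @node l r k κl κr ihl ihr =>
    rw [LTree.size] at hs ⊢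
    rw [Labeling.root] at hm ⊢
    have hb := hκ.bounds
    rw [Labeling.Admissible] at hκ
    have hd := disjoint_seg (n := n) s l.size r.size
    have hl' := treeVec_mem_chainSpace (n := n) hκ.2.2.2.2.2.1 (s := s) 0 (by omega)
    have hr' := treeVec_mem_chainSpace (n := n) hκ.2.2.2.2.2.2 (s := s + l.size) 0 (by omega)
    rw [chainSpace_zero] at hl' hr'
    have hca : (seg n s l.size).card = l.size := card_seg (by omega)
    have hcb : (seg n (s + l.size) r.size).card = r.size := card_seg (by omega)
    set i := κl.root
    set j := κr.root
    rw [treePhi, treeVec]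
    set F := tensor (seg n s l.size) (seg n (s + l.size) r.size) (treeVec n s κl)
      (treeVec n (s + l.size) κr)
    have hFA : F ∈ lowest (seg n s l.size) i :=
      apply_mem_lowest (tensorLeft_mem_commAlg hd _) hl'
    have hFB : F ∈ lowest (seg n (s + l.size) r.size) j :=
      apply_mem_lowest (tensorRight_mem_commAlg hd _) hr'
    rw [nodeOp, seg_add, show m - k = (m - i - j) - (k - i - j) by omega, ← Module.End.mul_apply,
      rdiv_mul_cg hd (by omega), LinearMap.sum_apply]
    -- With `y = w - j`; the terms excluded by the range of `w` vanish, being raised too often.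
    symm
    rw [← Finset.sum_filter_of_ne
      (p := fun y => y + 2 * j ≤ r.size ∧ m - i - j ≤ y + (l.size - 2 * i))]
    · refine Finset.sum_nbij' (fun y => y + j) (fun w => w - j) ?_ ?_ ?_ ?_ ?_
      · intro y hy
        simp only [Finset.mem_filter, Finset.mem_range] at hy ⊢
        omega
      · intro w hw
        simp only [Finset.mem_filter, Finset.mem_range] at hw ⊢
        omega
      · intro y hy
        omega
      · intro w hw
        simp only [Finset.mem_filter, Finset.mem_range] at hw
        omega
      · intro y hy
        simp only [Finset.mem_filter, Finset.mem_range] at hy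
        rw [ihl hκ.2.2.2.2.2.1 (by omega) (by omega), ihr hκ.2.2.2.2.2.2 (by omega) (by omega),
          tensor_rdiv_rdiv hd, LinearMap.smul_apply, Module.End.mul_apply,
          show ((m - i - j : ℕ) : ℤ) = (m : ℤ) - i - j by omega,
          show ((y + j : ℕ) : ℤ) - j = y by omega,
          show m - (y + j) - i = m - i - j - y by omega, Nat.add_sub_cancel]
    · intro y hy hne
      rw [Finset.mem_range] at hy
      by_contra hcon
      apply hne
      rw [LinearMap.smul_apply, Module.End.mul_apply]
      rcases lt_or_ge r.size (y + 2 * j) with h1 | h1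
      · rw [rdiv_eq_zero_of_lt hFB (by omega) (by omega), map_zero, smul_zero]
      · rw [rdiv_eq_zero_of_lt (apply_mem_lowest (rdiv_mem_commAlg hd.symm y) hFA) (by omega)
          (by omega), smul_zero]

/-! ### Orthogonality -/

theorem two_mul_root_le {T : LTree} {κ : Labeling T} (hκ : κ.Admissible) :
    2 * κ.root ≤ T.size := by
  cases κ with
  | leaf => simp [Labeling.root]
  | node k κl κr =>
    rw [Labeling.Admissible] at hκ
    rw [Labeling.root, LTree.size]
    omega

/-- Different labelings are separated by the label of some vertex. -/
theorem exists_verts_ne {T : LTree} {κ κ' : Labeling T} (hκ : κ.Admissible) (hκ' : κ'.Admissible)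
    (hne : κ ≠ κ') {s q : ℕ} (hs : s + T.size ≤ n) (hq : T.height ≤ q) :
    ∃ X : Finset (Fin n), ∃ k k', (X, k) ∈ verts n s q κ ∧ (X, k') ∈ verts n s q κ' ∧ k ≠ k' ∧
      2 * k ≤ X.card ∧ 2 * k' ≤ X.card := by
  by_cases hroot : κ.root = κ'.root
  swap
  · refine ⟨_, _, _, root_mem_verts κ s q, root_mem_verts κ' s q, hroot, ?_, ?_⟩
    · rw [card_seg hs]; exact two_mul_root_le hκ
    · rw [card_seg hs]; exact two_mul_root_le hκ'
  induction κ generalizing s q with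
  | leaf => cases κ'; exact absurd rfl hne
  | @node l r k κl κr ihl ihr =>
    cases κ' with
    | node k' κl' κr' =>
    rw [Labeling.root, Labeling.root] at hroot
    subst hroot
    rw [LTree.size] at hs
    rw [LTree.height] at hq
    rw [Labeling.Admissible] at hκ hκ'
    obtain ⟨q, rfl⟩ : ∃ p, q = p + 1 := ⟨q - 1, by omega⟩
    simp only [verts]
    by_cases hl : κl = κl'
    · have hr : κr ≠ κr' := by rintro rfl; exact hne (by rw [hl])
      have key : ∃ X : Finset (Fin n), ∃ k k', (X, k) ∈ verts n (s + l.size) q κr ∧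
          (X, k') ∈ verts n (s + l.size) q κr' ∧ k ≠ k' ∧ 2 * k ≤ X.card ∧ 2 * k' ≤ X.card := by
        by_cases hroot : κr.root = κr'.root
        · exact ihr hκ.2.2.2.2.2.2 hκ'.2.2.2.2.2.2 hr (by omega) (by omega) hroot
        · refine ⟨_, _, _, root_mem_verts κr _ q, root_mem_verts κr' _ q, hroot, ?_, ?_⟩
          · rw [card_seg (by omega)]; exact two_mul_root_le hκ.2.2.2.2.2.2
          · rw [card_seg (by omega)]; exact two_mul_root_le hκ'.2.2.2.2.2.2
      obtain ⟨X, p, p', h1, h2, h3⟩ := key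
      exact ⟨X, p, p', .inr (.inr h1), .inr (.inr h2), h3⟩
    · have key : ∃ X : Finset (Fin n), ∃ k k', (X, k) ∈ verts n s q κl ∧
          (X, k') ∈ verts n s q κl' ∧ k ≠ k' ∧ 2 * k ≤ X.card ∧ 2 * k' ≤ X.card := by
        by_cases hroot : κl.root = κl'.root
        · exact ihl hκ.2.2.2.2.2.1 hκ'.2.2.2.2.2.1 hl (by omega) (by omega) hroot
        · refine ⟨_, _, _, root_mem_verts κl _ q, root_mem_verts κl' _ q, hroot, ?_, ?_⟩
          · rw [card_seg (by omega)]; exact two_mul_root_le hκ.2.2.2.2.2.1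
          · rw [card_seg (by omega)]; exact two_mul_root_le hκ'.2.2.2.2.2.1
      obtain ⟨X, p, p', h1, h2, h3⟩ := key
      exact ⟨X, p, p', .inr (.inl h1), .inr (.inl h2), h3⟩

theorem permRep_dotProduct (g : Equiv.Perm (Fin n)) (f f' : Fun n) :
    permRep n g f ⬝ᵥ star f' = f ⬝ᵥ star (permRep n g⁻¹ f') := by
  simp only [dotProduct, permRep_apply, Pi.star_apply, inv_inv]
  exact Fintype.sum_equiv (MulAction.toPerm g⁻¹) _ _ fun Z => by simp

theorem casOp_dotProduct (A : Finset (Fin n)) (f f' : Fun n) :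
    casOp A f ⬝ᵥ star f' = f ⬝ᵥ star (casOp A f') := by
  simp only [casOp_eq_sum_swap, LinearMap.sum_apply, sum_dotProduct, star_sum, dotProduct_sum,
    permRep_dotProduct, Equiv.swap_inv]

theorem star_cas (t k : ℕ) : star (cas t k) = cas t k := by
  simp [cas]

theorem dotProduct_eq_zero_of_casOp {A : Finset (Fin n)} {f f' : Fun n} {k k' : ℕ}
    (hf : casOp A f = cas A.card k • f) (hf' : casOp A f' = cas A.card k' • f') (hne : k ≠ k')
    (hk : 2 * k ≤ A.card) (hk' : 2 * k' ≤ A.card) : f ⬝ᵥ star f' = 0 := by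
  have h := casOp_dotProduct A f f'
  rw [hf, hf', smul_dotProduct, star_smul, dotProduct_smul, star_cas, smul_eq_mul, smul_eq_mul,
    ← sub_eq_zero, ← sub_mul] at h
  exact (mul_eq_zero.1 h).resolve_left fun h' => hne (cas_injective hk hk' (sub_eq_zero.1 h'))

theorem scalarProd_eq_dotProduct {m : ℕ} {f f' : Fun n} (hf : f ∈ permModule Finset.univ m) :
    scalarProd m f f' = f ⬝ᵥ star f' :=
  Finset.sum_subset (Finset.subset_univ _) fun Z _ hZ => by rw [hf Z hZ, zero_mul]

theorem linearIndependent_of_dotProduct {ι : Type*} {v : ι → Fun n} (h0 : ∀ i, v i ≠ 0)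
    (h : ∀ i j, i ≠ j → v i ⬝ᵥ star (v j) = 0) : LinearIndependent ℂ v := by
  rw [linearIndependent_iff']
  intro S c hc i hi
  have h1 := congrArg (· ⬝ᵥ star (v i)) hc
  simp only [sum_dotProduct, smul_dotProduct, zero_dotProduct] at h1
  rw [Finset.sum_eq_single_of_mem i hi fun j _ hj => by rw [h j i hj, smul_zero]] at h1
  exact (smul_eq_zero.1 h1).resolve_right fun h2 => h0 i (eq_zero_of_dotProduct h2)

theorem treePhi_ne_zero {T : LTree} {κ : Labeling T} (hκ : κ.Admissible) {s m : ℕ}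
    (hs : s + T.size ≤ n) (hm : κ.root ≤ m) (hm' : κ.root + m ≤ T.size) :
    treePhi n s m κ ≠ 0 := by
  rw [treePhi_eq hκ hs hm]
  have h := treeVec_mem_chainSpace (n := n) hκ (s := s) 0 hs
  rw [chainSpace_zero] at h
  have hc := card_seg hs
  exact fun h0 => treeVec_ne_zero hκ hs (eq_zero_of_rdiv_eq_zero h (by omega) h0)

theorem casOp_treePhi {T : LTree} {κ : Labeling T} (hκ : κ.Admissible) {s m q : ℕ}
    (hs : s + T.size ≤ n) (hm : κ.root ≤ m) {p : Finset (Fin n) × ℕ} (hp : p ∈ verts n s q κ) :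
    casOp p.1 (treePhi n s m κ) = cas p.1.card p.2 • treePhi n s m κ := by
  rw [treePhi_eq hκ hs hm]
  have h := (mem_chainSpace.1 (treeVec_mem_chainSpace (n := n) hκ (s := s) q hs)).2
  exact apply_eq_smul_of_commute (commute_casOp_rdiv (.inl (subset_of_mem_verts κ hp)) _)
    (mem_casSpace.1 h p hp)

theorem dotProduct_treePhi {T : LTree} {κ κ' : Labeling T} (hκ : κ.Admissible)
    (hκ' : κ'.Admissible) (hne : κ ≠ κ') {s m : ℕ} (hs : s + T.size ≤ n) (hm : κ.root ≤ m)
    (hm' : κ'.root ≤ m) : treePhi n s m κ ⬝ᵥ star (treePhi n s m κ') = 0 := by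
  obtain ⟨X, k, k', h1, h2, h3, h4, h5⟩ := exists_verts_ne hκ hκ' hne hs le_rfl
  have e1 := casOp_treePhi hκ hs hm h1
  have e2 := casOp_treePhi hκ' hs hm' h2
  exact dotProduct_eq_zero_of_casOp e1 e2 h3 h4 h5

/-! ### Invariance -/

theorem permRep_sigma {X : Finset (Fin n)} {g : Equiv.Perm (Fin n)} (hg : g • X = X) (m : ℕ) :
    permRep n g (sigma X m) = sigma X m := by
  ext Z
  have h : g⁻¹ • Z ⊆ X ↔ Z ⊆ X := by
    rw [← Finset.subset_smul_finset_iff, hg]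
  simp [permRep_apply, sigma, Finset.mem_powersetCard, h]

theorem permRep_tensor {A B : Finset (Fin n)} {g : Equiv.Perm (Fin n)} (hA : g • A = A)
    (hB : g • B = B) (φ ψ : Fun n) :
    permRep n g (tensor A B φ ψ) = tensor A B (permRep n g φ) (permRep n g ψ) := by
  ext Z
  have h : g⁻¹ • Z ⊆ A ∪ B ↔ Z ⊆ A ∪ B := by
    rw [← Finset.subset_smul_finset_iff, Finset.smul_finset_union, hA, hB]
  have hA' : g⁻¹ • Z ∩ A = g⁻¹ • (Z ∩ A) := by
    rw [Finset.smul_finset_inter, inv_smul_eq_iff.2 hA.symm]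
  have hB' : g⁻¹ • Z ∩ B = g⁻¹ • (Z ∩ B) := by
    rw [Finset.smul_finset_inter, inv_smul_eq_iff.2 hB.symm]
  simp only [permRep_apply, tensor_apply, h, hA', hB']

theorem permRep_treePhi {T : LTree} (κ : Labeling T) {s q m : ℕ} (hq : T.height ≤ q)
    {g : Equiv.Perm (Fin n)} (hg : g ∈ setwiseStabilizer (levelBlocks n T s q)) :
    permRep n g (treePhi n s m κ) = treePhi n s m κ := by
  induction κ generalizing s q m with
  | leaf =>
    rw [treePhi]
    exact permRep_sigma (mem_setwiseStabilizer.1 hg _ (by rw [levelBlocks]; rfl)) m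
  | @node l r k κl κr ihl ihr =>
    rw [LTree.height] at hq
    obtain ⟨q, rfl⟩ : ∃ p, q = p + 1 := ⟨q - 1, by omega⟩
    rw [levelBlocks] at hg
    have hl : g ∈ setwiseStabilizer (levelBlocks n l s q) :=
      mem_setwiseStabilizer.2 fun B hB => mem_setwiseStabilizer.1 hg B (.inl hB)
    have hr : g ∈ setwiseStabilizer (levelBlocks n r (s + l.size) q) :=
      mem_setwiseStabilizer.2 fun B hB => mem_setwiseStabilizer.1 hg B (.inr hB)
    rw [treePhi, map_sum]
    refine Finset.sum_congr rfl fun w _ => ?_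
    rw [map_smul, permRep_tensor (smul_seg_of_mem_setwiseStabilizer hl)
      (smul_seg_of_mem_setwiseStabilizer hr), ihl (by omega) hl, ihr (by omega) hr]

theorem size_eq_sum_parts (T : LTree) : T.size = T.parts.sum := by
  induction T with
  | leaf a => simp [LTree.size, LTree.parts]
  | node l r ihl ihr => simp [LTree.size, LTree.parts, ihl, ihr]

/-- The blocks at the deepest level are the consecutive intervals given by the leaves. -/
theorem mem_levelBlocks_iff {T : LTree} {s q : ℕ} (hq : T.height ≤ q) {B : Finset (Fin n)} :
    B ∈ levelBlocks n T s q ↔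
      ∃ j, ∃ h : j < T.parts.length, B = seg n (s + (T.parts.take j).sum) T.parts[j] := by
  induction T generalizing s q with
  | leaf a =>
    rw [levelBlocks, Set.mem_singleton_iff]
    simp [LTree.parts]
  | node l r ihl ihr =>
    rw [LTree.height] at hq
    obtain ⟨q, rfl⟩ : ∃ p, q = p + 1 := ⟨q - 1, by omega⟩
    rw [levelBlocks, Set.mem_union, ihl (by omega), ihr (by omega)]
    simp only [LTree.parts, List.length_append, size_eq_sum_parts l]
    constructor
    · rintro (⟨j, h, rfl⟩ | ⟨j, h, rfl⟩)
      · exact ⟨j, by omega, by rw [List.getElem_append_left h, List.take_append_of_le_length h.le]⟩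
      · refine ⟨l.parts.length + j, by omega, ?_⟩
        rw [List.getElem_append_right (by omega), List.take_length_add_append, List.sum_append,
          add_assoc]
        simp
    · rintro ⟨j, h, rfl⟩
      rcases lt_or_ge j l.parts.length with hj | hj
      · exact .inl ⟨j, hj, by
          rw [List.getElem_append_left hj, List.take_append_of_le_length hj.le]⟩
      · obtain ⟨i, rfl⟩ : ∃ i, j = l.parts.length + i := ⟨j - l.parts.length, by omega⟩
        refine .inr ⟨i, by omega, ?_⟩
        rw [List.getElem_append_right (by omega), List.take_length_add_append, List.sum_append,
          add_assoc]
        simp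

theorem youngSubgroup_eq (a : Composition n) {T : LTree} (hT : T.parts = a.blocks) :
    youngSubgroup a = setwiseStabilizer (levelBlocks n T 0 T.height) := by
  rw [youngSubgroup]
  congr 1
  ext B
  rw [mem_levelBlocks_iff le_rfl, Set.mem_range]
  simp only [hT, zero_add]
  constructor
  · rintro ⟨j, rfl⟩; exact ⟨j, j.2, rfl⟩
  · rintro ⟨j, h, rfl⟩; exact ⟨⟨j, h⟩, rfl⟩

/-! ### Completeness -/

/-- For fixed `i`, `j`, the raised Clebsch–Gordan vectors of all admissible weights span the same
space as the products of the raisings on `A` and on `B`; the two families have the same number of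
nonzero members, and the former is independent. -/
theorem rdiv_rdiv_mem_span {A B : Finset (Fin n)} (h : Disjoint A B) {i j M y : ℕ} {F : Fun n}
    (hA : F ∈ lowest A i) (hB : F ∈ lowest B j) (hF : F ≠ 0) (hi : 2 * i ≤ A.card)
    (hj : 2 * j ≤ B.card) (hyM : y ≤ M) (hy : 2 * j + y ≤ B.card)
    (hy' : 2 * i + (M - y) ≤ A.card) {P : Submodule ℂ (Fun n)}
    (hP : ∀ N ≤ M, 2 * i + N ≤ A.card → 2 * j + N ≤ B.card →
      2 * i + 2 * j + M + N ≤ A.card + B.card →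
        rdiv (A ∪ B) (M - N) (cg A B N (A.card - 2 * i) (B.card - 2 * j) F) ∈ P) :
    rdiv A (M - y) (rdiv B y F) ∈ P := by
  set a := A.card - 2 * i with ha
  set b := B.card - 2 * j with hb
  let U : Finset ℕ := Finset.Icc (M - a) (min M b)
  let I : Finset ℕ := Finset.Icc 0 (min M (min a (min b (a + b - M))))
  let X : ℕ → Fun n := fun y => rdiv A (M - y) (rdiv B y F)
  let Y : I → Fun n := fun N =>
    rdiv (A ∪ B) (M - N) (cg A B N (A.card - 2 * i) (B.card - 2 * j) F)
  have hI (N : I) : (N : ℕ) ≤ M ∧ 2 * i + N ≤ A.card ∧ 2 * j + N ≤ B.card ∧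
      2 * i + 2 * j + M + N ≤ A.card + B.card := by
    have := Finset.mem_Icc.1 N.2
    simp only [le_min_iff] at this
    omega
  have hYP : Submodule.span ℂ (Set.range Y) ≤ P := by
    rw [Submodule.span_le]
    rintro _ ⟨N, rfl⟩
    exact hP N (hI N).1 (hI N).2.1 (hI N).2.2.1 (hI N).2.2.2
  -- `rdiv_mul_cg` expands the members of `Y`; the terms with index outside `U` vanish.
  have hYX : Submodule.span ℂ (Set.range Y) ≤ Submodule.span ℂ (U.image X : Set (Fun n)) := by
    rw [Submodule.span_le]
    rintro _ ⟨N, rfl⟩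
    simp only [Y]
    rw [← Module.End.mul_apply, rdiv_mul_cg h (hI N).1, LinearMap.sum_apply]
    refine sum_mem fun z hz => Submodule.smul_mem _ _ ?_
    rw [Finset.mem_range] at hz
    rw [Module.End.mul_apply]
    by_cases hzU : z ∈ U
    · exact Submodule.subset_span (Finset.mem_coe.2 (Finset.mem_image_of_mem X hzU))
    · rw [Finset.mem_Icc, le_min_iff] at hzU
      rcases lt_or_ge b z with h1 | h1
      · rw [rdiv_eq_zero_of_lt hB hj (by omega), map_zero]; exact zero_mem _
      · rw [rdiv_eq_zero_of_lt (apply_mem_lowest (rdiv_mem_commAlg h.symm z) hA) hi (by omega)]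
        exact zero_mem _
  have hcard : (A ∪ B).card = A.card + B.card := Finset.card_union_of_disjoint h
  have hlow (N : ℕ) := cg_mem_lowest h hA hB N
  have hind : LinearIndependent ℂ Y := by
    refine linearIndependent_of_dotProduct (fun N h0 => ?_) fun N N' hne => ?_
    · exact hF (eq_zero_of_cg_eq_zero h hA hB (hI N).2.1 (hI N).2.2.1
        (eq_zero_of_rdiv_eq_zero (hlow N) (by have := hI N; omega) h0))
    · refine dotProduct_eq_zero_of_casOp (A := A ∪ B) (k := i + j + N) (k' := i + j + N') ?_ ?_
        (fun h' => hne (Subtype.ext (by omega))) (by have := hI N; omega)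
        (by have := hI N'; omega)
      · exact apply_eq_smul_of_commute (commute_casOp_rdiv (.inl subset_rfl) _)
          (casOp_apply_of_mem_lowest (hlow N))
      · exact apply_eq_smul_of_commute (commute_casOp_rdiv (.inl subset_rfl) _)
          (casOp_apply_of_mem_lowest (hlow N'))
  have hfin : Module.finrank ℂ (Submodule.span ℂ (U.image X : Set (Fun n))) ≤
      Module.finrank ℂ (Submodule.span ℂ (Set.range Y)) := by
    rw [finrank_span_eq_card hind, Fintype.card_coe]
    refine (finrank_span_finset_le_card _).trans (Finset.card_image_le.trans ?_)
    simp only [U, I, Nat.card_Icc]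
    omega
  have hyU : y ∈ U := by
    rw [Finset.mem_Icc, le_min_iff]; omega
  have heq := Submodule.eq_of_le_of_finrank_le hYX hfin
  refine hYP ?_
  rw [heq]
  exact Submodule.subset_span (Finset.mem_coe.2 (Finset.mem_image_of_mem X hyU))

/-- The functions on the `m`-subsets of the interval of a tree that are invariant under all
transpositions inside a leaf. The leaves are the blocks at any level `q` not less than the height, and
all such `q` are admitted because the two subtrees of a vertex may have different heights. -/
def swapInvariant (n : ℕ) (T : LTree) (s m : ℕ) : Submodule ℂ (Fun n) where
  carrier := {f | f ∈ suppSpace (seg n s T.size) ∧ count (seg n s T.size) f = (m : ℂ) • f ∧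
    ∀ q, T.height ≤ q → ∀ C ∈ levelBlocks n T s q, ∀ x ∈ C, ∀ y ∈ C,
      permRep n (Equiv.swap x y) f = f}
  add_mem' hf hg := ⟨add_mem hf.1 hg.1, by rw [map_add, hf.2.1, hg.2.1, smul_add],
    fun q hq C hC x hx y hy => by
      rw [map_add, hf.2.2 q hq C hC x hx y hy, hg.2.2 q hq C hC x hx y hy]⟩
  zero_mem' := ⟨zero_mem _, by simp, fun q hq C hC x hx y hy => map_zero _⟩
  smul_mem' c f hf := ⟨Submodule.smul_mem _ _ hf.1, by rw [map_smul, hf.2.1, smul_comm],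
    fun q hq C hC x hx y hy => by rw [map_smul, hf.2.2 q hq C hC x hx y hy]⟩

theorem mem_swapInvariant {T : LTree} {s m : ℕ} {f : Fun n} : f ∈ swapInvariant n T s m ↔
    f ∈ suppSpace (seg n s T.size) ∧ count (seg n s T.size) f = (m : ℂ) • f ∧
    ∀ q, T.height ≤ q → ∀ C ∈ levelBlocks n T s q, ∀ x ∈ C, ∀ y ∈ C,
      permRep n (Equiv.swap x y) f = f := Iff.rfl

/-- A function invariant under the transpositions of `X` is constant on the subsets of `X` of a given
size. -/
theorem eq_of_card_eq_of_swap {X : Finset (Fin n)} {f : Fun n}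
    (hf : ∀ x ∈ X, ∀ y ∈ X, permRep n (Equiv.swap x y) f = f) {Z Z' : Finset (Fin n)}
    (hZ : Z ⊆ X) (hZ' : Z' ⊆ X) (hc : Z.card = Z'.card) : f Z = f Z' := by
  induction hd : (Z \ Z').card generalizing Z with
  | zero =>
    have h1 : Z ⊆ Z' := Finset.sdiff_eq_empty_iff_subset.1 (Finset.card_eq_zero.1 hd)
    rw [Finset.eq_of_subset_of_card_le h1 hc.ge]
  | succ d ih =>
    obtain ⟨x, hx⟩ := Finset.card_pos.1 (by omega : 0 < (Z \ Z').card)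
    have h2 : (Z' \ Z).card = d + 1 := by rw [← hd]; exact Finset.card_sdiff_comm hc.symm
    obtain ⟨y, hy⟩ := Finset.card_pos.1 (by omega : 0 < (Z' \ Z).card)
    obtain ⟨hxZ, hxZ'⟩ := Finset.mem_sdiff.1 hx
    obtain ⟨hyZ', hyZ⟩ := Finset.mem_sdiff.1 hy
    have h3 := congrFun (hf x (hZ hxZ) y (hZ' hyZ')) Z
    rw [permRep_apply, Equiv.swap_inv, swap_smul_of_mem_of_notMem hxZ hyZ] at h3
    rw [← h3]
    refine ih ?_ ?_ ?_
    · exact Finset.insert_subset (hZ' hyZ') ((Finset.erase_subset _ _).trans hZ)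
    · rw [← hc, Finset.card_insert_of_notMem (fun h => hyZ (Finset.mem_of_mem_erase h)),
        Finset.card_erase_add_one hxZ]
    · have h4 : insert y (Z.erase x) \ Z' = (Z \ Z').erase x := by
        rw [Finset.insert_sdiff_of_mem _ hyZ', Finset.erase_sdiff_comm]
      rw [h4, Finset.card_erase_of_mem hx, hd]; rfl

theorem permRep_swap_apply_of_commute {S : Module.End ℂ (Fun n)} {x y : Fin n}
    (h : Commute (permRep n (Equiv.swap x y)) S) {f : Fun n}
    (hf : permRep n (Equiv.swap x y) f = f) : permRep n (Equiv.swap x y) (S f) = S f := by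
  rw [← Module.End.mul_apply, h.eq, Module.End.mul_apply, hf]

theorem commute_permRep_swap_of_mem {C : Finset (Fin n)} {S : Module.End ℂ (Fun n)}
    (hS : S ∈ commAlg C) {x y : Fin n} (hx : x ∈ C) (hy : y ∈ C) :
    Commute (permRep n (Equiv.swap x y)) S := by
  by_cases hxy : x = y
  · subst hxy
    rw [Equiv.swap_self]
    change Commute (permRep n 1) S
    rw [permRep_one]; exact Commute.one_left _
  · obtain ⟨h1, h2⟩ := mem_commAlg.1 hS x hx
    obtain ⟨h3, h4⟩ := mem_commAlg.1 hS y hy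
    rw [permRep_swap hxy]
    refine Commute.symm ?_
    have h5 := h2.mul_right h1
    have h6 := h4.mul_right h3
    exact ((((h5.mul_right h6).add_right (((Commute.one_right S).sub_right h5).mul_right
      ((Commute.one_right S).sub_right h6))).add_right (h2.mul_right h3)).add_right
        (h4.mul_right h1))

theorem tensorSpace_le {A B : Finset (Fin n)} {S S' : Set (Fun n)} {P : Submodule ℂ (Fun n)}
    (h : ∀ φ ∈ S, ∀ ψ ∈ S', tensor A B φ ψ ∈ P) :
    tensorSpace A B (Submodule.span ℂ S) (Submodule.span ℂ S') ≤ P := by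
  rw [tensorSpace, Submodule.span_le]
  rintro _ ⟨φ, hφ, ψ, hψ, rfl⟩
  have h1 (φ) (hφ : φ ∈ S) : Submodule.span ℂ S' ≤ P.comap (tensorRight A B φ) :=
    Submodule.span_le.2 fun ψ hψ => h φ hφ ψ hψ
  have h2 : Submodule.span ℂ S ≤ P.comap (tensorLeft A B ψ) :=
    Submodule.span_le.2 fun φ hφ => h1 φ hφ hψ
  exact h2 hφ

theorem tensorSpace_mono {A B : Finset (Fin n)} {U U' V V' : Submodule ℂ (Fun n)} (hU : U ≤ U')
    (hV : V ≤ V') : tensorSpace A B U V ≤ tensorSpace A B U' V' :=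
  Submodule.span_mono fun _ ⟨φ, hφ, ψ, hψ, h⟩ => ⟨φ, hU hφ, ψ, hV hψ, h⟩

/-- The step from the subtrees to the tree: `rdiv_rdiv_mem_span` in terms of labelings. -/
theorem tensor_treePhi_mem_span {l r : LTree} {s m w : ℕ} (hs : s + (l.size + r.size) ≤ n)
    (hw : w ≤ m) (κl : RepLabeling l (m - w)) (κr : RepLabeling r w) :
    tensor (seg n s l.size) (seg n (s + l.size) r.size) (treePhi n s (m - w) κl.1)
      (treePhi n (s + l.size) w κr.1) ∈
        Submodule.span ℂ (Set.range fun κ : RepLabeling (.node l r) m => treePhi n s m κ.1) := by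
  obtain ⟨κl, hκl, hl1, hl2⟩ := κl
  obtain ⟨κr, hκr, hr1, hr2⟩ := κr
  have hd := disjoint_seg (n := n) s l.size r.size
  have hca : (seg n s l.size).card = l.size := card_seg (by omega)
  have hcb : (seg n (s + l.size) r.size).card = r.size := card_seg (by omega)
  have hl' := treeVec_mem_chainSpace (n := n) hκl (s := s) 0 (by omega)
  have hr' := treeVec_mem_chainSpace (n := n) hκr (s := s + l.size) 0 (by omega)
  rw [chainSpace_zero] at hl' hr'
  rw [treePhi_eq hκl (by omega) hl1, treePhi_eq hκr (by omega) hr1, tensor_rdiv_rdiv hd,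
    show m - w - κl.root = (m - κl.root - κr.root) - (w - κr.root) by omega]
  set F := tensor (seg n s l.size) (seg n (s + l.size) r.size) (treeVec n s κl)
    (treeVec n (s + l.size) κr) with hF
  have hFA : F ∈ lowest (seg n s l.size) κl.root :=
    apply_mem_lowest (tensorLeft_mem_commAlg hd _) hl'
  have hFB : F ∈ lowest (seg n (s + l.size) r.size) κr.root :=
    apply_mem_lowest (tensorRight_mem_commAlg hd _) hr'
  refine rdiv_rdiv_mem_span hd hFA hFB ?_ (by omega) (by omega) (by omega)
    (by omega) (by omega) ?_
  · exact tensor_ne_zero hd (treeVec_mem_suppSpace κl s) (treeVec_mem_suppSpace κr _)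
      (treeVec_ne_zero hκl (by omega)) (treeVec_ne_zero hκr (by omega))
  · intro N hN hNA hNB hNM
    rw [hca] at hNA hNM
    rw [hcb] at hNB hNM
    have hadm : (Labeling.node (N + κl.root + κr.root) κl κr).Admissible := by
      rw [Labeling.Admissible]
      refine ⟨by omega, by omega, by omega, by omega, by omega, hκl, hκr⟩
    have hroot : (Labeling.node (N + κl.root + κr.root) κl κr).root = N + κl.root + κr.root := rfl
    refine Submodule.subset_span ⟨⟨_, hadm, by rw [hroot]; omega, by
      rw [hroot, LTree.size]; omega⟩, ?_⟩
    change treePhi n s m (Labeling.node (N + κl.root + κr.root) κl κr) = _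
    rw [treePhi_eq hadm hs (by rw [hroot]; omega), treeVec, nodeOp, hroot, LTree.size, seg_add,
      hca, hcb, show N + κl.root + κr.root - κl.root - κr.root = N by omega,
      show m - (N + κl.root + κr.root) = m - κl.root - κr.root - N by omega]

theorem swapInvariant_le_span (T : LTree) {s m : ℕ} (hs : s + T.size ≤ n) :
    swapInvariant n T s m ≤
      Submodule.span ℂ (Set.range fun κ : RepLabeling T m => treePhi n s m κ.1) := by
  induction T generalizing s m with
  | leaf a =>
    intro f hf
    obtain ⟨h1, h2, h3⟩ := mem_swapInvariant.1 hf
    rw [LTree.size] at hs h1 h2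
    have h4 := h3 0 le_rfl (seg n s a) (by rw [levelBlocks]; rfl)
    have h5 : f ∈ permModule (seg n s a) m := mem_permModule_iff.2 ⟨h2, h1⟩
    have hca : (seg n s a).card = a := card_seg hs
    rcases lt_or_ge a m with h | h
    · have : f = 0 := funext fun Z => h5 Z (by
        rw [Finset.powersetCard_eq_empty.2 (by omega)]; exact Finset.notMem_empty Z)
      rw [this]; exact zero_mem _
    · obtain ⟨Z₀, hZ₀, hZc⟩ := Finset.exists_subset_card_eq (s := seg n s a) (n := m) (by omega)
      have : f = f Z₀ • sigma (seg n s a) m := by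
        ext Z
        rw [Pi.smul_apply, sigma, smul_eq_mul]
        split_ifs with hZ
        · obtain ⟨hZX, hZm⟩ := Finset.mem_powersetCard.1 hZ
          rw [mul_one]
          exact eq_of_card_eq_of_swap h4 hZX hZ₀ (by omega)
        · rw [h5 Z hZ, mul_zero]
      rw [this]
      refine Submodule.smul_mem _ _ (Submodule.subset_span ⟨⟨.leaf, ?_, ?_, ?_⟩, ?_⟩)
      · trivial
      · exact Nat.zero_le _
      · rw [LTree.size, Labeling.root]; omega
      · change treePhi n s m (.leaf (a := a)) = _
        rw [treePhi]
  | node l r ihl ihr =>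
    intro f hf
    obtain ⟨h1, h2, h3⟩ := mem_swapInvariant.1 hf
    rw [LTree.size] at hs h1 h2
    rw [seg_add] at h1 h2
    have hd := disjoint_seg (n := n) s l.size r.size
    set A := seg n s l.size
    set B := seg n (s + l.size) r.size
    have hsum : f = ∑ w ∈ Finset.range (m + 1), proj B w f := by
      ext Z
      rw [Finset.sum_apply]
      simp only [proj_apply]
      rw [Finset.sum_ite_eq]
      split_ifs with h
      · rfl
      · refine count_eq_smul_iff.1 h2 Z fun h' => h ?_
        rw [Finset.mem_range, Nat.lt_succ_iff, ← h']
        exact Finset.card_le_card (Finset.inter_subset_inter_left Finset.subset_union_right)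
    have hswl (q : ℕ) (hq : l.height ≤ q) (C) (hC : C ∈ levelBlocks n l s q) (x) (hx : x ∈ C) (y)
        (hy : y ∈ C) : permRep n (Equiv.swap x y) f = f := by
      refine h3 (max q r.height + 1) (by rw [LTree.height]; omega) C ?_ x hx y hy
      rw [levelBlocks]
      refine .inl ?_
      rw [mem_levelBlocks_iff hq] at hC
      rwa [mem_levelBlocks_iff (by omega)]
    have hswr (q : ℕ) (hq : r.height ≤ q) (C) (hC : C ∈ levelBlocks n r (s + l.size) q) (x)
        (hx : x ∈ C) (y) (hy : y ∈ C) : permRep n (Equiv.swap x y) f = f := by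
      refine h3 (max q l.height + 1) (by rw [LTree.height]; omega) C ?_ x hx y hy
      rw [levelBlocks]
      refine .inr ?_
      rw [mem_levelBlocks_iff hq] at hC
      rwa [mem_levelBlocks_iff (by omega)]
    rw [hsum]
    refine sum_mem fun w hw => ?_
    have hw' : w ≤ m := Nat.lt_succ_iff.1 (Finset.mem_range.1 hw)
    have hmem : proj B w f ∈
        tensorSpace A B (swapInvariant n l s (m - w)) (swapInvariant n r (s + l.size) w) := by
      refine mem_tensorSpace_of_slice ?_ (fun Z hZ => ?_) fun Y hY => ?_
      · intro Z hZ
        rw [proj_apply, h1 Z hZ, ite_self]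
      · have hS := slice_mem_commAlg (Finset.disjoint_of_subset_right hZ hd)
        refine mem_swapInvariant.2 ⟨slice_mem_suppSpace _ _ _, ?_, ?_⟩
        · exact apply_eq_smul_of_commute (commute_count_of_mem hS).symm (count_left_proj hd h2 hw')
        · intro q hq C hC x hx y hy
          have hCA := subset_of_mem_levelBlocks hC
          refine permRep_swap_apply_of_commute
            (commute_permRep_swap_of_mem hS (hCA hx) (hCA hy)) ?_
          exact permRep_swap_apply_of_commute
            (commute_permRep_swap_of_mem (proj_mem_commAlg hd.symm w) (hCA hx) (hCA hy))
            (hswl q hq C hC x hx y hy)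
      · have hS := slice_mem_commAlg (Finset.disjoint_of_subset_right hY hd.symm)
        refine mem_swapInvariant.2 ⟨slice_mem_suppSpace _ _ _, ?_, ?_⟩
        · exact apply_eq_smul_of_commute (commute_count_of_mem hS).symm (count_proj B w f)
        · intro q hq C hC x hx y hy
          have hCB := subset_of_mem_levelBlocks hC
          refine permRep_swap_apply_of_commute
            (commute_permRep_swap_of_mem hS (hCB hx) (hCB hy)) ?_
          exact permRep_swap_apply_of_commute
            (commute_permRep_proj (swap_smul_eq (by simp [B, hCB hx, hCB hy])) w)
            (hswr q hq C hC x hx y hy)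
    refine tensorSpace_le ?_ (tensorSpace_mono (ihl (by omega)) (ihr (by omega)) hmem)
    rintro _ ⟨κl, rfl⟩ _ ⟨κr, rfl⟩
    exact tensor_treePhi_mem_span hs hw' κl κr

end

end HahnTree

theorem mainTheorem3 {n : ℕ} (a : Composition n) (T : LTree) (hT : T.parts = a.blocks)
    (m : ℕ) (hm : m ≤ n) :
    (∀ κ : RepLabeling T m,
      (∃! W : Fin (T.height + 1) → Submodule ℂ (Fun n), IsRepChain κ.1 W) ∧
      ∀ W : Fin (T.height + 1) → Submodule ℂ (Fun n), IsRepChain κ.1 W →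
        treePhi n 0 m κ.1 ∈ (W (Fin.last T.height)).map (radonR n (m - κ.1.root)) ∧
        (W (Fin.last T.height)).map (radonR n (m - κ.1.root)) ≤
          (specht Finset.univ κ.1.root).map (radonR n (m - κ.1.root)) ∧
        (specht Finset.univ κ.1.root).map (radonR n (m - κ.1.root)) ≤
          permModule Finset.univ m) ∧
    (∀ κ κ' : RepLabeling T m, κ ≠ κ' →
      scalarProd m (treePhi n 0 m κ.1) (treePhi n 0 m κ'.1) = 0) ∧
    LinearIndependent ℂ (fun κ : RepLabeling T m => treePhi n 0 m κ.1) ∧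
    Submodule.span ℂ (Set.range fun κ : RepLabeling T m => treePhi n 0 m κ.1) =
      invariantSpace a m := by
  have hsize : T.size = n := by rw [size_eq_sum_parts, hT, a.blocks_sum]
  have hs : 0 + T.size ≤ n := by omega
  have hseg : seg n 0 T.size = Finset.univ := by rw [hsize, seg_zero_self]
  have hspecht (k : ℕ) : specht (Finset.univ : Finset (Fin n)) k = lowest Finset.univ k := by
    rw [specht_eq, suppSpace_univ, inf_top_eq]
  have hperm (κ : RepLabeling T m) :
      (specht Finset.univ κ.1.root).map (radonR n (m - κ.1.root)) ≤ permModule Finset.univ m := by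
    rw [hspecht, Submodule.map_le_iff_le_comap]
    intro f hf
    rw [Submodule.mem_comap, mem_permModule_iff, suppSpace_univ, radonR_eq_rdiv, count_rdiv hf.1]
    refine ⟨?_, trivial⟩
    have h : κ.1.root + (m - κ.1.root) = m := by have := κ.2.2.1; omega
    exact_mod_cast congrArg (fun c : ℕ => (c : ℂ) • rdiv Finset.univ (m - κ.1.root) f) h
  have hchain (κ : RepLabeling T m) :
      chainSpace n 0 T.height κ.1 ≤ specht Finset.univ κ.1.root := by
    rw [hspecht, ← hseg]
    exact fun f hf => (mem_chainSpace.1 hf).1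
  have hmemChain (κ : RepLabeling T m) : treePhi n 0 m κ.1 ∈
      (chainSpace n 0 T.height κ.1).map (radonR n (m - κ.1.root)) :=
    ⟨treeVec n 0 κ.1, treeVec_mem_chainSpace κ.2.1 _ hs, by
      rw [treePhi_eq κ.2.1 hs κ.2.2.1, hseg, radonR_eq_rdiv]⟩
  have hmem (κ : RepLabeling T m) : treePhi n 0 m κ.1 ∈ permModule Finset.univ m :=
    hperm κ (Submodule.map_mono (hchain κ) (hmemChain κ))
  have horth (κ κ' : RepLabeling T m) (hne : κ ≠ κ') :
      treePhi n 0 m κ.1 ⬝ᵥ star (treePhi n 0 m κ'.1) = 0 :=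
    dotProduct_treePhi κ.2.1 κ'.2.1 (fun h => hne (Subtype.ext h)) hs κ.2.2.1 κ'.2.2.1
  refine ⟨fun κ => ⟨?_, fun W hW => ?_⟩, fun κ κ' hne => ?_, ?_, le_antisymm ?_ ?_⟩
  · simp only [isRepChain_iff hsize κ.2.1]
    exact existsUnique_eq
  · rw [isRepChain_iff hsize κ.2.1] at hW
    subst hW
    exact ⟨hmemChain κ, Submodule.map_mono (hchain κ), hperm κ⟩
  · rw [scalarProd_eq_dotProduct (hmem κ), horth κ κ' hne]
  · exact linearIndependent_of_dotProduct
      (fun κ => treePhi_ne_zero κ.2.1 hs κ.2.2.1 κ.2.2.2) horth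
  · rw [Submodule.span_le]
    rintro _ ⟨κ, rfl⟩
    refine ⟨hmem κ, fun g hg => permRep_treePhi κ.1 le_rfl ?_⟩
    rwa [← youngSubgroup_eq a hT]
  · rintro f ⟨hf, hinv⟩
    refine swapInvariant_le_span T hs (mem_swapInvariant.2 ?_)
    rw [mem_permModule_iff] at hf
    rw [hseg]
    refine ⟨hf.2, hf.1, fun q hq C hC x hx y hy => hinv _ ?_⟩
    rw [youngSubgroup_eq a hT]
    refine swap_mem_setwiseStabilizer (C := C) ?_ hx hy
    rw [mem_levelBlocks_iff hq] at hC
    rwa [mem_levelBlocks_iff le_rfl]
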